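/- Let $\mathcal H,\mathcal K$ be separable complex Hilbert spaces. Write $\mathfrak T(\mathcal H)$ for the Banach space of trace-class operators with the trace norm, $\mathfrak T_+(\mathcal H)$ for its cone of positive operators, $\mathfrak S(\mathcal H)=\{\rho\in\mathfrak T_+(\mathcal H):\operatorname{Tr}\rho=1\}$ for the set of states and $\mathfrak B(\mathcal H)$ for the bounded operators. Let $\eta(x)=-x\log x$ (with $\eta(0)=0$). The quantum entropy of $A\in\mathfrak T_+(\mathcal K)$ is $H(A)=\operatorname{Tr}\eta(A)-\eta(\operatorname{Tr}A)\in[0,+\infty]$, and the classical entropy of a summable family of numbers $x_i\ge 0$ is $H(\{x_i\})=\sum_i\eta(x_i)-\eta\left(\sum_i x_i\right)\in[0,+\infty]$. Let $\Phi:\mathfrak T(\mathcal H)\to\mathfrak T(\mathcal K)$ be a linear map that is positive ($\Phi(A)\ge 0$ for $A\ge 0$) and trace-non-increasing ($\operatorname{Tr}\Phi(A)\le\operatorname{Tr}A$ for $A\ge 0$), and let $\Phi^*:\mathfrak B(\mathcal K)\to\mathfrak B(\mathcal H)$ be its dual map, defined by $\operatorname{Tr}\Phi(\rho)B=\operatorname{Tr}\rho\,\Phi^*(B)$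 for all $\rho\in\mathfrak S(\mathcal H)$, $B\in\mathfrak B(\mathcal K)$. The following properties are equivalent (orthonormal bases are finite or countable; continuity is with respect to the trace norm and includes finiteness): (i) $H(\Phi(\rho))<+\infty$ for all $\rho\in\mathfrak S(\mathcal H)$; (ii) the function $\rho\mapsto H(\Phi(\rho))$ is continuous and bounded on $\mathfrak S(\mathcal H)$; (iii) there is an orthonormal basis $\{|i\rangle\}$ of $\mathcal K$ such that the function $\rho\mapsto H\left(\{\langle i|\Phi(\rho)|i\rangle\}_i\right)$ is continuous and bounded on $\mathfrak S(\mathcal H)$; (iv) there are an orthonormal basis $\{|i\rangle\}$ of $\mathcal K$ and numbers $h_i\ge 0$ such that $$\Bigl\|\sum_i h_i\,\Phi^*(|i\rangle\langle i|)\Bigr\|<+\infty\quad\text{and}\quad\sum_i e^{-h_i}<+\infty,$$ where the first condition means that the series of positive operators converges in the strong operator topology to a bounded operator. Moreover, let $\mathcal A\subset\mathfrak T_+(\mathcal H)$ be any convex, closed and bounded set such that, for every non-decreasing sequence $\{B_n\}$ of positive operators in $\Phi^*(\mathfrak B(\mathcal K))$, $$\sup_{A\in\mathcal A}\,\lim_{n\to\infty}\operatorname{Tr}AB_n<+\infty\quad\Longrightarrow\quad\sup_n\|B_n\|<+\infty.$$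 Then (ii), (iii) and (iv) are also equivalent to: $H(\Phi(A))<+\infty$ for all $A\in\mathcal A$. That is, $\mathfrak S(\mathcal H)$ in (i) can be replaced by $\mathcal A$. -/

import Mathlib

noncomputable section

open scoped InnerProductSpace ENNReal Topology ComplexOrder
open Filter

namespace QuantumEntropy

universe u v w

section Operators

set_option linter.unusedSectionVars false

variable {H : Type u} [NormedAddCommGroup H] [InnerProductSpace ℂ H] [CompleteSpace H]
variable {K : Type v} [NormedAddCommGroup K] [InnerProductSpace ℂ K] [CompleteSpace K]

theorem tsum_enorm_inner_sq {ι : Type w} (b : HilbertBasis ι ℂ H) (x : H) :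
    ∑' i, ‖⟪b i, x⟫_ℂ‖ₑ ^ 2 = ‖x‖ₑ ^ 2 := by
  have h := b.hasSum_inner_mul_inner x x
  have h2 : HasSum (fun i => ‖⟪b i, x⟫_ℂ‖ ^ 2) (‖x‖ ^ 2) := by
    have h3 := Complex.hasSum_re h
    convert h3 using 1
    · funext i
      rw [← inner_conj_symm x (b i), mul_comm, Complex.mul_conj, Complex.normSq_eq_norm_sq]
      norm_cast
    · rw [inner_self_eq_norm_sq_to_K]
      norm_cast
  have h4 := ENNReal.ofReal_tsum_of_nonneg (fun i => by positivity) h2.summable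
  rw [h2.tsum_eq, ENNReal.ofReal_pow (norm_nonneg _), ofReal_norm] at h4
  rw [h4]
  congr 1; funext i
  rw [ENNReal.ofReal_pow (norm_nonneg _), ofReal_norm]

theorem tsum_enorm_sq_adjoint {ι κ : Type*} (b : HilbertBasis ι ℂ H) (c : HilbertBasis κ ℂ K)
    (S : H →L[ℂ] K) :
    ∑' i, ‖S (b i)‖ₑ ^ 2 = ∑' j, ‖S.adjoint (c j)‖ₑ ^ 2 := by
  simp_rw [← tsum_enorm_inner_sq c (S _), ← tsum_enorm_inner_sq b (S.adjoint _)]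
  rw [ENNReal.tsum_comm]
  congr 1; funext j; congr 1; funext i
  rw [ContinuousLinearMap.adjoint_inner_right, ← inner_conj_symm, RCLike.enorm_conj]

theorem tsum_enorm_sq_comp_le {ι : Type*} (b : HilbertBasis ι ℂ H) (S V : H →L[ℂ] H) :
    ∑' i, ‖S (V (b i))‖ₑ ^ 2 ≤ ‖V‖ₑ ^ 2 * ∑' i, ‖S (b i)‖ₑ ^ 2 := by
  have h1 := tsum_enorm_sq_adjoint b b (S ∘L V)
  have h2 := tsum_enorm_sq_adjoint b b S
  simp only [ContinuousLinearMap.comp_apply] at h1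
  rw [h1, h2, ← ENNReal.tsum_mul_left]
  refine ENNReal.tsum_le_tsum fun i => ?_
  rw [ContinuousLinearMap.adjoint_comp, ContinuousLinearMap.comp_apply, ← mul_pow]
  gcongr
  refine (ContinuousLinearMap.le_opENorm _ _).trans ?_
  gcongr
  rw [← ofReal_norm, ← ofReal_norm, LinearIsometryEquiv.norm_map]

theorem exists_regular_inverse {A : Type*} [CStarAlgebra A] [PartialOrder A] [StarOrderedRing A]
    {a : A} (ha : 0 ≤ a) {ε : ℝ} (hε : 0 < ε) :
    ∃ G : A, star G = G ∧ G * a = a * G ∧ ‖a * G‖ ≤ 1 ∧ ‖a - a * G * a‖ ≤ ε := by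
  have hsa : IsSelfAdjoint a := .of_nonneg ha
  have hpos : ∀ x ∈ spectrum ℝ a, 0 ≤ x := fun x hx => spectrum_nonneg_of_nonneg ha hx
  obtain ⟨g, hg, hgx⟩ : ∃ g : ℝ → ℝ, Continuous g ∧ ∀ x, 0 ≤ x → g x = (x + ε)⁻¹ := by
    refine ⟨fun x => (|x| + ε)⁻¹, ?_, fun x hx => by simp [abs_of_nonneg hx]⟩
    exact Continuous.inv₀ (by fun_prop) fun x => by positivity
  have hid : cfc (fun x : ℝ => x) a = a := cfc_id' ℝ a
  have hGa : cfc g a * a = cfc (fun x => g x * x) a := by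
    rw [cfc_mul g (fun x => x) a hg.continuousOn continuousOn_id, hid]
  have haG : a * cfc g a = cfc (fun x => x * g x) a := by
    rw [cfc_mul (fun x => x) g a continuousOn_id hg.continuousOn, hid]
  have haGa : a * cfc g a * a = cfc (fun x => x * g x * x) a := by
    rw [cfc_mul (fun x => x * g x) (fun x => x) a (continuousOn_id.mul hg.continuousOn)
      continuousOn_id, hid, haG]
  have hsub : a - a * cfc g a * a = cfc (fun x => x - x * g x * x) a := by
    rw [cfc_sub (fun x => x) (fun x => x * g x * x) a continuousOn_id
      ((continuousOn_id.mul hg.continuousOn).mul continuousOn_id), hid, haGa]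
  refine ⟨cfc g a, cfc_predicate g a, ?_, ?_, ?_⟩
  · rw [hGa, haG]; simp_rw [mul_comm]
  · rw [haG]
    refine norm_cfc_le zero_le_one fun x hx => ?_
    have h0 := hpos x hx
    rw [hgx x h0, Real.norm_of_nonneg (by positivity), ← div_eq_mul_inv,
      div_le_one (by positivity)]
    linarith
  · rw [hsub]
    refine norm_cfc_le hε.le fun x hx => ?_
    have h0 := hpos x hx
    have : x - x * g x * x = ε * (x / (x + ε)) := by
      rw [hgx x h0]; field_simp; ring
    rw [this, Real.norm_of_nonneg (by positivity)]
    have : x / (x + ε) ≤ 1 := by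
      rw [div_le_one (by positivity)]; linarith
    nlinarith

theorem exists_approx_polar (T : H →L[ℂ] H) {ε : ℝ} (hε : 0 < ε) :
    ∃ U : H →L[ℂ] H, ‖U‖ ≤ 1 ∧ ‖T - U * CFC.abs T‖ ≤ ε ∧ ‖CFC.abs T - star U * T‖ ≤ ε := by
  have ha0 : 0 ≤ CFC.abs T := CFC.abs_nonneg T
  have hsa : star (CFC.abs T) = CFC.abs T := IsSelfAdjoint.of_nonneg ha0
  have haa : star T * T = CFC.abs T * CFC.abs T := (CFC.abs_mul_abs T).symm
  obtain ⟨G, hG, hc, h1, h2⟩ := exists_regular_inverse ha0 hε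
  generalize CFC.abs T = a at *
  have key : ∀ X : H →L[ℂ] H, ‖T * X‖ = ‖a * X‖ := by
    intro X
    have : ‖T * X‖ * ‖T * X‖ = ‖a * X‖ * ‖a * X‖ := by
      rw [← CStarRing.norm_star_mul_self, ← CStarRing.norm_star_mul_self (x := a * X)]
      congr 1
      rw [star_mul, star_mul, hsa, mul_assoc, ← mul_assoc (star T), haa]
      simp only [mul_assoc]
    nlinarith [norm_nonneg (T * X), norm_nonneg (a * X),
      mul_self_inj_of_nonneg (norm_nonneg (T * X)) (norm_nonneg (a * X)) |>.mp this]
  refine ⟨T * G, ?_, ?_, ?_⟩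
  · rw [key]; exact h1
  · have : T - T * G * a = T * (1 - G * a) := by noncomm_ring
    rw [this, key]
    have h3 : a * (1 - G * a) = a - a * G * a := by noncomm_ring
    rw [h3]; exact h2
  · rw [star_mul, hG, mul_assoc, haa, ← mul_assoc, hc]
    exact h2

/-- The reference orthonormal basis of `H` used to write traces. -/
def stdIndex (H : Type u) [NormedAddCommGroup H] [InnerProductSpace ℂ H] [CompleteSpace H] :
    Set H :=
  Classical.choose (exists_hilbertBasis ℂ H)

/-- The reference orthonormal basis of `H` used to write traces. -/
def stdBasis (H : Type u) [NormedAddCommGroup H] [InnerProductSpace ℂ H] [CompleteSpace H] :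
    HilbertBasis (stdIndex H) ℂ H :=
  Classical.choose (Classical.choose_spec (exists_hilbertBasis ℂ H))

/-- The trace `∑ ⟨i|T|i⟩ ∈ [0, ∞]` of a positive operator `T`. -/
def posTrace (T : H →L[ℂ] H) : ℝ≥0∞ :=
  ∑' i, ENNReal.ofReal (⟪stdBasis H i, T (stdBasis H i)⟫_ℂ).re

/-- The trace norm `Tr |T| ∈ [0, ∞]`, where `|T| = √(T* T)`. -/
def traceNorm (T : H →L[ℂ] H) : ℝ≥0∞ := posTrace (CFC.abs T)

/-- The trace `∑ ⟨i|T|i⟩` of an operator `T` of trace class. -/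
def trace (T : H →L[ℂ] H) : ℂ := ∑' i, ⟪stdBasis H i, T (stdBasis H i)⟫_ℂ

theorem inner_eq_sqrt {T : H →L[ℂ] H} (hT : 0 ≤ T) (x y : H) :
    ⟪x, T y⟫_ℂ = ⟪CFC.sqrt T x, CFC.sqrt T y⟫_ℂ := by
  have h : CFC.sqrt T * CFC.sqrt T = T := CFC.sqrt_mul_sqrt_self T hT
  have hs : (CFC.sqrt T).adjoint = CFC.sqrt T := IsSelfAdjoint.of_nonneg (CFC.sqrt_nonneg T)
  conv_lhs => rw [← h, mul_apply_eq_comp]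
  rw [← ContinuousLinearMap.adjoint_inner_left, hs]

theorem ofReal_inner_eq {T : H →L[ℂ] H} (hT : 0 ≤ T) (x : H) :
    ENNReal.ofReal (⟪x, T x⟫_ℂ).re = ‖CFC.sqrt T x‖ₑ ^ 2 := by
  rw [inner_eq_sqrt hT, inner_self_eq_norm_sq_to_K, ← ofReal_norm,
    ← ENNReal.ofReal_pow (norm_nonneg _)]
  norm_cast

/-- The trace of a positive operator can be computed in any orthonormal basis. -/
theorem posTrace_eq_tsum {T : H →L[ℂ] H} (hT : 0 ≤ T) {ι : Type*} (b : HilbertBasis ι ℂ H) :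
    posTrace T = ∑' i, ENNReal.ofReal (⟪b i, T (b i)⟫_ℂ).re := by
  unfold posTrace
  simp_rw [ofReal_inner_eq hT]
  rw [tsum_enorm_sq_adjoint (stdBasis H) b,
    show (CFC.sqrt T).adjoint = CFC.sqrt T from IsSelfAdjoint.of_nonneg (CFC.sqrt_nonneg T)]

theorem traceNorm_of_nonneg {T : H →L[ℂ] H} (hT : 0 ≤ T) : traceNorm T = posTrace T := by
  rw [traceNorm, CFC.abs_of_nonneg T hT]

theorem sum_enorm_inner_abs_le {T : H →L[ℂ] H} (hT : 0 ≤ T) {ι : Type*}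
    (b : HilbertBasis ι ℂ H) (W V : H →L[ℂ] H) (F : Finset ι) :
    ∑ i ∈ F, ‖⟪W (b i), T (V (b i))⟫_ℂ‖ₑ ≤ ‖W‖ₑ * ‖V‖ₑ * posTrace T := by
  have hb : posTrace T = ∑' i, ‖CFC.sqrt T (b i)‖ₑ ^ 2 := by
    rw [posTrace_eq_tsum hT b]; simp_rw [ofReal_inner_eq hT]
  have hV : ∀ X : H →L[ℂ] H, (∑ i ∈ F, ‖CFC.sqrt T (X (b i))‖ₑ ^ (2 : ℝ)) ^ (1 / 2 : ℝ) ≤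
      ‖X‖ₑ * posTrace T ^ (1 / 2 : ℝ) := by
    intro X
    have h1 : ∑ i ∈ F, ‖CFC.sqrt T (X (b i))‖ₑ ^ (2 : ℝ) ≤ ‖X‖ₑ ^ (2 : ℝ) * posTrace T := by
      simp_rw [ENNReal.rpow_two]
      rw [hb]
      exact (ENNReal.sum_le_tsum F).trans (tsum_enorm_sq_comp_le b _ X)
    refine (ENNReal.rpow_le_rpow h1 (by norm_num)).trans_eq ?_
    rw [ENNReal.mul_rpow_of_nonneg _ _ (by norm_num), ← ENNReal.rpow_mul]
    norm_num
  calc ∑ i ∈ F, ‖⟪W (b i), T (V (b i))⟫_ℂ‖ₑ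
      ≤ ∑ i ∈ F, ‖CFC.sqrt T (W (b i))‖ₑ * ‖CFC.sqrt T (V (b i))‖ₑ := by
        refine Finset.sum_le_sum fun i _ => ?_
        rw [inner_eq_sqrt hT, ← ofReal_norm, ← ofReal_norm, ← ofReal_norm,
          ← ENNReal.ofReal_mul (norm_nonneg _)]
        exact ENNReal.ofReal_le_ofReal (norm_inner_le_norm _ _)
    _ ≤ _ := ENNReal.inner_le_Lp_mul_Lq F _ _ Real.HolderConjugate.two_two
    _ ≤ (‖W‖ₑ * posTrace T ^ (1 / 2 : ℝ)) * (‖V‖ₑ * posTrace T ^ (1 / 2 : ℝ)) := by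
        gcongr
        · exact hV W
        · exact hV V
    _ = ‖W‖ₑ * ‖V‖ₑ * (posTrace T ^ (1 / 2 : ℝ) * posTrace T ^ (1 / 2 : ℝ)) := by ring
    _ = _ := by
        rw [← ENNReal.rpow_add_of_nonneg _ _ (by norm_num) (by norm_num)]
        norm_num

theorem sum_enorm_inner_le (T : H →L[ℂ] H) {ι : Type*} (b : HilbertBasis ι ℂ H)
    (W V : H →L[ℂ] H) (F : Finset ι) :
    ∑ i ∈ F, ‖⟪W (b i), T (V (b i))⟫_ℂ‖ₑ ≤ ‖W‖ₑ * ‖V‖ₑ * traceNorm T := by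
  have hbn : ∀ i, ‖b i‖ = 1 := b.orthonormal.1
  have key : ∀ n : ℕ, ∑ i ∈ F, ‖⟪W (b i), T (V (b i))⟫_ℂ‖ₑ ≤ ‖W‖ₑ * ‖V‖ₑ * traceNorm T +
      F.card * ENNReal.ofReal (‖W‖ * ‖V‖ * (1 / ((n : ℝ) + 1))) := by
    intro n
    obtain ⟨U, hU, h1, -⟩ := exists_approx_polar T (ε := 1 / ((n : ℝ) + 1)) (by positivity)
    have h2 : ∀ i, ‖⟪W (b i), T (V (b i))⟫_ℂ‖ₑ ≤
        ‖⟪(U.adjoint ∘L W) (b i), CFC.abs T (V (b i))⟫_ℂ‖ₑ +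
          ENNReal.ofReal (‖W‖ * ‖V‖ * (1 / ((n : ℝ) + 1))) := by
      intro i
      have h3 : ⟪W (b i), T (V (b i))⟫_ℂ = ⟪(U.adjoint ∘L W) (b i), CFC.abs T (V (b i))⟫_ℂ +
          ⟪W (b i), (T - U * CFC.abs T) (V (b i))⟫_ℂ := by
        rw [ContinuousLinearMap.comp_apply, ContinuousLinearMap.adjoint_inner_left,
          sub_apply, inner_sub_right, mul_apply_eq_comp]
        ring
      rw [h3]
      refine (enorm_add_le _ _).trans ?_
      gcongr
      rw [← ofReal_norm]
      refine ENNReal.ofReal_le_ofReal ((norm_inner_le_norm _ _).trans ?_)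
      have h4 : ‖W (b i)‖ ≤ ‖W‖ := by simpa [hbn] using W.le_opNorm (b i)
      have h5 : ‖V (b i)‖ ≤ ‖V‖ := by simpa [hbn] using V.le_opNorm (b i)
      calc ‖W (b i)‖ * ‖(T - U * CFC.abs T) (V (b i))‖
          ≤ ‖W‖ * (‖T - U * CFC.abs T‖ * ‖V (b i)‖) := by
            gcongr; exact ContinuousLinearMap.le_opNorm _ _
        _ ≤ ‖W‖ * ((1 / ((n : ℝ) + 1)) * ‖V‖) := by gcongr
        _ = _ := by ring
    refine (Finset.sum_le_sum fun i _ => h2 i).trans ?_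
    rw [Finset.sum_add_distrib, Finset.sum_const, nsmul_eq_mul]
    gcongr
    refine (sum_enorm_inner_abs_le (CFC.abs_nonneg T) b _ V F).trans ?_
    rw [traceNorm]
    gcongr
    rw [← ofReal_norm, ← ofReal_norm]
    refine ENNReal.ofReal_le_ofReal ((ContinuousLinearMap.opNorm_comp_le _ _).trans ?_)
    rw [LinearIsometryEquiv.norm_map]
    nlinarith [norm_nonneg W]
  have hlim : Tendsto (fun n : ℕ => ‖W‖ₑ * ‖V‖ₑ * traceNorm T +
      F.card * ENNReal.ofReal (‖W‖ * ‖V‖ * (1 / ((n : ℝ) + 1)))) atTop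
      (𝓝 (‖W‖ₑ * ‖V‖ₑ * traceNorm T + F.card * ENNReal.ofReal (‖W‖ * ‖V‖ * 0))) := by
    refine Tendsto.add tendsto_const_nhds (ENNReal.Tendsto.const_mul ?_ (Or.inr (by simp)))
    exact ENNReal.tendsto_ofReal (tendsto_one_div_add_atTop_nhds_zero_nat.const_mul _)
  simpa using ge_of_tendsto' hlim key

theorem traceNorm_le_of_forall (T : H →L[ℂ] H) (C : ℝ≥0∞)
    (hC : ∀ (W : H →L[ℂ] H) (F : Finset (stdIndex H)), ‖W‖ ≤ 1 →
      ∑ i ∈ F, ‖⟪W (stdBasis H i), T (stdBasis H i)⟫_ℂ‖ₑ ≤ C) : traceNorm T ≤ C := by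
  have hbn : ∀ i, ‖stdBasis H i‖ = 1 := (stdBasis H).orthonormal.1
  rw [traceNorm, posTrace, ENNReal.tsum_eq_iSup_sum]
  refine iSup_le fun F => ?_
  have key : ∀ n : ℕ, ∑ i ∈ F, ENNReal.ofReal
      (⟪stdBasis H i, CFC.abs T (stdBasis H i)⟫_ℂ).re ≤
        C + F.card * ENNReal.ofReal (1 / ((n : ℝ) + 1)) := by
    intro n
    obtain ⟨U, hU, -, h1⟩ := exists_approx_polar T (ε := 1 / ((n : ℝ) + 1)) (by positivity)
    have h2 : ∀ i, ENNReal.ofReal (⟪stdBasis H i, CFC.abs T (stdBasis H i)⟫_ℂ).re ≤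
        ‖⟪U (stdBasis H i), T (stdBasis H i)⟫_ℂ‖ₑ + ENNReal.ofReal (1 / ((n : ℝ) + 1)) := by
      intro i
      have h3 : ⟪stdBasis H i, CFC.abs T (stdBasis H i)⟫_ℂ =
          ⟪U (stdBasis H i), T (stdBasis H i)⟫_ℂ +
          ⟪stdBasis H i, (CFC.abs T - star U * T) (stdBasis H i)⟫_ℂ := by
        rw [sub_apply, inner_sub_right, mul_apply_eq_comp,
          ContinuousLinearMap.star_eq_adjoint, ContinuousLinearMap.adjoint_inner_right]
        ring
      rw [← ofReal_norm, ← ENNReal.ofReal_add (norm_nonneg _) (by positivity)]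
      refine ENNReal.ofReal_le_ofReal ((Complex.re_le_norm _).trans ?_)
      rw [h3]
      refine (norm_add_le _ _).trans ?_
      gcongr
      refine (norm_inner_le_norm _ _).trans ?_
      rw [hbn, one_mul]
      refine (ContinuousLinearMap.le_opNorm _ _).trans ?_
      rw [hbn, mul_one]
      exact h1
    refine (Finset.sum_le_sum fun i _ => h2 i).trans ?_
    rw [Finset.sum_add_distrib, Finset.sum_const, nsmul_eq_mul]
    gcongr
    exact hC U F hU
  have hlim : Tendsto (fun n : ℕ => C + F.card * ENNReal.ofReal (1 / ((n : ℝ) + 1))) atTop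
      (𝓝 (C + F.card * ENNReal.ofReal 0)) := by
    refine Tendsto.add tendsto_const_nhds (ENNReal.Tendsto.const_mul ?_ (Or.inr (by simp)))
    exact ENNReal.tendsto_ofReal tendsto_one_div_add_atTop_nhds_zero_nat
  simpa using ge_of_tendsto' hlim key

theorem enorm_le_one {W : H →L[ℂ] H} (hW : ‖W‖ ≤ 1) : ‖W‖ₑ ≤ 1 := by
  rw [← ofReal_norm]; exact ENNReal.ofReal_le_one.mpr hW

theorem traceNorm_add_le (S T : H →L[ℂ] H) :
    traceNorm (S + T) ≤ traceNorm S + traceNorm T := by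
  refine traceNorm_le_of_forall _ _ fun W F hW => ?_
  have hid : ‖ContinuousLinearMap.id ℂ H‖ ≤ 1 := ContinuousLinearMap.norm_id_le
  have h : ∀ R : H →L[ℂ] H, ∑ i ∈ F, ‖⟪W (stdBasis H i), R (stdBasis H i)⟫_ℂ‖ₑ ≤ traceNorm R := by
    intro R
    refine (sum_enorm_inner_le R (stdBasis H) W (ContinuousLinearMap.id ℂ H) F).trans ?_
    calc _ ≤ 1 * 1 * traceNorm R := by
          gcongr
          · exact enorm_le_one hW
          · exact enorm_le_one hid
      _ = _ := by simp
  calc _ ≤ ∑ i ∈ F, (‖⟪W (stdBasis H i), S (stdBasis H i)⟫_ℂ‖ₑ +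
        ‖⟪W (stdBasis H i), T (stdBasis H i)⟫_ℂ‖ₑ) := by
        refine Finset.sum_le_sum fun i _ => ?_
        rw [add_apply, inner_add_right]
        exact enorm_add_le _ _
    _ ≤ _ := by
        rw [Finset.sum_add_distrib]
        exact add_le_add (h S) (h T)

theorem traceNorm_smul (c : ℂ) (T : H →L[ℂ] H) : traceNorm (c • T) = ‖c‖ₑ * traceNorm T := by
  rw [traceNorm, traceNorm, CFC.abs_smul, posTrace, posTrace, ← ENNReal.tsum_mul_left]
  congr 1; funext i
  rw [smul_apply, inner_smul_right_eq_smul, Complex.real_smul,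
    Complex.re_ofReal_mul, ENNReal.ofReal_mul (norm_nonneg _), ofReal_norm]

theorem eq_zero_of_traceNorm_eq_zero {T : H →L[ℂ] H} (h : traceNorm T = 0) : T = 0 := by
  rw [traceNorm, posTrace, ENNReal.tsum_eq_zero] at h
  have h0 := CFC.abs_nonneg T
  have h1 : CFC.sqrt (CFC.abs T) = 0 := by
    ext x
    have hx := (stdBasis H).hasSum_repr x
    have hy := hx.mapL (CFC.sqrt (CFC.abs T))
    have : ∀ i, CFC.sqrt (CFC.abs T) ((stdBasis H).repr x i • stdBasis H i) = 0 := by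
      intro i
      have := h i
      rw [ofReal_inner_eq h0] at this
      simp only [ne_eq, OfNat.ofNat_ne_zero, not_false_eq_true, pow_eq_zero_iff,
        enorm_eq_zero] at this
      rw [map_smul, this, smul_zero]
    simp_rw [this] at hy
    exact hy.unique hasSum_zero
  have h2 : CFC.abs T = 0 := by rw [← CFC.sqrt_mul_sqrt_self (CFC.abs T) h0, h1, mul_zero]
  exact CFC.abs_eq_zero_iff.mp h2

/-- The trace-class operators, as a linear subspace of the bounded operators. -/
def traceClassSubmodule (H : Type u) [NormedAddCommGroup H] [InnerProductSpace ℂ H]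
    [CompleteSpace H] : Submodule ℂ (H →L[ℂ] H) where
  carrier := {T | traceNorm T < ⊤}
  zero_mem' := by simp [traceNorm, posTrace]
  add_mem' {S T} hS hT := (traceNorm_add_le S T).trans_lt (ENNReal.add_lt_top.mpr ⟨hS, hT⟩)
  smul_mem' c T hT := by
    rw [Set.mem_ofPred_eq, traceNorm_smul]
    exact ENNReal.mul_lt_top enorm_lt_top hT

/-- The space of trace-class operators on `H`. It is a type of its own, so that its norm and its
topology are those of the trace norm and not those of the operator norm. -/
def TraceClass (H : Type u) [NormedAddCommGroup H] [InnerProductSpace ℂ H] [CompleteSpace H] :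
    Type u :=
  traceClassSubmodule H

namespace TraceClass

instance : AddCommGroup (TraceClass H) := inferInstanceAs (AddCommGroup (traceClassSubmodule H))

instance : Module ℂ (TraceClass H) := inferInstanceAs (Module ℂ (traceClassSubmodule H))

/-- The bounded operator underlying a trace-class operator. -/
def toCLM : TraceClass H →ₗ[ℂ] (H →L[ℂ] H) := (traceClassSubmodule H).subtype

/-- A bounded operator of finite trace norm as a trace-class operator. -/
def mk (T : H →L[ℂ] H) (hT : traceNorm T < ⊤) : TraceClass H := ⟨T, hT⟩

theorem toCLM_injective : Function.Injective (toCLM (H := H)) := Subtype.val_injective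

theorem traceNorm_lt_top (A : TraceClass H) : traceNorm A.toCLM < ⊤ := A.2

@[simp] theorem toCLM_mk (T : H →L[ℂ] H) (hT : traceNorm T < ⊤) : (mk T hT).toCLM = T := rfl

instance : Norm (TraceClass H) := ⟨fun A => (traceNorm A.toCLM).toReal⟩

theorem norm_def (A : TraceClass H) : ‖A‖ = (traceNorm A.toCLM).toReal := rfl

theorem normedSpaceCore : NormedSpace.Core ℂ (TraceClass H) where
  norm_nonneg _ := ENNReal.toReal_nonneg
  norm_smul c A := by
    rw [norm_def, norm_def, map_smul, traceNorm_smul, ENNReal.toReal_mul, toReal_enorm]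
  norm_triangle A B := by
    rw [norm_def, norm_def, norm_def, map_add,
      ← ENNReal.toReal_add A.traceNorm_lt_top.ne B.traceNorm_lt_top.ne]
    exact ENNReal.toReal_mono (ENNReal.add_lt_top.mpr
      ⟨A.traceNorm_lt_top, B.traceNorm_lt_top⟩).ne (traceNorm_add_le _ _)
  norm_eq_zero_iff A := by
    refine ⟨fun h => ?_, fun h => ?_⟩
    · rw [norm_def, ENNReal.toReal_eq_zero_iff] at h
      refine toCLM_injective ?_
      rw [map_zero]
      exact eq_zero_of_traceNorm_eq_zero (h.resolve_right A.traceNorm_lt_top.ne)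
    · rw [h, norm_def, map_zero]
      simp [traceNorm, posTrace]

/-- The trace norm makes the trace-class operators a normed space. -/
instance : NormedAddCommGroup (TraceClass H) := NormedAddCommGroup.ofCore normedSpaceCore

instance : NormedSpace ℂ (TraceClass H) := NormedSpace.ofCore normedSpaceCore

/-- The trace of a trace-class operator. -/
def tr (A : TraceClass H) : ℂ := trace A.toCLM

theorem hasSum_trace_mul (A : TraceClass H) (B : H →L[ℂ] H) :
    Summable (fun i => ⟪stdBasis H i, (A.toCLM * B) (stdBasis H i)⟫_ℂ) ∧
      ‖trace (A.toCLM * B)‖ ≤ ‖B‖ * ‖A‖ := by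
  have h : ∑' i, ‖⟪stdBasis H i, (A.toCLM * B) (stdBasis H i)⟫_ℂ‖ₑ ≤ ‖B‖ₑ * traceNorm A.toCLM := by
    rw [ENNReal.tsum_eq_iSup_sum]
    refine iSup_le fun F => ?_
    have := sum_enorm_inner_le A.toCLM (stdBasis H) (ContinuousLinearMap.id ℂ H) B F
    refine this.trans ?_
    calc _ ≤ 1 * ‖B‖ₑ * traceNorm A.toCLM := by
          gcongr
          exact enorm_le_one ContinuousLinearMap.norm_id_le
      _ = _ := by simp
  have hfin : ‖B‖ₑ * traceNorm A.toCLM < ⊤ := ENNReal.mul_lt_top enorm_lt_top A.traceNorm_lt_top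
  have hs : Summable (fun i => ‖⟪stdBasis H i, (A.toCLM * B) (stdBasis H i)⟫_ℂ‖) := by
    have h2 := ENNReal.summable_toReal (h.trans_lt hfin).ne
    simpa only [toReal_enorm] using h2
  refine ⟨hs.of_norm, ?_⟩
  refine (norm_tsum_le_tsum_norm hs).trans ?_
  have h3 := ENNReal.toReal_mono hfin.ne h
  rw [ENNReal.toReal_mul, toReal_enorm, ENNReal.tsum_toReal_eq (by simp)] at h3
  rw [norm_def]
  simpa only [toReal_enorm] using h3

/-- The functional `A ↦ Tr A B` on trace-class operators given by a bounded operator `B`. -/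
def pairing (B : H →L[ℂ] H) : TraceClass H →ₗ[ℂ] ℂ where
  toFun A := trace (A.toCLM * B)
  map_add' A A' := by
    rw [trace, trace, trace, ← (hasSum_trace_mul A B).1.tsum_add (hasSum_trace_mul A' B).1]
    congr 1; funext i
    rw [map_add, add_mul, add_apply, inner_add_right]
  map_smul' c A := by
    rw [trace, trace, RingHom.id_apply, smul_eq_mul, ← tsum_mul_left]
    congr 1; funext i
    rw [map_smul, smul_mul_assoc, smul_apply, inner_smul_right]

theorem pairing_apply (A : TraceClass H) (B : H →L[ℂ] H) : pairing B A = trace (A.toCLM * B) := rfl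

theorem norm_pairing_le (A : TraceClass H) (B : H →L[ℂ] H) : ‖pairing B A‖ ≤ ‖B‖ * ‖A‖ :=
  (hasSum_trace_mul A B).2

theorem tr_eq_pairing (A : TraceClass H) : A.tr = pairing 1 A := by
  rw [pairing_apply, mul_one, tr]

theorem norm_eq_tr {A : TraceClass H} (hA : 0 ≤ A.toCLM) : ‖A‖ = A.tr.re := by
  have h := (hasSum_trace_mul A 1).1
  rw [mul_one] at h
  rw [norm_def, traceNorm_of_nonneg hA, posTrace, tr, trace, Complex.re_tsum h,
    ENNReal.tsum_toReal_eq (by simp)]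
  congr 1; funext i
  refine ENNReal.toReal_ofReal ?_
  exact ((ContinuousLinearMap.nonneg_iff_isPositive _).mp hA).re_inner_nonneg_right _

theorem traceNorm_rankOne_lt_top (x y : H) :
    traceNorm (InnerProductSpace.rankOne ℂ x y) < ⊤ := by
  have h : traceNorm (InnerProductSpace.rankOne ℂ x y) ≤ ENNReal.ofReal (‖x‖ ^ 2 + ‖y‖ ^ 2) := by
    refine traceNorm_le_of_forall _ _ fun W F hW => ?_
    have hB : ∀ z : H, ∑ i ∈ F, ‖⟪stdBasis H i, z⟫_ℂ‖ ^ 2 ≤ ‖z‖ ^ 2 := fun z =>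
      (stdBasis H).orthonormal.sum_inner_products_le z
    have h1 : ∑ i ∈ F, ‖⟪W (stdBasis H i),
        InnerProductSpace.rankOne ℂ x y (stdBasis H i)⟫_ℂ‖ ≤ ‖x‖ ^ 2 + ‖y‖ ^ 2 := by
      calc _ ≤ ∑ i ∈ F, (‖⟪stdBasis H i, W.adjoint x⟫_ℂ‖ ^ 2 + ‖⟪stdBasis H i, y⟫_ℂ‖ ^ 2) := by
            refine Finset.sum_le_sum fun i _ => ?_
            rw [InnerProductSpace.rankOne_apply, inner_smul_right, norm_mul,
              ContinuousLinearMap.adjoint_inner_right, norm_inner_symm y]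
            nlinarith [sq_nonneg (‖⟪W (stdBasis H i), x⟫_ℂ‖ - ‖⟪stdBasis H i, y⟫_ℂ‖),
              sq_nonneg (‖⟪W (stdBasis H i), x⟫_ℂ‖), sq_nonneg (‖⟪stdBasis H i, y⟫_ℂ‖)]
        _ ≤ ‖W.adjoint x‖ ^ 2 + ‖y‖ ^ 2 := by
            rw [Finset.sum_add_distrib]
            exact add_le_add (hB _) (hB _)
        _ ≤ _ := by
            have : ‖W.adjoint x‖ ≤ 1 * ‖x‖ := by
              refine (ContinuousLinearMap.le_opNorm _ _).trans ?_
              rw [LinearIsometryEquiv.norm_map]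
              gcongr
            rw [one_mul] at this
            gcongr
    refine le_trans (le_of_eq ?_) (ENNReal.ofReal_le_ofReal h1)
    rw [ENNReal.ofReal_sum_of_nonneg fun i _ => norm_nonneg _]
    simp_rw [ofReal_norm]
  exact h.trans_lt ENNReal.ofReal_lt_top

/-- The operator `|x⟩⟨y|` as a trace-class operator. -/
def rankOne (x y : H) : TraceClass H :=
  mk (InnerProductSpace.rankOne ℂ x y) (traceNorm_rankOne_lt_top x y)

theorem toCLM_rankOne (x y : H) : (rankOne x y).toCLM = InnerProductSpace.rankOne ℂ x y := rfl

theorem toCLM_rankOne_self_nonneg (x : H) : 0 ≤ (rankOne x x).toCLM := by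
  rw [toCLM_rankOne, ContinuousLinearMap.nonneg_iff_isPositive]
  exact InnerProductSpace.isPositive_rankOne_self x

theorem pairing_rankOne (B : H →L[ℂ] H) (x y : H) : pairing B (rankOne x y) = ⟪y, B x⟫_ℂ := by
  rw [pairing_apply, trace, toCLM_rankOne, ← ContinuousLinearMap.adjoint_inner_left,
    ← (stdBasis H).tsum_inner_mul_inner]
  congr 1; funext i
  rw [mul_apply_eq_comp, InnerProductSpace.rankOne_apply, inner_smul_right,
    ContinuousLinearMap.adjoint_inner_left]

theorem tr_rankOne_self (x : H) : (rankOne x x).tr.re = ‖x‖ ^ 2 := by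
  rw [tr_eq_pairing, pairing_rankOne, one_apply_eq_self, inner_self_eq_norm_sq_to_K]
  norm_cast

/-- A functional that is bounded on positive operators is determined by its values on the
operators `|x⟩⟨x|`. -/
theorem eq_of_eq_rankOne {f : TraceClass H →ₗ[ℂ] ℂ} {C : ℝ}
    (hf : ∀ A : TraceClass H, 0 ≤ A.toCLM → ‖f A‖ ≤ C * ‖A‖)
    (hx : ∀ x, f (rankOne x x) = 0) {A : TraceClass H} (hA : 0 ≤ A.toCLM) : f A = 0 := by
  set S := CFC.sqrt A.toCLM with hS
  have hSs : S.adjoint = S := IsSelfAdjoint.of_nonneg (CFC.sqrt_nonneg A.toCLM)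
  set b := stdBasis H
  have hsum : HasSum (fun i => ‖S (b i)‖ ^ 2) ‖A‖ := by
    have h1 : posTrace A.toCLM = ∑' i, ‖S (b i)‖ₑ ^ 2 := by
      rw [posTrace]; simp_rw [ofReal_inner_eq hA]; rfl
    have h2 := A.traceNorm_lt_top
    rw [traceNorm_of_nonneg hA, h1] at h2
    have h3 := ENNReal.hasSum_toReal h2.ne
    rw [norm_def, traceNorm_of_nonneg hA, h1, ENNReal.tsum_toReal_eq (by simp)]
    simpa only [ENNReal.toReal_pow, toReal_enorm] using h3
  have hbd : ∀ F : Finset (stdIndex H), ‖f A‖ ≤ C * (‖A‖ - ∑ i ∈ F, ‖S (b i)‖ ^ 2) := by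
    intro F
    set R : TraceClass H := A - ∑ i ∈ F, rankOne (S (b i)) (S (b i)) with hR
    have hRpos : 0 ≤ R.toCLM := by
      rw [ContinuousLinearMap.nonneg_iff_isPositive, ContinuousLinearMap.isPositive_iff_complex]
      intro x
      have h1 : ⟪R.toCLM x, x⟫_ℂ = ((‖S x‖ ^ 2 - ∑ i ∈ F, ‖⟪b i, S x⟫_ℂ‖ ^ 2 : ℝ) : ℂ) := by
        rw [hR, map_sub, map_sum, sub_apply, inner_sub_left, sum_apply, sum_inner]
        push_cast
        congr 1
        · rw [← inner_conj_symm, inner_eq_sqrt hA, inner_self_eq_norm_sq_to_K]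
          simp [hS]
        · refine Finset.sum_congr rfl fun i _ => ?_
          rw [toCLM_rankOne, InnerProductSpace.rankOne_apply, inner_smul_left, inner_conj_symm,
            ← inner_conj_symm x (S (b i)), mul_comm, RCLike.mul_conj,
            ← ContinuousLinearMap.adjoint_inner_right, hSs]
          norm_cast
      have h2 := sub_nonneg.mpr (b.orthonormal.sum_inner_products_le (s := F) (S x))
      rw [h1]
      exact ⟨congrArg _ (RCLike.ofReal_re (K := ℂ) _), h2.trans_eq (RCLike.ofReal_re (K := ℂ) _).symm⟩
    have hRn : ‖R‖ = ‖A‖ - ∑ i ∈ F, ‖S (b i)‖ ^ 2 := by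
      rw [norm_eq_tr hRpos, norm_eq_tr hA, tr_eq_pairing, tr_eq_pairing, hR, map_sub, map_sum,
        Complex.sub_re, Complex.re_sum]
      congr 1
      refine Finset.sum_congr rfl fun i _ => ?_
      rw [← tr_eq_pairing, tr_rankOne_self]
    have hfR : f R = f A := by
      rw [hR, map_sub, map_sum, Finset.sum_eq_zero fun i _ => hx _, sub_zero]
    rw [← hfR, ← hRn]
    exact hf R hRpos
  have hlim : Tendsto (fun F : Finset (stdIndex H) => C * (‖A‖ - ∑ i ∈ F, ‖S (b i)‖ ^ 2)) atTop
      (𝓝 (C * (‖A‖ - ‖A‖))) := (tendsto_const_nhds.sub hsum).const_mul C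
  have h := ge_of_tendsto' hlim hbd
  rw [sub_self, mul_zero] at h
  exact norm_le_zero_iff.mp h

end TraceClass

open TraceClass

/-- The cone of positive trace-class operators. -/
def posCone (H : Type u) [NormedAddCommGroup H] [InnerProductSpace ℂ H] [CompleteSpace H] :
    Set (TraceClass H) :=
  {A | 0 ≤ A.toCLM}

/-- The set of states (density operators): the positive operators of trace one. -/
def states (H : Type u) [NormedAddCommGroup H] [InnerProductSpace ℂ H] [CompleteSpace H] :
    Set (TraceClass H) :=
  {A | A ∈ posCone H ∧ A.tr = 1}

/-- The positive trace-non-increasing linear maps from the trace-class operators on `H` to the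
trace-class operators on `K`. -/
structure PosTraceNonincMap (H : Type u) [NormedAddCommGroup H] [InnerProductSpace ℂ H] [CompleteSpace H]
    (K : Type v) [NormedAddCommGroup K] [InnerProductSpace ℂ K] [CompleteSpace K] where
  toLinearMap : TraceClass H →ₗ[ℂ] TraceClass K
  map_mem_posCone : ∀ A ∈ posCone H, toLinearMap A ∈ posCone K
  tr_map_le : ∀ A ∈ posCone H, (toLinearMap A).tr.re ≤ A.tr.re

namespace PosTraceNonincMap

instance : CoeFun (PosTraceNonincMap H K) (fun _ => TraceClass H → TraceClass K) :=
  ⟨fun Φ => Φ.toLinearMap⟩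

theorem norm_pairing_map_le (Φ : PosTraceNonincMap H K) (B : K →L[ℂ] K) {A : TraceClass H}
    (hA : 0 ≤ A.toCLM) : ‖pairing B (Φ A)‖ ≤ ‖B‖ * ‖A‖ := by
  refine (norm_pairing_le _ _).trans ?_
  gcongr
  rw [norm_eq_tr hA, norm_eq_tr (Φ.map_mem_posCone A hA)]
  exact Φ.tr_map_le A hA

theorem norm_pairing_map_rankOne_le (Φ : PosTraceNonincMap H K) (B : K →L[ℂ] K) (x y : H) :
    ‖pairing B (Φ (rankOne x y))‖ ≤ ‖B‖ * (‖x‖ ^ 2 + ‖y‖ ^ 2) := by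
  set f : TraceClass H →ₗ[ℂ] ℂ := pairing B ∘ₗ Φ.toLinearMap with hf
  have hr : ∀ z : H, ‖f (rankOne z z)‖ ≤ ‖B‖ * ‖z‖ ^ 2 := by
    intro z
    have := Φ.norm_pairing_map_le B (toCLM_rankOne_self_nonneg z)
    rwa [norm_eq_tr (toCLM_rankOne_self_nonneg z), tr_rankOne_self] at this
  have hpol : (4 : ℂ) • rankOne x y = rankOne (x + y) (x + y) - rankOne (x - y) (x - y) +
      Complex.I • rankOne (x + Complex.I • y) (x + Complex.I • y) -
      Complex.I • rankOne (x - Complex.I • y) (x - Complex.I • y) := by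
    apply toCLM_injective
    ext z
    simp only [map_add, map_sub, map_smul, toCLM_rankOne, add_apply, sub_apply, smul_apply,
      InnerProductSpace.rankOne_apply, inner_add_left, inner_sub_left, inner_smul_left,
      Complex.conj_I]
    match_scalars
    · linear_combination (2 * ⟪y, z⟫_ℂ) * Complex.I_sq
    · linear_combination (-2 * ⟪x, z⟫_ℂ) * Complex.I_sq
  have h4 : (4 : ℂ) * f (rankOne x y) = f (rankOne (x + y) (x + y)) -
      f (rankOne (x - y) (x - y)) +
      Complex.I * f (rankOne (x + Complex.I • y) (x + Complex.I • y)) -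
      Complex.I * f (rankOne (x - Complex.I • y) (x - Complex.I • y)) := by
    have := congrArg f hpol
    simpa only [map_add, map_sub, map_smul, smul_eq_mul] using this
  have h5 : 4 * ‖f (rankOne x y)‖ ≤ ‖B‖ * ‖x + y‖ ^ 2 + ‖B‖ * ‖x - y‖ ^ 2 +
      ‖B‖ * ‖x + Complex.I • y‖ ^ 2 + ‖B‖ * ‖x - Complex.I • y‖ ^ 2 := by
    calc 4 * ‖f (rankOne x y)‖ = ‖(4 : ℂ) * f (rankOne x y)‖ := by simp
      _ ≤ _ := by
        rw [h4]
        refine (norm_sub_le _ _).trans (add_le_add ((norm_add_le _ _).trans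
          (add_le_add ((norm_sub_le _ _).trans (add_le_add (hr _) (hr _))) ?_)) ?_)
        · rw [norm_mul, Complex.norm_I, one_mul]; exact hr _
        · rw [norm_mul, Complex.norm_I, one_mul]; exact hr _
  have p1 := parallelogram_law_with_norm ℂ x y
  have p2 := parallelogram_law_with_norm ℂ x (Complex.I • y)
  rw [norm_smul, Complex.norm_I, one_mul] at p2
  have h6 : ‖B‖ * ‖x + y‖ ^ 2 + ‖B‖ * ‖x - y‖ ^ 2 + ‖B‖ * ‖x + Complex.I • y‖ ^ 2 +
      ‖B‖ * ‖x - Complex.I • y‖ ^ 2 = 4 * (‖B‖ * (‖x‖ ^ 2 + ‖y‖ ^ 2)) := by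
    linear_combination ‖B‖ * p1 + ‖B‖ * p2
  have : pairing B (Φ (rankOne x y)) = f (rankOne x y) := rfl
  rw [this]
  linarith

theorem exists_dual (Φ : PosTraceNonincMap H K) (B : K →L[ℂ] K) :
    ∃ D : H →L[ℂ] H, ∀ ρ ∈ states H, trace ((Φ ρ).toCLM * B) = trace (ρ.toCLM * D) := by
  have hadd : ∀ x x' y : H, rankOne (x + x') y = rankOne x y + rankOne x' y := fun x x' y =>
    toCLM_injective (by simp [toCLM_rankOne])
  have hadd' : ∀ x y y' : H, rankOne x (y + y') = rankOne x y + rankOne x y' := fun x y y' =>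
    toCLM_injective (by simp [toCLM_rankOne])
  have hsmul : ∀ (c : ℂ) (x y : H), rankOne (c • x) y = c • rankOne x y := fun c x y =>
    toCLM_injective (by simp [toCLM_rankOne])
  have hsmul' : ∀ (c : ℂ) (x y : H), rankOne x (c • y) = (starRingEnd ℂ c) • rankOne x y :=
    fun c x y => toCLM_injective (by simp [toCLM_rankOne])
  set f : TraceClass H →ₗ[ℂ] ℂ := pairing B ∘ₗ Φ.toLinearMap with hf
  let β : H →ₗ⋆[ℂ] H →ₗ[ℂ] ℂ := LinearMap.mk₂'ₛₗ (starRingEnd ℂ) (RingHom.id ℂ)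
    (fun y x => f (rankOne x y))
    (fun y y' x => by rw [hadd', map_add]) (fun c y x => by rw [hsmul', map_smul])
    (fun y x x' => by rw [hadd, map_add]) (fun c y x => by rw [hsmul, map_smul]; rfl)
  have hβ : ∀ y x, ‖β y x‖ ≤ 2 * ‖B‖ * ‖y‖ * ‖x‖ := by
    intro y x
    rcases eq_or_ne x 0 with rfl | hx
    · simp
    rcases eq_or_ne y 0 with rfl | hy
    · simp
    have hx' := norm_pos_iff.mpr hx
    have hy' := norm_pos_iff.mpr hy
    have h1 := Φ.norm_pairing_map_rankOne_le B ((‖x‖⁻¹ : ℂ) • x) ((‖y‖⁻¹ : ℂ) • y)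
    rw [norm_smul, norm_smul] at h1
    simp only [norm_inv, Complex.norm_real, norm_norm, inv_mul_cancel₀ hx'.ne',
      inv_mul_cancel₀ hy'.ne'] at h1
    have h2 : ‖f (rankOne ((‖x‖⁻¹ : ℂ) • x) ((‖y‖⁻¹ : ℂ) • y))‖ ≤ ‖B‖ * (1 ^ 2 + 1 ^ 2) := h1
    rw [hsmul, hsmul', map_smul, map_smul, norm_smul, norm_smul, RCLike.norm_conj] at h2
    simp only [norm_inv, Complex.norm_real, norm_norm] at h2
    change ‖x‖⁻¹ * (‖y‖⁻¹ * ‖β y x‖) ≤ _ at h2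
    have h3 : ‖β y x‖ = ‖x‖ * ‖y‖ * (‖x‖⁻¹ * (‖y‖⁻¹ * ‖β y x‖)) := by field_simp
    rw [h3]
    calc _ ≤ ‖x‖ * ‖y‖ * (‖B‖ * (1 ^ 2 + 1 ^ 2)) := by gcongr
      _ = 2 * ‖B‖ * ‖y‖ * ‖x‖ := by ring
  let β' : H →L⋆[ℂ] H →L[ℂ] ℂ := LinearMap.mkContinuous₂ β (2 * ‖B‖) hβ
  set D : H →L[ℂ] H := (InnerProductSpace.continuousLinearMapOfBilin β').adjoint with hD
  refine ⟨D, fun ρ hρ => ?_⟩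
  have hfD : ∀ x, (f - pairing D) (rankOne x x) = 0 := by
    intro x
    rw [LinearMap.sub_apply, pairing_rankOne, hD, ContinuousLinearMap.adjoint_inner_right,
      InnerProductSpace.continuousLinearMapOfBilin_apply]
    exact sub_self _
  have hbd : ∀ A : TraceClass H, 0 ≤ A.toCLM → ‖(f - pairing D) A‖ ≤ (‖B‖ + ‖D‖) * ‖A‖ := by
    intro A hA
    rw [LinearMap.sub_apply, add_mul]
    exact (norm_sub_le _ _).trans
      (add_le_add (Φ.norm_pairing_map_le B hA) (norm_pairing_le A D))
  have := eq_of_eq_rankOne hbd hfD hρ.1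
  rw [LinearMap.sub_apply, sub_eq_zero] at this
  exact this

/-- The dual map `Φ*` from the bounded operators on the output space to those on the input space,
determined by `Tr Φ(ρ) B = Tr ρ Φ*(B)` for all states `ρ`. -/
def dual (Φ : PosTraceNonincMap H K) (B : K →L[ℂ] K) : H →L[ℂ] H := Classical.choose (Φ.exists_dual B)

theorem dual_spec (Φ : PosTraceNonincMap H K) (B : K →L[ℂ] K) :
    ∀ ρ ∈ states H, trace ((Φ ρ).toCLM * B) = trace (ρ.toCLM * Φ.dual B) :=
  Classical.choose_spec (Φ.exists_dual B)

/-- The defining relation of the dual map determines it. -/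
theorem dual_unique (Φ : PosTraceNonincMap H K) (B : K →L[ℂ] K) {D : H →L[ℂ] H}
    (hD : ∀ ρ ∈ states H, trace ((Φ ρ).toCLM * B) = trace (ρ.toCLM * D)) : D = Φ.dual B := by
  have h1 : ∀ x : H, ‖x‖ = 1 → ⟪x, D x⟫_ℂ = ⟪x, Φ.dual B x⟫_ℂ := by
    intro x hx
    have hs : rankOne x x ∈ states H := by
      refine ⟨toCLM_rankOne_self_nonneg x, ?_⟩
      rw [tr_eq_pairing, pairing_rankOne, one_apply_eq_self, inner_self_eq_norm_sq_to_K, hx]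
      simp
    rw [← pairing_rankOne, ← pairing_rankOne]
    exact (hD _ hs).symm.trans (Φ.dual_spec B _ hs)
  have h2 : ∀ x : H, ⟪x, D x⟫_ℂ = ⟪x, Φ.dual B x⟫_ℂ := by
    intro x
    rcases eq_or_ne x 0 with rfl | hx
    · simp
    have hx' := norm_pos_iff.mpr hx
    have h3 := h1 ((‖x‖⁻¹ : ℂ) • x) (by
      rw [norm_smul, norm_inv, Complex.norm_real, norm_norm, inv_mul_cancel₀ hx'.ne'])
    simp only [map_smul, inner_smul_left, inner_smul_right] at h3
    have hx'' : (‖x‖⁻¹ : ℂ) ≠ 0 := inv_ne_zero (Complex.ofReal_ne_zero.mpr hx'.ne')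
    exact mul_left_cancel₀ ((map_ne_zero _).mpr hx'') (mul_left_cancel₀ hx'' h3)
  have h4 := (ext_inner_map D.toLinearMap (Φ.dual B).toLinearMap).mp fun x => by
    have := congrArg (starRingEnd ℂ) (h2 x)
    change ⟪D x, x⟫_ℂ = ⟪Φ.dual B x, x⟫_ℂ
    simpa only [inner_conj_symm] using this
  exact ContinuousLinearMap.coe_injective h4

end PosTraceNonincMap

end Operators

section Entropy

open TraceClass Real

variable {H : Type u} [NormedAddCommGroup H] [InnerProductSpace ℂ H] [CompleteSpace H]
variable {K : Type v} [NormedAddCommGroup K] [InnerProductSpace ℂ K] [CompleteSpace K]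

/-- The quantum entropy `H(A) = Tr η(A) - η(Tr A)` of a positive trace-class operator, where
`η(x) = - x log x`. It takes values in `[0, ∞]`. The operator `η(A)` is the difference of its
positive and negative parts; the negative part has finite rank and so a finite trace. -/
def entropy (A : TraceClass H) : EReal :=
  (posTrace (cfc (fun x : ℝ => max (negMulLog x) 0) A.toCLM) : EReal) -
    (posTrace (cfc (fun x : ℝ => max (-negMulLog x) 0) A.toCLM) : EReal) -
    (negMulLog A.tr.re : EReal)

/-- The classical entropy `∑ η(x i) - η(∑ x i)` of a summable family of non-negative numbers.
Only finitely many terms `η(x i)` are negative. -/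
def classicalEntropy {ι : Type*} (x : ι → ℝ) : EReal :=
  ((∑' i, ENNReal.ofReal (negMulLog (x i)) : ℝ≥0∞) : EReal) -
    ((∑' i, ENNReal.ofReal (-negMulLog (x i)) : ℝ≥0∞) : EReal) -
    (negMulLog (∑' i, x i) : EReal)

/-- The function `f` takes finite values on `s`. -/
def FiniteOn {X : Type*} (f : X → EReal) (s : Set X) : Prop :=
  ∀ x ∈ s, f x ≠ ⊥ ∧ f x ≠ ⊤

/-- The function `f` is continuous and bounded on `s`, and in particular finite there. -/
def ContinuousBoundedOn {X : Type*} [TopologicalSpace X] (f : X → EReal) (s : Set X) : Prop :=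
  ContinuousOn f s ∧ ∃ C : ℝ, ∀ x ∈ s, -(C : EReal) ≤ f x ∧ f x ≤ (C : EReal)

namespace PosTraceNonincMap

/-- The output entropy `A ↦ H(Φ(A))`. -/
def outputEntropy (Φ : PosTraceNonincMap H K) (A : TraceClass H) : EReal := entropy (Φ A)

/-- In some orthonormal basis of the output space, the classical entropy of the diagonal of `Φ(ρ)`
is a continuous and bounded function on the set of states. The space `K` is meant to be separable,
so that an index type in `Type` serves for every orthonormal basis. -/
def HasContinuousDiagonalEntropy (Φ : PosTraceNonincMap H K) : Prop :=
  ∃ (ι : Type) (b : HilbertBasis ι ℂ K),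
    ContinuousBoundedOn
      (fun ρ => classicalEntropy fun i => (⟪b i, (Φ ρ).toCLM (b i)⟫_ℂ).re) (states H)

/-- There are an orthonormal basis of the output space and numbers `h i ≥ 0` with
`∑ exp (-h i) < ∞` such that the series `∑ h i • Φ*(|i⟩⟨i|)` of positive operators converges in the
strong operator topology to a bounded operator. -/
def HasSummableDualWeights (Φ : PosTraceNonincMap H K) : Prop :=
  ∃ (ι : Type) (b : HilbertBasis ι ℂ K) (h : ι → ℝ),
    (∀ i, 0 ≤ h i) ∧
    (∃ S : H →L[ℂ] H, ∀ x : H,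
      HasSum (fun i => h i • Φ.dual (InnerProductSpace.rankOne ℂ (b i) (b i)) x) (S x)) ∧
    Summable fun i => exp (-h i)

/-- For every increasing sequence `B n` of positive operators in the range of `Φ*`, finiteness of
`sup_{A ∈ 𝒜} lim_n Tr A (B n)` implies finiteness of `sup_n ‖B n‖`. -/
def DetectsBoundedness (Φ : PosTraceNonincMap H K) (𝒜 : Set (TraceClass H)) : Prop :=
  ∀ B : ℕ → H →L[ℂ] H, (∀ n, 0 ≤ B n) → Monotone B → (∀ n, B n ∈ Set.range Φ.dual) →
    (∃ C : ℝ, ∀ A ∈ 𝒜, ∃ l ≤ C,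
      Tendsto (fun n => (trace (A.toCLM * B n)).re) atTop (𝓝 l)) →
    ∃ C : ℝ, ∀ n, ‖B n‖ ≤ C

end PosTraceNonincMap

end Entropy

end QuantumEntropy

end

noncomputable section

open scoped InnerProductSpace ENNReal Topology ComplexOrder
open Filter

namespace QuantumEntropy

universe u v w

/-! ### Rank-one decompositions, eigenbases and the functional calculus on eigenvectors. -/

section TraceClassOperators

set_option linter.unusedSectionVars false

variable {H : Type u} [NormedAddCommGroup H] [InnerProductSpace ℂ H] [CompleteSpace H]

namespace TraceClass

/-! The proof rests on Klein's inequality with a remainder, `η(t) + (t - q)² / 2 ≤ t (-log q) - t +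
q` on the unit interval (`negMulLog_add_sq_le`), and on its operator form
`IsSubstate.re_inner_etaPos_add_sq_le`. Entropies are replaced by `etaTrace`, the trace of the
positive part of `η`. For positive operators of trace at most one `η` is non-negative on the
spectrum, and on states the correction `η(Tr Φ(ρ))` is a bounded continuous term, so finiteness,
boundedness and continuity can be read off from `etaTrace`.

Finiteness on `𝒜` gives the weights of (iv) as follows. Finiteness is automatically uniform:
elements `a n` of `𝒜` whose (rescaled) outputs have `Tr η` above `4 ^ n` could be mixed with weights
`2 ^ -(n + 1)` into one element of `𝒜`, and since `Tr η` is monotone up to a trace, its output would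
have infinite entropy (`exists_etaTrace_bound`). The quadratic remainder makes `Tr η` strongly
concave, so near-maximizers of `Tr η` on the convex set of outputs form a Cauchy sequence with a
limit `S`, although the set need not be compact nor contain `S`. Moving a near-maximizer slightly
towards an output `T` cannot raise `Tr η` by much, and this first-order optimality bounds `-Tr T log
S` uniformly in `T` (`exists_truncLog_bound`). In the eigenbasis of `S`, the weights `h i = -log (s
i)`, corrected where `s i` is too small, satisfy `∑ exp (-h i) < ∞` and make `∑ h i ⟨i|T|i⟩` bounded
(`exists_weights`). These sums are limits of `Tr A B n` for the increasing partial sums `B n` of `∑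
h i Φ*(|i⟩⟨i|)`, so the hypothesis on `𝒜` bounds `‖B n‖`, and the series converges strongly.

Conversely, given weights, Klein's inequality with `q = exp (-h i)` dominates `η(p i)` by `h i p i +
exp (-h i)`, a series of continuous functions with a continuous sum; a Dini argument gives (iii).
For (ii), `Tr η(Φ(ρ))` is lower semicontinuous as a sum of non-negative continuous terms. For upper
semicontinuity at `ρ`, finitely many basis vectors are rotated: the new diagonal entropy is still
continuous and still an upper bound at every state, but at `ρ` itself it is within `2 δ` of `Tr
η(Φ(ρ))` (`IsSubstate.eventually_exists_hilbertBasis`).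

Both (ii) and (iii) return to finiteness, because diagonals have larger entropy than operators and
because scaling carries finiteness from states to all positive operators. -/

theorem trace_mul_rankOne (A : TraceClass H) (x y : H) :
    trace (A.toCLM * InnerProductSpace.rankOne ℂ x y) = ⟪y, A.toCLM x⟫_ℂ := by
  rw [trace, ← (stdBasis H).tsum_inner_mul_inner]
  congr 1; funext i
  rw [mul_apply_eq_comp, InnerProductSpace.rankOne_apply, map_smul, inner_smul_right]

theorem norm_inner_le (A : TraceClass H) (x y : H) : ‖⟪y, A.toCLM x⟫_ℂ‖ ≤ ‖x‖ * ‖y‖ * ‖A‖ := by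
  rw [← trace_mul_rankOne]
  refine (norm_pairing_le A (InnerProductSpace.rankOne ℂ x y)).trans ?_
  rw [InnerProductSpace.norm_rankOne]

/-- The matrix element bound is tested against `y = A x`, and one factor `‖A x‖` cancels. -/
theorem norm_toCLM_le (A : TraceClass H) : ‖A.toCLM‖ ≤ ‖A‖ := by
  refine ContinuousLinearMap.opNorm_le_bound _ (norm_nonneg _) fun x => ?_
  have h := A.norm_inner_le x (A.toCLM x)
  rw [inner_self_eq_norm_sq_to_K, norm_pow, RCLike.norm_ofReal, abs_norm] at h
  rcases (norm_nonneg (A.toCLM x)).eq_or_lt with h0 | h0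
  · rw [← h0]; positivity
  · refine le_of_mul_le_mul_right ?_ h0
    linarith

theorem continuous_toCLM : Continuous (toCLM (H := H)) :=
  (toCLM.mkContinuous 1 fun A => by rw [one_mul]; exact A.norm_toCLM_le).continuous

theorem continuous_pairing (B : H →L[ℂ] H) : Continuous (pairing B) :=
  ((pairing B).mkContinuous ‖B‖ fun A => norm_pairing_le A B).continuous

/-- A positive trace-class operator is the sum of the operators `|√A e⟩⟨√A e|`, where `e` runs
through an orthonormal basis. -/
theorem hasSum_rankOne_sqrt {A : TraceClass H} (hA : 0 ≤ A.toCLM) {ι : Type*}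
    (b : HilbertBasis ι ℂ H) :
    HasSum (fun i => rankOne (CFC.sqrt A.toCLM (b i)) (CFC.sqrt A.toCLM (b i))) A := by
  set S := CFC.sqrt A.toCLM with hS
  have hSs : S.adjoint = S := IsSelfAdjoint.of_nonneg (CFC.sqrt_nonneg A.toCLM)
  have hsum : HasSum (fun i => ‖S (b i)‖ ^ 2) ‖A‖ := by
    have h1 : posTrace A.toCLM = ∑' i, ‖S (b i)‖ₑ ^ 2 := by
      rw [posTrace_eq_tsum hA b]; simp_rw [ofReal_inner_eq hA]; rfl
    have h2 := A.traceNorm_lt_top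
    rw [traceNorm_of_nonneg hA, h1] at h2
    have h3 := ENNReal.hasSum_toReal h2.ne
    rw [norm_def, traceNorm_of_nonneg hA, h1, ENNReal.tsum_toReal_eq (by simp)]
    simpa only [ENNReal.toReal_pow, toReal_enorm] using h3
  -- The remainder is `√A (1 - P) √A` with `P` the projection onto the span of the `b i`, `i ∈ F`.
  -- It is positive, so its trace norm is its trace, which is computed exactly.
  have hn : ∀ F : Finset ι, ‖∑ i ∈ F, rankOne (S (b i)) (S (b i)) - A‖ =
      ‖A‖ - ∑ i ∈ F, ‖S (b i)‖ ^ 2 := by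
    intro F
    rw [← norm_neg, neg_sub]
    set R : TraceClass H := A - ∑ i ∈ F, rankOne (S (b i)) (S (b i)) with hR
    have hRpos : 0 ≤ R.toCLM := by
      rw [ContinuousLinearMap.nonneg_iff_isPositive, ContinuousLinearMap.isPositive_iff_complex]
      intro x
      have h1 : ⟪R.toCLM x, x⟫_ℂ = ((‖S x‖ ^ 2 - ∑ i ∈ F, ‖⟪b i, S x⟫_ℂ‖ ^ 2 : ℝ) : ℂ) := by
        rw [hR, map_sub, map_sum, sub_apply, inner_sub_left, sum_apply, sum_inner]
        push_cast
        congr 1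
        · rw [← inner_conj_symm, inner_eq_sqrt hA, inner_self_eq_norm_sq_to_K]
          simp [hS]
        · refine Finset.sum_congr rfl fun i _ => ?_
          rw [toCLM_rankOne, InnerProductSpace.rankOne_apply, inner_smul_left, inner_conj_symm,
            ← inner_conj_symm x (S (b i)), mul_comm, RCLike.mul_conj,
            ← ContinuousLinearMap.adjoint_inner_right, hSs]
          norm_cast
      have h2 := sub_nonneg.mpr (b.orthonormal.sum_inner_products_le (s := F) (S x))
      rw [h1]
      exact ⟨congrArg _ (RCLike.ofReal_re (K := ℂ) _), h2.trans_eq (RCLike.ofReal_re (K := ℂ) _).symm⟩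
    rw [norm_eq_tr hRpos, norm_eq_tr hA, tr_eq_pairing, tr_eq_pairing, hR, map_sub, map_sum,
      Complex.sub_re, Complex.re_sum]
    congr 1
    refine Finset.sum_congr rfl fun i _ => ?_
    rw [← tr_eq_pairing, tr_rankOne_self]
  refine tendsto_iff_norm_sub_tendsto_zero.mpr ?_
  simp_rw [hn]
  simpa using (tendsto_const_nhds (x := ‖A‖)).sub hsum

theorem hasSum_pairing {A : TraceClass H} (hA : 0 ≤ A.toCLM) (D : H →L[ℂ] H) {ι : Type*}
    (b : HilbertBasis ι ℂ H) :
    HasSum (fun i => ⟪CFC.sqrt A.toCLM (b i), D (CFC.sqrt A.toCLM (b i))⟫_ℂ) (pairing D A) := by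
  have := (hasSum_rankOne_sqrt hA b).map (pairing D) (continuous_pairing D)
  simpa only [Function.comp_def, pairing_rankOne] using this

/-- The rank-one expansion converges in operator norm as well, so `A` is a norm limit of finite-rank
operators. -/
theorem isCompactOperator {A : TraceClass H} (hA : 0 ≤ A.toCLM) : IsCompactOperator A.toCLM := by
  have h := (hasSum_rankOne_sqrt hA (stdBasis H)).map toCLM continuous_toCLM
  refine isCompactOperator_of_tendsto (l := atTop) h (Eventually.of_forall fun F => ?_)
  refine (compactOperator (RingHom.id ℂ) H H).sum_mem (t := F) fun i _ => ?_
  have : (InnerProductSpace.rankOne ℂ (CFC.sqrt A.toCLM (stdBasis H i))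
      (CFC.sqrt A.toCLM (stdBasis H i))) =
      (ContinuousLinearMap.toSpanSingleton ℂ (CFC.sqrt A.toCLM (stdBasis H i))) ∘L
        (innerSL ℂ (CFC.sqrt A.toCLM (stdBasis H i))) := by
    ext x; simp [InnerProductSpace.rankOne_apply]
  change IsCompactOperator _
  rw [Function.comp_apply, toCLM_rankOne, this]
  have h1 : IsCompactOperator (innerSL ℂ (CFC.sqrt A.toCLM (stdBasis H i))) :=
    isCompactOperator_of_locallyCompactSpace_dom _
  exact h1.clm_comp (ContinuousLinearMap.toSpanSingleton ℂ _)

end TraceClass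

open TraceClass

/-- A positive operator of finite trace has an orthonormal basis of eigenvectors. -/
theorem exists_eigenbasis {T : H →L[ℂ] H} (hT : 0 ≤ T) (hfin : posTrace T ≠ ⊤) :
    ∃ (ι : Type u) (b : HilbertBasis ι ℂ H) (t : ι → ℝ), ∀ i, T (b i) = (t i : ℂ) • b i := by
  have hcpt : IsCompactOperator T :=
    TraceClass.isCompactOperator (A := TraceClass.mk T
      (by rw [traceNorm_of_nonneg hT]; exact hfin.lt_top)) hT
  have hsym : (T : H →ₗ[ℂ] H).IsSymmetric :=
    ((ContinuousLinearMap.nonneg_iff_isPositive T).mp hT).isSymmetric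
  have hbot := ContinuousLinearMap.orthogonalComplement_iSup_eigenspaces_eq_bot hcpt hsym
  have hof := hsym.orthogonalFamily_eigenspaces
  have hclosed : ∀ μ : ℂ, CompleteSpace (Module.End.eigenspace (T : H →ₗ[ℂ] H) μ) := by
    intro μ
    have : (Module.End.eigenspace (T : H →ₗ[ℂ] H) μ : Set H) = {x | T x = μ • x} := by
      ext x; simp
    have hc : IsClosed (Module.End.eigenspace (T : H →ₗ[ℂ] H) μ : Set H) := by
      rw [this]
      exact isClosed_eq T.continuous (continuous_const_smul μ)
    exact hc.completeSpace_coe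
  choose w e he using fun μ : ℂ =>
    exists_hilbertBasis ℂ (Module.End.eigenspace (T : H →ₗ[ℂ] H) μ)
  have hon : Orthonormal ℂ fun a : Σ μ, w μ => (e a.1 a.2 : H) :=
    hof.orthonormal_sigma_orthonormal (v_family := fun μ => e μ) fun μ => (e μ).orthonormal
  -- A vector orthogonal to a Hilbert basis of each eigenspace is orthogonal to every eigenspace,
  -- hence zero by the spectral theorem for compact self-adjoint operators.
  have hsp : (Submodule.span ℂ (Set.range fun a : Σ μ, w μ => (e a.1 a.2 : H)))ᗮ = ⊥ := by
    rw [eq_bot_iff, ← hbot]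
    intro x hx
    rw [← Submodule.iInf_orthogonal, Submodule.mem_iInf]
    intro μ
    rw [Submodule.mem_orthogonal]
    intro y hy
    have h1 := ((e μ).hasSum_repr ⟨y, hy⟩).map
      (Submodule.subtypeL (Module.End.eigenspace (T : H →ₗ[ℂ] H) μ))
      (Submodule.subtypeL _).continuous
    have h2 := h1.map (innerSLFlip ℂ x) (innerSLFlip ℂ x).continuous
    refine h2.unique ?_
    convert hasSum_zero using 1
    funext i
    have h3 : ⟪(e μ i : H), x⟫_ℂ = 0 :=
      (Submodule.mem_orthogonal _ _).mp hx _ (Submodule.subset_span ⟨⟨μ, i⟩, rfl⟩)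
    simp [h3]
  refine ⟨Σ μ, w μ, HilbertBasis.mkOfOrthogonalEqBot hon hsp, fun a => a.1.re, fun a => ?_⟩
  rw [HilbertBasis.coe_mkOfOrthogonalEqBot]
  have h1 : T (e a.1 a.2 : H) = a.1 • (e a.1 a.2 : H) :=
    Module.End.mem_eigenspace_iff.mp (e a.1 a.2).2
  have hne : (e a.1 a.2 : H) ≠ 0 := hon.ne_zero a
  have h2 : (starRingEnd ℂ) a.1 = a.1 :=
    hsym.conj_eigenvalue_eq_self (Module.End.hasEigenvalue_of_hasEigenvector
      ⟨Module.End.mem_eigenspace_iff.mpr h1, hne⟩)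
  rw [h1, Complex.conj_eq_iff_re.mp h2]

theorem re_inner_nonneg {T : H →L[ℂ] H} (hT : 0 ≤ T) (x : H) : 0 ≤ (⟪x, T x⟫_ℂ).re :=
  ((ContinuousLinearMap.nonneg_iff_isPositive T).mp hT).re_inner_nonneg_right x

theorem re_inner_mono {S T : H →L[ℂ] H} (h : S ≤ T) (x : H) :
    (⟪x, S x⟫_ℂ).re ≤ (⟪x, T x⟫_ℂ).re := by
  have := re_inner_nonneg (sub_nonneg.mpr h) x
  rw [sub_apply, inner_sub_right, Complex.sub_re] at this
  linarith

theorem re_inner_eigenvector {T : H →L[ℂ] H} {x : H} {t : ℝ} (hx : ‖x‖ = 1)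
    (h : T x = (t : ℂ) • x) : (⟪x, T x⟫_ℂ).re = t := by
  rw [h, inner_smul_right, inner_self_eq_norm_sq_to_K, hx]
  simp

theorem cfc_apply_of_eigenvector {T : H →L[ℂ] H} (hT : IsSelfAdjoint T) {f : ℝ → ℝ}
    (hf : Continuous f) {x : H} {t : ℝ} (h : T x = (t : ℂ) • x) :
    cfc f T x = (f t : ℂ) • x := by
  -- real polynomials are dense in the continuous functions on a compact interval
  have hpoly : ∀ p : Polynomial ℝ, Polynomial.aeval T p x = ((p.eval t : ℝ) : ℂ) • x := by
    intro p
    induction p using Polynomial.induction_on' with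
    | add p q hp hq => simp [hp, hq, add_smul]
    | monomial n a =>
      rw [Polynomial.aeval_monomial, Polynomial.eval_monomial, Algebra.algebraMap_eq_smul_one,
        smul_mul_assoc, one_mul]
      have : ∀ n : ℕ, (T ^ n) x = ((t : ℂ) ^ n) • x := by
        intro n
        induction n with
        | zero => simp
        | succ n ih => rw [pow_succ', mul_apply_eq_comp, ih, map_smul, h, smul_smul, pow_succ]
      rw [smul_apply, this]
      push_cast
      rw [mul_smul, Complex.coe_smul]
  obtain ⟨R, hR0, hR⟩ : ∃ R : ℝ, 0 ≤ R ∧ ∀ s ∈ insert t (spectrum ℝ T), s ∈ Set.Icc (-R) R := by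
    have hb : Bornology.IsBounded (insert t (spectrum ℝ T)) :=
      ((spectrum.isCompact T).insert t).isBounded
    obtain ⟨R, hR⟩ := hb.exists_norm_le
    refine ⟨|R|, abs_nonneg _, fun s hs => ?_⟩
    have := (hR s hs).trans (le_abs_self R)
    rwa [Real.norm_eq_abs, abs_le] at this
  have key : ∀ ε > 0, ‖cfc f T x - (f t : ℂ) • x‖ ≤ 2 * ε * ‖x‖ := by
    intro ε hε
    obtain ⟨p, hp⟩ := exists_polynomial_near_of_continuousOn (-R) R f hf.continuousOn ε hε
    have h1 : ‖cfc f T - Polynomial.aeval T p‖ ≤ ε := by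
      rw [← cfc_polynomial p T, ← cfc_sub f _ T hf.continuousOn p.continuousOn]
      refine norm_cfc_le hε.le fun s hs => ?_
      rw [← norm_neg, neg_sub]
      exact (hp s (hR s (Set.mem_insert_of_mem _ hs))).le
    have h2 : cfc f T x - (f t : ℂ) • x = (cfc f T - Polynomial.aeval T p) x +
        ((p.eval t - f t : ℝ) : ℂ) • x := by
      rw [sub_apply, hpoly]
      push_cast
      rw [sub_smul]
      abel
    rw [h2]
    have h3 : ‖((p.eval t - f t : ℝ) : ℂ) • x‖ ≤ ε * ‖x‖ := by
      rw [norm_smul, Complex.norm_real]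
      gcongr
      exact (hp t (hR t (Set.mem_insert _ _))).le
    have h4 : ‖(cfc f T - Polynomial.aeval T p) x‖ ≤ ε * ‖x‖ :=
      (ContinuousLinearMap.le_opNorm _ _).trans (by gcongr)
    calc _ ≤ _ := norm_add_le _ _
      _ ≤ ε * ‖x‖ + ε * ‖x‖ := add_le_add h4 h3
      _ = _ := by ring
  rw [← sub_eq_zero, ← norm_le_zero_iff]
  have hlim : Tendsto (fun ε : ℝ => 2 * ε * ‖x‖) (𝓝[>] 0) (𝓝 (2 * 0 * ‖x‖)) :=
    (Continuous.tendsto (by fun_prop) 0).mono_left nhdsWithin_le_nhds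
  have := ge_of_tendsto hlim (eventually_mem_nhdsWithin.mono key)
  simpa using this

end TraceClassOperators

/-! ### Klein's inequality for numbers and operators. -/

section Klein

set_option linter.unusedSectionVars false

open Real

/-- Klein's inequality for numbers in the unit interval, with a quadratic remainder. -/
theorem negMulLog_add_sq_le {t q : ℝ} (ht : 0 ≤ t) (ht1 : t ≤ 1) (hq : 0 < q) (hq1 : q ≤ 1) :
    negMulLog t + (t - q) ^ 2 / 2 ≤ t * (-log q) - t + q := by
  -- The slope of `log` is at least one on `(0, 1]`, so `φ' = log s - log q - (s - q)` has the sign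
  -- of `s - q` and `φ` is minimal at `q`, where it vanishes.
  set φ : ℝ → ℝ := fun t => t * (-log q) - t + q - negMulLog t - (t - q) ^ 2 / 2 with hφ
  have hc : Continuous φ := by
    have := continuous_negMulLog
    fun_prop
  have hd : ∀ s, 0 < s → HasDerivAt φ (log s - log q - (s - q)) s := by
    intro s hs
    have h1 := hasDerivAt_negMulLog hs.ne'
    have h2 : HasDerivAt (fun s : ℝ => s * (-log q) - s + q) (1 * (-log q) - 1) s :=
      (((hasDerivAt_id s).mul_const (-log q)).sub (hasDerivAt_id s)).add_const q
    have h3 : HasDerivAt (fun s : ℝ => (s - q) ^ 2 / 2) ((2 * (s - q)) / 2) s := by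
      simpa using (((hasDerivAt_id s).sub_const q).pow 2).div_const 2
    exact ((h2.sub h1).sub h3).congr_deriv (by ring)
  have hφq : φ q = 0 := by simp [hφ, negMulLog]
  suffices h : 0 ≤ φ t by
    simp only [hφ] at h
    linarith
  rw [← hφq]
  rcases le_total t q with htq | htq
  · have hanti : AntitoneOn φ (Set.Icc 0 q) := by
      refine antitoneOn_of_deriv_nonpos (convex_Icc _ _) hc.continuousOn ?_ ?_
      · intro s hs
        rw [interior_Icc] at hs
        exact (hd s hs.1).differentiableAt.differentiableWithinAt
      · intro s hs
        rw [interior_Icc] at hs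
        rw [(hd s hs.1).deriv]
        have h1 := one_sub_inv_le_log_of_pos (div_pos hq hs.1)
        rw [log_div hq.ne' hs.1.ne', inv_div] at h1
        have h2 : q - s ≤ 1 - s / q := by
          rw [one_sub_div hq.ne', le_div_iff₀ hq]
          nlinarith [hs.2]
        linarith
    exact hanti ⟨ht, htq⟩ ⟨hq.le, le_rfl⟩ htq
  · have hmono : MonotoneOn φ (Set.Icc q 1) := by
      refine monotoneOn_of_deriv_nonneg (convex_Icc _ _) hc.continuousOn ?_ ?_
      · intro s hs
        rw [interior_Icc] at hs
        exact (hd s (hq.trans hs.1)).differentiableAt.differentiableWithinAt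
      · intro s hs
        rw [interior_Icc] at hs
        have hs0 := hq.trans hs.1
        rw [(hd s hs0).deriv]
        have h1 := one_sub_inv_le_log_of_pos (div_pos hs0 hq)
        rw [log_div hs0.ne' hq.ne', inv_div] at h1
        have h2 : s - q ≤ 1 - q / s := by
          rw [one_sub_div hs0.ne', le_div_iff₀ hs0]
          nlinarith [hs.1, hs.2]
        linarith
    exact hmono ⟨le_rfl, hq1⟩ ⟨htq, ht1⟩ htq

/-- The positive part of `η(x) = - x log x`. -/
def etaPos (x : ℝ) : ℝ := max (negMulLog x) 0

theorem continuous_etaPos : Continuous etaPos := continuous_negMulLog.max continuous_const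

theorem etaPos_nonneg (x : ℝ) : 0 ≤ etaPos x := le_max_right _ _

theorem etaPos_eq {x : ℝ} (h0 : 0 ≤ x) (h1 : x ≤ 1) : etaPos x = negMulLog x :=
  max_eq_left (negMulLog_nonneg h0 h1)

theorem ofReal_etaPos (x : ℝ) : ENNReal.ofReal (etaPos x) = ENNReal.ofReal (negMulLog x) := by
  rw [etaPos, ENNReal.ofReal_max, ENNReal.ofReal_zero, max_eq_left zero_le]

variable {H : Type u} [NormedAddCommGroup H] [InnerProductSpace ℂ H] [CompleteSpace H]

/-- The trace of the positive part of `η(T)`. -/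
def etaTrace (T : H →L[ℂ] H) : ℝ≥0∞ := posTrace (cfc etaPos T)

theorem cfc_etaPos_nonneg (T : H →L[ℂ] H) : 0 ≤ cfc etaPos T :=
  cfc_nonneg fun x _ => etaPos_nonneg x

/-- The positive operators of trace at most one. -/
def IsSubstate (T : H →L[ℂ] H) : Prop := 0 ≤ T ∧ posTrace T ≤ 1

namespace IsSubstate

variable {A B T X Z : H →L[ℂ] H}

theorem posTrace_ne_top (hT : IsSubstate T) : posTrace T ≠ ⊤ :=
  (hT.2.trans_lt ENNReal.one_lt_top).ne

theorem norm_le_one (hT : IsSubstate T) : ‖T‖ ≤ 1 := by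
  have h : traceNorm T < ⊤ := by
    rw [traceNorm_of_nonneg hT.1]
    exact hT.posTrace_ne_top.lt_top
  refine (TraceClass.norm_toCLM_le (TraceClass.mk T h)).trans ?_
  rw [TraceClass.norm_def, TraceClass.toCLM_mk, traceNorm_of_nonneg hT.1]
  exact ENNReal.toReal_le_of_le_ofReal zero_le_one (by simpa using hT.2)

/-- Together with positivity this confines the spectrum to the unit interval, where `η` is
non-negative and the scalar Klein inequality applies. -/
theorem le_one (hT : IsSubstate T) : T ≤ 1 :=
  (CStarAlgebra.norm_le_one_iff_of_nonneg T hT.1).mp hT.norm_le_one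

theorem isSelfAdjoint (hT : IsSubstate T) : IsSelfAdjoint T := .of_nonneg hT.1

theorem spectrum_subset (hT : IsSubstate T) : spectrum ℝ T ⊆ Set.Icc 0 1 := by
  intro x hx
  refine ⟨spectrum_nonneg_of_nonneg hT.1 hx, ?_⟩
  have h1 : T ≤ algebraMap ℝ (H →L[ℂ] H) 1 := by rw [map_one]; exact hT.le_one
  exact (le_algebraMap_iff_spectrum_le hT.isSelfAdjoint).mp h1 x hx

theorem re_inner_le_one (hT : IsSubstate T) {x : H} (hx : ‖x‖ = 1) : (⟪x, T x⟫_ℂ).re ≤ 1 := by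
  have h := re_inner_mono hT.le_one x
  rw [one_apply_eq_self, inner_self_eq_norm_sq_to_K, hx] at h
  simpa using h

theorem eigenvalue_mem (hT : IsSubstate T) {x : H} (hx : ‖x‖ = 1) {t : ℝ}
    (h : T x = (t : ℂ) • x) : 0 ≤ t ∧ t ≤ 1 := by
  rw [← re_inner_eigenvector hx h]
  exact ⟨re_inner_nonneg hT.1 x, hT.re_inner_le_one hx⟩

/-- The operator form of Klein's inequality with a quadratic remainder. -/
theorem re_inner_etaPos_add_sq_le (hA : IsSubstate A) {x : H} (hx : ‖x‖ = 1) {q : ℝ} (hq : 0 < q)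
    (hq1 : q ≤ 1) : (⟪x, cfc etaPos A x⟫_ℂ).re + ‖A x - (q : ℂ) • x‖ ^ 2 / 2 ≤
      (⟪x, A x⟫_ℂ).re * (-log q) - (⟪x, A x⟫_ℂ).re + q := by
  have hsa := hA.isSelfAdjoint
  -- The scalar inequality on the spectrum is an operator inequality; the square `(A - q)²`
  -- evaluated at `x` is `‖A x - q x‖²`.
  have hle : cfc (fun t => etaPos t + (1 / 2 : ℝ) * ((t - q) * (t - q))) A ≤
      cfc (fun t => (-log q - 1) * t + q) A := by
    refine cfc_mono (fun t ht => ?_)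
      (by have := continuous_etaPos; fun_prop) (by fun_prop)
    obtain ⟨h0, h1⟩ := hA.spectrum_subset ht
    rw [etaPos_eq h0 h1]
    have := negMulLog_add_sq_le h0 h1 hq hq1
    linarith
  have hR : cfc (fun t => (-log q - 1) * t + q) A =
      (-log q - 1) • A + q • (1 : H →L[ℂ] H) := by
    rw [cfc_add_const q (fun t => (-log q - 1) * t) A (by fun_prop), cfc_const_mul_id _ A,
      Algebra.algebraMap_eq_smul_one]
  have hsub : cfc (fun t : ℝ => t - q) A = A - q • (1 : H →L[ℂ] H) := by
    rw [cfc_sub (fun t => t) (fun _ => q) A (by fun_prop) (by fun_prop), cfc_id' ℝ A,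
      cfc_const q A, Algebra.algebraMap_eq_smul_one]
  have hL : cfc (fun t => etaPos t + (1 / 2 : ℝ) * ((t - q) * (t - q))) A =
      cfc etaPos A + (1 / 2 : ℝ) • ((A - q • (1 : H →L[ℂ] H)) * (A - q • (1 : H →L[ℂ] H))) := by
    rw [cfc_add A etaPos _ continuous_etaPos.continuousOn (by fun_prop),
      cfc_const_mul (1 / 2 : ℝ) (fun t => (t - q) * (t - q)) A (by fun_prop),
      cfc_mul (fun t => t - q) (fun t => t - q) A (by fun_prop) (by fun_prop), hsub]
  have hmain := re_inner_mono hle x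
  rw [hL, hR] at hmain
  have hDs : IsSelfAdjoint (A - q • (1 : H →L[ℂ] H)) := hsub ▸ cfc_predicate _ A
  have hDx : (A - q • (1 : H →L[ℂ] H)) x = A x - (q : ℂ) • x := by
    rw [sub_apply, smul_apply, one_apply_eq_self, Complex.coe_smul]
  have hsq : ⟪x, ((A - q • (1 : H →L[ℂ] H)) * (A - q • (1 : H →L[ℂ] H))) x⟫_ℂ =
      ((‖A x - (q : ℂ) • x‖ ^ 2 : ℝ) : ℂ) := by
    rw [mul_apply_eq_comp, ← ContinuousLinearMap.adjoint_inner_left, ← ContinuousLinearMap.star_eq_adjoint,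
      hDs.star_eq, hDx, inner_self_eq_norm_sq_to_K]
    norm_cast
  have hxx : ⟪x, x⟫_ℂ = 1 := by rw [inner_self_eq_norm_sq_to_K, hx]; simp
  simp only [add_apply, smul_apply, inner_add_right, inner_smul_right_eq_smul, hsq,
    one_apply_eq_self, hxx, Complex.add_re, Complex.smul_re, Complex.ofReal_re, smul_eq_mul,
    Complex.one_re] at hmain
  linarith

/-- The case `q = 0` is needed for eigenvalues that vanish. There `log 0 = 0` by convention and the
inequality would fail if `⟨x, A x⟩` were positive, whence `h0`; it follows from small positive `q`.
-/
theorem re_inner_etaPos_add_le (hA : IsSubstate A) {x : H} (hx : ‖x‖ = 1) {q : ℝ} (hq : 0 ≤ q)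
    (hq1 : q ≤ 1) (h0 : q = 0 → (⟪x, A x⟫_ℂ).re = 0) :
    (⟪x, cfc etaPos A x⟫_ℂ).re + (⟪x, A x⟫_ℂ).re ≤ (⟪x, A x⟫_ℂ).re * (-log q) + q := by
  rcases hq.eq_or_lt with rfl | hq
  · rw [h0 rfl]
    simp only [add_zero, zero_mul]
    refine le_of_forall_pos_le_add fun ε hε => ?_
    have h := hA.re_inner_etaPos_add_sq_le hx (lt_min hε one_pos) (min_le_right ε 1)
    rw [h0 rfl] at h
    nlinarith [min_le_left ε 1, sq_nonneg ‖A x - ((min ε 1 : ℝ) : ℂ) • x‖]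
  · have := hA.re_inner_etaPos_add_sq_le hx hq hq1
    nlinarith [sq_nonneg ‖A x - (q : ℂ) • x‖]

/-- Jensen's inequality for `η`, which is Klein's inequality at the optimal `q = ⟨x, A x⟩`. -/
theorem re_inner_etaPos_le (hA : IsSubstate A) {x : H} (hx : ‖x‖ = 1) :
    (⟪x, cfc etaPos A x⟫_ℂ).re ≤ negMulLog (⟪x, A x⟫_ℂ).re := by
  have := hA.re_inner_etaPos_add_le hx (re_inner_nonneg hA.1 x) (hA.re_inner_le_one hx) id
  rw [negMulLog]
  linarith

/-- The diagonal of an operator has larger entropy than the operator. -/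
theorem etaTrace_le_tsum (hA : IsSubstate A) {ι : Type*} (b : HilbertBasis ι ℂ H) :
    etaTrace A ≤ ∑' i, ENNReal.ofReal (negMulLog (⟪b i, A (b i)⟫_ℂ).re) := by
  rw [etaTrace, posTrace_eq_tsum (cfc_etaPos_nonneg A) b]
  exact ENNReal.tsum_le_tsum fun i =>
    ENNReal.ofReal_le_ofReal (hA.re_inner_etaPos_le (b.orthonormal.1 i))

end IsSubstate

theorem etaTrace_eq_tsum {T : H →L[ℂ] H} (hT : IsSelfAdjoint T) {ι : Type*}
    {b : HilbertBasis ι ℂ H} {t : ι → ℝ} (h : ∀ i, T (b i) = (t i : ℂ) • b i) :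
    etaTrace T = ∑' i, ENNReal.ofReal (negMulLog (t i)) := by
  rw [etaTrace, posTrace_eq_tsum (cfc_etaPos_nonneg T) b]
  congr 1; funext i
  rw [re_inner_eigenvector (b.orthonormal.1 i)
    (cfc_apply_of_eigenvector hT continuous_etaPos (h i)), ofReal_etaPos]

theorem apply_eq_zero_of_re_inner_eq_zero {A : H →L[ℂ] H} (hA : 0 ≤ A) {x : H}
    (h : (⟪x, A x⟫_ℂ).re = 0) : A x = 0 := by
  rw [inner_eq_sqrt hA, inner_self_eq_norm_sq_to_K] at h
  have h1 : CFC.sqrt A x = 0 := by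
    rw [← norm_eq_zero]
    have : ((‖CFC.sqrt A x‖ : ℂ) ^ 2).re = ‖CFC.sqrt A x‖ ^ 2 := by norm_cast
    exact pow_eq_zero_iff two_ne_zero |>.mp (this.symm.trans h)
  have h2 : CFC.sqrt A * CFC.sqrt A = A := CFC.sqrt_mul_sqrt_self A hA
  rw [← h2, mul_apply_eq_comp, h1, map_zero]

/-- The Hilbert–Schmidt norm dominates the operator norm: `‖D* y‖² = ∑ |⟨D (b i), y⟩|²`, and each
term is bounded by Cauchy–Schwarz. -/
theorem enorm_sq_le_tsum {ι : Type*} (b : HilbertBasis ι ℂ H) (D : H →L[ℂ] H) :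
    ‖D‖ₑ ^ 2 ≤ ∑' i, ‖D (b i)‖ₑ ^ 2 := by
  rcases eq_or_ne (∑' i, ‖D (b i)‖ₑ ^ 2) ⊤ with hS | hS
  · rw [hS]; exact le_top
  have hsum : Summable fun i => ‖D (b i)‖ ^ 2 := by
    simpa only [ENNReal.toReal_pow, toReal_enorm] using ENNReal.summable_toReal hS
  have hS' : ∑' i, ‖D (b i)‖ₑ ^ 2 = ENNReal.ofReal (∑' i, ‖D (b i)‖ ^ 2) := by
    rw [ENNReal.ofReal_tsum_of_nonneg (fun i => by positivity) hsum]
    congr 1; funext i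
    rw [ENNReal.ofReal_pow (norm_nonneg _), ofReal_norm]
  have h0 : 0 ≤ ∑' i, ‖D (b i)‖ ^ 2 := tsum_nonneg fun i => by positivity
  rw [hS', ← ofReal_norm, ← ENNReal.ofReal_pow (norm_nonneg _)]
  refine ENNReal.ofReal_le_ofReal ?_
  rw [← Real.le_sqrt (norm_nonneg _) h0]
  rw [← LinearIsometryEquiv.norm_map ContinuousLinearMap.adjoint D]
  refine ContinuousLinearMap.opNorm_le_bound _ (Real.sqrt_nonneg _) fun y => ?_
  refine le_of_sq_le_sq ?_ (by positivity)
  rw [mul_pow, Real.sq_sqrt h0]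
  have h1 : ∀ i, ‖⟪b i, D.adjoint y⟫_ℂ‖ ^ 2 ≤ ‖D (b i)‖ ^ 2 * ‖y‖ ^ 2 := by
    intro i
    rw [ContinuousLinearMap.adjoint_inner_right, ← mul_pow]
    gcongr
    exact norm_inner_le_norm _ _
  have h2 : ‖D.adjoint y‖ₑ ^ 2 ≤ ENNReal.ofReal ((∑' i, ‖D (b i)‖ ^ 2) * ‖y‖ ^ 2) := by
    rw [← tsum_enorm_inner_sq b, ← hsum.tsum_mul_right,
      ENNReal.ofReal_tsum_of_nonneg (fun i => by positivity) (hsum.mul_right _)]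
    refine ENNReal.tsum_le_tsum fun i => ?_
    rw [← ofReal_norm, ← ENNReal.ofReal_pow (norm_nonneg _)]
    exact ENNReal.ofReal_le_ofReal (h1 i)
  rw [← ofReal_norm, ← ENNReal.ofReal_pow (norm_nonneg _)] at h2
  exact (ENNReal.ofReal_le_ofReal_iff (by positivity)).mp h2

end Klein

/-! ### Monotonicity, strong concavity and scaling of `Tr η`, and its relation to the entropy. -/

section EntropyTrace

set_option linter.unusedSectionVars false

open Real

variable {H : Type u} [NormedAddCommGroup H] [InnerProductSpace ℂ H] [CompleteSpace H]

theorem posTrace_mono {S T : H →L[ℂ] H} (h : S ≤ T) : posTrace S ≤ posTrace T :=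
  ENNReal.tsum_le_tsum fun _ => ENNReal.ofReal_le_ofReal (re_inner_mono h _)

theorem posTrace_add {S T : H →L[ℂ] H} (hS : 0 ≤ S) (hT : 0 ≤ T) :
    posTrace (S + T) = posTrace S + posTrace T := by
  rw [posTrace, posTrace, posTrace, ← ENNReal.tsum_add]
  congr 1; funext i
  rw [add_apply, inner_add_right, Complex.add_re,
    ENNReal.ofReal_add (re_inner_nonneg hS _) (re_inner_nonneg hT _)]

theorem posTrace_smul {c : ℝ} (hc : 0 ≤ c) (T : H →L[ℂ] H) :
    posTrace (c • T) = ENNReal.ofReal c * posTrace T := by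
  rw [posTrace, posTrace, ← ENNReal.tsum_mul_left]
  congr 1; funext i
  rw [smul_apply, inner_smul_right_eq_smul, Complex.smul_re, smul_eq_mul, ENNReal.ofReal_mul hc]

theorem smul_nonneg_clm {c : ℝ} (hc : 0 ≤ c) {T : H →L[ℂ] H} (hT : 0 ≤ T) : 0 ≤ c • T :=
  smul_nonneg hc hT

/-- The functional `T ↦ Tr η(T)` is increasing up to the trace. -/
theorem IsSubstate.etaTrace_mono {X Z : H →L[ℂ] H} (hX : IsSubstate X) (hZ : IsSubstate Z)
    (h : X ≤ Z) : etaTrace X ≤ etaTrace Z + posTrace Z := by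
  obtain ⟨ι, b, z, hz⟩ := exists_eigenbasis hZ.1 hZ.posTrace_ne_top
  rw [etaTrace_eq_tsum hZ.isSelfAdjoint hz, etaTrace, posTrace_eq_tsum (cfc_etaPos_nonneg X) b,
    posTrace_eq_tsum hZ.1 b, ← ENNReal.tsum_add]
  refine ENNReal.tsum_le_tsum fun k => ?_
  have hk := b.orthonormal.1 k
  obtain ⟨hz0, hz1⟩ := hZ.eigenvalue_mem hk (hz k)
  have hxz := re_inner_mono h (b k)
  have hx0 := re_inner_nonneg hX.1 (b k)
  rw [re_inner_eigenvector hk (hz k)] at hxz ⊢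
  rw [← ENNReal.ofReal_add (negMulLog_nonneg hz0 hz1) hz0]
  refine ENNReal.ofReal_le_ofReal ?_
  -- Klein's inequality with `q` the eigenvalue of `Z`; then `X ≤ Z` is used inside the linear term,
  -- whose coefficient `-log (z k)` is non-negative.
  have := hX.re_inner_etaPos_add_le hk hz0 hz1 fun h0 => le_antisymm (h0 ▸ hxz) hx0
  have hl : 0 ≤ -log (z k) := by linarith [log_nonpos hz0 hz1]
  rw [negMulLog]
  nlinarith [mul_le_mul_of_nonneg_right hxz hl]

/-- The functional `T ↦ Tr η(T)` is strongly concave. -/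
theorem IsSubstate.etaTrace_midpoint {A B M : H →L[ℂ] H} (hA : IsSubstate A) (hB : IsSubstate B)
    (hM : IsSubstate M) (hABM : A + B = (2 : ℝ) • M) :
    4 * etaTrace A + 4 * etaTrace B + ‖A - B‖ₑ ^ 2 ≤ 8 * etaTrace M := by
  obtain ⟨ι, b, m, hm⟩ := exists_eigenbasis hM.1 hM.posTrace_ne_top
  refine (add_le_add_right (enorm_sq_le_tsum b (A - B)) _).trans ?_
  rw [etaTrace_eq_tsum hM.isSelfAdjoint hm, etaTrace, etaTrace,
    posTrace_eq_tsum (cfc_etaPos_nonneg A) b, posTrace_eq_tsum (cfc_etaPos_nonneg B) b,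
    ← ENNReal.tsum_mul_left, ← ENNReal.tsum_mul_left, ← ENNReal.tsum_mul_left,
    ← ENNReal.tsum_add, ← ENNReal.tsum_add]
  refine ENNReal.tsum_le_tsum fun k => ?_
  have hk := b.orthonormal.1 k
  obtain ⟨hm0, hm1⟩ := hM.eigenvalue_mem hk (hm k)
  have hsum : A (b k) + B (b k) = ((2 * m k : ℝ) : ℂ) • b k := by
    rw [← add_apply, hABM, smul_apply, hm]
    push_cast
    rw [mul_smul]
    rfl
  have hsum' : (⟪b k, A (b k)⟫_ℂ).re + (⟪b k, B (b k)⟫_ℂ).re = 2 * m k := by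
    rw [← Complex.add_re, ← inner_add_right, hsum, inner_smul_right, inner_self_eq_norm_sq_to_K, hk]
    simp
  have hA0 := re_inner_nonneg hA.1 (b k)
  have hB0 := re_inner_nonneg hB.1 (b k)
  have hη : ∀ T : H →L[ℂ] H, 0 ≤ (⟪b k, cfc etaPos T (b k)⟫_ℂ).re := fun T =>
    re_inner_nonneg (cfc_etaPos_nonneg T) _
  have key : 4 * (⟪b k, cfc etaPos A (b k)⟫_ℂ).re + 4 * (⟪b k, cfc etaPos B (b k)⟫_ℂ).re +
      ‖(A - B) (b k)‖ ^ 2 ≤ 8 * negMulLog (m k) := by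
    rcases hm0.eq_or_lt with h0 | h0
    · have hA00 : (⟪b k, A (b k)⟫_ℂ).re = 0 := by linarith
      have hB00 : (⟪b k, B (b k)⟫_ℂ).re = 0 := by linarith
      have h1 := hA.re_inner_etaPos_le hk
      have h2 := hB.re_inner_etaPos_le hk
      rw [hA00] at h1
      rw [hB00] at h2
      rw [← h0, sub_apply, apply_eq_zero_of_re_inner_eq_zero hA.1 hA00,
        apply_eq_zero_of_re_inner_eq_zero hB.1 hB00]
      simp only [negMulLog_zero, sub_zero, norm_zero] at h1 h2 ⊢
      linarith
    -- With `q = m k` for both operators the linear terms add up to `2 η(m k)`, because `M` is the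
    -- midpoint. The remainders are both `‖(A - B) (b k)‖² / 8`, and their sum over `k` dominates
    -- the operator norm.
    · have h1 := hA.re_inner_etaPos_add_sq_le hk h0 hm1
      have h2 := hB.re_inner_etaPos_add_sq_le hk h0 hm1
      have h3 : A (b k) - (m k : ℂ) • b k = (1 / 2 : ℂ) • ((A - B) (b k)) := by
        have : B (b k) = ((2 * m k : ℝ) : ℂ) • b k - A (b k) := by rw [← hsum]; abel
        rw [sub_apply, this]
        push_cast
        match_scalars <;> ring
      have h4 : B (b k) - (m k : ℂ) • b k = (-(1 / 2) : ℂ) • ((A - B) (b k)) := by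
        have : A (b k) = ((2 * m k : ℝ) : ℂ) • b k - B (b k) := by rw [← hsum]; abel
        rw [sub_apply, this]
        push_cast
        match_scalars <;> ring
      rw [h3, norm_smul] at h1
      rw [h4, norm_smul, norm_neg] at h2
      have h5 : ‖(1 / 2 : ℂ)‖ = 1 / 2 := by simp
      rw [h5, mul_pow] at h1 h2
      rw [negMulLog]
      linear_combination 4 * h1 + 4 * h2 + (4 * (-log (m k)) - 4) * hsum'
  have h8 : (8 : ℝ≥0∞) = ENNReal.ofReal 8 := by simp
  have h4 : (4 : ℝ≥0∞) = ENNReal.ofReal 4 := by simp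
  rw [h8, h4, ← ofReal_norm, ← ENNReal.ofReal_pow (norm_nonneg _), ← ENNReal.ofReal_mul (by norm_num),
    ← ENNReal.ofReal_mul (by norm_num), ← ENNReal.ofReal_mul (by norm_num),
    ← ENNReal.ofReal_add (by have := hη A; positivity) (by have := hη B; positivity),
    ← ENNReal.ofReal_add (by have := hη A; have := hη B; positivity) (by positivity)]
  exact ENNReal.ofReal_le_ofReal key

/-- From `η(μ x) = μ η(x) + x η(μ)`, after bounding each `η` on the right by its positive part. -/
theorem etaTrace_smul_le {T : H →L[ℂ] H} (hT : 0 ≤ T) {μ : ℝ} (hμ : 0 ≤ μ) :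
    etaTrace (μ • T) ≤
      ENNReal.ofReal μ * etaTrace T + ENNReal.ofReal (etaPos μ) * posTrace T := by
  have hsa : IsSelfAdjoint T := .of_nonneg hT
  have hc := continuous_etaPos
  rw [etaTrace, etaTrace, ← posTrace_smul hμ, ← posTrace_smul (etaPos_nonneg μ),
    ← posTrace_add (smul_nonneg_clm hμ (cfc_etaPos_nonneg T)) (smul_nonneg_clm (etaPos_nonneg μ) hT)]
  refine posTrace_mono ?_
  rw [← cfc_comp_smul μ etaPos T hc.continuousOn hsa]
  have h1 : μ • cfc etaPos T + etaPos μ • T = cfc (fun x => μ * etaPos x + etaPos μ * x) T := by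
    rw [cfc_add T (fun x => μ * etaPos x) _ (by fun_prop) (by fun_prop),
      cfc_const_mul μ etaPos T hc.continuousOn, cfc_const_mul_id (etaPos μ) T]
  rw [h1]
  refine cfc_mono (fun x hx => ?_) (by simp only [smul_eq_mul]; fun_prop) (by fun_prop)
  have hx0 : 0 ≤ x := spectrum_nonneg_of_nonneg hT hx
  have h2 : negMulLog x ≤ etaPos x := le_max_left _ _
  have h3 : negMulLog μ ≤ etaPos μ := le_max_left _ _
  refine max_le ?_ (by have := etaPos_nonneg x; have := etaPos_nonneg μ; positivity)
  rw [smul_eq_mul, negMulLog_mul]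
  nlinarith [mul_le_mul_of_nonneg_left h2 hμ, mul_le_mul_of_nonneg_left h3 hx0]

/-- On a spectrum bounded by `R` one has `x log x ≤ |log R| x`, so the negative part of `η(T)` is
dominated by a multiple of `T`. -/
theorem posTrace_negPart_ne_top {T : H →L[ℂ] H} (hT : 0 ≤ T) (hfin : posTrace T ≠ ⊤) :
    posTrace (cfc (fun x : ℝ => max (-negMulLog x) 0) T) ≠ ⊤ := by
  obtain ⟨R, hR⟩ := (spectrum.isCompact (𝕜 := ℝ) T).isBounded.exists_norm_le
  have h1 : cfc (fun x : ℝ => max (-negMulLog x) 0) T ≤ |log R| • T := by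
    have h2 : |log R| • T = cfc (fun x => |log R| * x) T := by
      rw [cfc_const_mul_id _ T (IsSelfAdjoint.of_nonneg hT)]
    rw [h2]
    refine cfc_mono (fun x hx => ?_)
      (by have := continuous_negMulLog; fun_prop) (by fun_prop)
    have hx0 : 0 ≤ x := spectrum_nonneg_of_nonneg hT hx
    refine max_le ?_ (by positivity)
    rw [negMulLog]
    rcases hx0.eq_or_lt with rfl | hx0
    · simp
    have h3 : log x ≤ |log R| :=
      (log_le_log hx0 ((le_abs_self x).trans (hR x hx))).trans (le_abs_self _)
    nlinarith [mul_le_mul_of_nonneg_left h3 hx0.le]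
  refine ((posTrace_mono h1).trans_lt ?_).ne
  rw [posTrace_smul (abs_nonneg _)]
  exact ENNReal.mul_lt_top ENNReal.ofReal_lt_top hfin.lt_top

theorem posTrace_toCLM_ne_top {A : TraceClass H} (hA : 0 ≤ A.toCLM) : posTrace A.toCLM ≠ ⊤ := by
  rw [← traceNorm_of_nonneg hA]
  exact A.traceNorm_lt_top.ne

/-- The entropy is finite if and only if the trace of the positive part of `η(A)` is. -/
theorem entropy_finite_iff {A : TraceClass H} (hA : 0 ≤ A.toCLM) :
    (entropy A ≠ ⊥ ∧ entropy A ≠ ⊤) ↔ etaTrace A.toCLM ≠ ⊤ := by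
  have hn := posTrace_negPart_ne_top hA (posTrace_toCLM_ne_top hA)
  have h : entropy A = (etaTrace A.toCLM : EReal) -
    (posTrace (cfc (fun x : ℝ => max (-negMulLog x) 0) A.toCLM) : EReal) -
    (negMulLog A.tr.re : EReal) := rfl
  rw [h]
  lift posTrace (cfc (fun x : ℝ => max (-negMulLog x) 0) A.toCLM) to NNReal using hn with n
  generalize etaTrace A.toCLM = e
  rcases eq_or_ne e ⊤ with rfl | he
  · simp
  · lift e to NNReal using he
    have : ((e : ℝ≥0∞) : EReal) - ((n : ℝ≥0∞) : EReal) - (negMulLog A.tr.re : EReal) =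
        (((e : ℝ) - (n : ℝ) - negMulLog A.tr.re : ℝ) : EReal) := by
      rw [EReal.coe_nnreal_eq_coe_real, EReal.coe_nnreal_eq_coe_real, ← EReal.coe_sub,
        ← EReal.coe_sub]
    rw [this]
    exact ⟨fun _ => ENNReal.coe_ne_top, fun _ => ⟨EReal.coe_ne_bot _, EReal.coe_ne_top _⟩⟩

theorem entropy_eq_of_isSubstate {A : TraceClass H} (hA : IsSubstate A.toCLM) :
    entropy A = (etaTrace A.toCLM : EReal) - (negMulLog A.tr.re : EReal) := by
  have h0 : cfc (fun x : ℝ => max (-negMulLog x) 0) A.toCLM = 0 := by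
    rw [← cfc_const_zero ℝ A.toCLM]
    refine cfc_congr fun x hx => ?_
    obtain ⟨h0, h1⟩ := hA.spectrum_subset hx
    exact max_eq_right (by linarith [negMulLog_nonneg h0 h1])
  have h : entropy A = (etaTrace A.toCLM : EReal) -
    (posTrace (cfc (fun x : ℝ => max (-negMulLog x) 0) A.toCLM) : EReal) -
    (negMulLog A.tr.re : EReal) := rfl
  rw [h, h0]
  simp [posTrace]

theorem classicalEntropy_eq {ι : Type*} {x : ι → ℝ} (h0 : ∀ i, 0 ≤ x i) (h1 : ∀ i, x i ≤ 1) :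
    classicalEntropy x = ((∑' i, ENNReal.ofReal (negMulLog (x i)) : ℝ≥0∞) : EReal) -
      (negMulLog (∑' i, x i) : EReal) := by
  have : ∀ i, ENNReal.ofReal (-negMulLog (x i)) = 0 := fun i =>
    ENNReal.ofReal_of_nonpos (by linarith [negMulLog_nonneg (h0 i) (h1 i)])
  simp [classicalEntropy, this]

end EntropyTrace

/-! ### Countability and reindexing of orthonormal bases. -/

section HilbertBases

set_option linter.unusedSectionVars false

variable {H : Type u} [NormedAddCommGroup H] [InnerProductSpace ℂ H] [CompleteSpace H]

/-- Distinct basis vectors are at distance `√2`, so balls of radius `1 / 2` around them are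
disjoint. -/
theorem countable_of_hilbertBasis [TopologicalSpace.SeparableSpace H] {ι : Type*}
    (b : HilbertBasis ι ℂ H) : Countable ι := by
  refine Pairwise.countable_of_isOpen_disjoint (s := fun i => Metric.ball (b i) (1 / 2))
    (fun i j hij => ?_) (fun i => Metric.isOpen_ball) fun i => ⟨b i, Metric.mem_ball_self (by norm_num)⟩
  refine Metric.ball_disjoint_ball ?_
  rw [dist_eq_norm]
  have h : ‖b i - b j‖ ^ 2 = 2 := by
    rw [norm_sub_sq (𝕜 := ℂ), b.orthonormal.2 hij, b.orthonormal.1 i, b.orthonormal.1 j]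
    norm_num
  nlinarith [norm_nonneg (b i - b j)]

/-- A Hilbert basis reindexed along an equivalence. -/
theorem exists_reindex {ι κ : Type*} (b : HilbertBasis ι ℂ H) (e : κ ≃ ι) :
    ∃ c : HilbertBasis κ ℂ H, ∀ k, c k = b (e k) := by
  refine ⟨HilbertBasis.mk (v := fun k => b (e k)) (b.orthonormal.comp e e.injective) ?_, fun k => ?_⟩
  · have : Set.range (fun k => b (e k)) = Set.range b := by
      rw [show (fun k => b (e k)) = b ∘ e from rfl, e.surjective.range_comp]
    rw [this, b.dense_span]
  · rw [HilbertBasis.coe_mk]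

/-- Eigenbases are indexed in the universe of the space, while `HasSummableDualWeights` asks for an
index in `Type`. -/
theorem exists_equiv_type_zero (ι : Type*) [Countable ι] : ∃ κ : Type, Nonempty (κ ≃ ι) := by
  obtain ⟨f, hf⟩ := exists_injective_nat ι
  exact ⟨Set.range f, ⟨(Equiv.ofInjective f hf).symm⟩⟩

end HilbertBases

/-! ### First-order optimality of near-maximizers of the entropy. -/

section NearMaximizers

set_option linter.unusedSectionVars false

open Real

variable {H : Type u} [NormedAddCommGroup H] [InnerProductSpace ℂ H] [CompleteSpace H]

theorem sqrt_apply_of_eigenvector {L : H →L[ℂ] H} (hL : 0 ≤ L) {x : H} {l : ℝ}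
    (h : L x = (l : ℂ) • x) : CFC.sqrt L x = (√l : ℂ) • x := by
  have h1 : CFC.sqrt L = cfc Real.sqrt L := by
    rw [CFC.sqrt_eq_cfc, cfc_nnreal_eq_real NNReal.sqrt L hL]
    refine cfc_congr fun s hs => ?_
    simp only [Real.coe_sqrt, Real.coe_toNNReal s (spectrum_nonneg_of_nonneg hL hs)]
  rw [h1]
  exact cfc_apply_of_eigenvector (.of_nonneg hL) Real.continuous_sqrt h

/-- The trace of a product of positive operators in an eigenbasis of one of them. -/
theorem tsum_inner_sqrt_eq {T L : H →L[ℂ] H} (hT : 0 ≤ T) (hL : 0 ≤ L) {ι κ : Type*}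
    (b : HilbertBasis ι ℂ H) {e : HilbertBasis κ ℂ H} {l : κ → ℝ}
    (h : ∀ k, L (e k) = (l k : ℂ) • e k) :
    ∑' i, ENNReal.ofReal (⟪CFC.sqrt T (b i), L (CFC.sqrt T (b i))⟫_ℂ).re =
      ∑' k, ENNReal.ofReal (l k * (⟪e k, T (e k)⟫_ℂ).re) := by
  have hTs : (CFC.sqrt T).adjoint = CFC.sqrt T := IsSelfAdjoint.of_nonneg (CFC.sqrt_nonneg T)
  have hLs : (CFC.sqrt L).adjoint = CFC.sqrt L := IsSelfAdjoint.of_nonneg (CFC.sqrt_nonneg L)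
  -- Both sides are the squared Hilbert–Schmidt norm of `√L √T`, computed from the operator and from
  -- its adjoint.
  have h1 := tsum_enorm_sq_adjoint b e (CFC.sqrt L ∘L CFC.sqrt T)
  rw [ContinuousLinearMap.adjoint_comp, hTs, hLs] at h1
  simp only [ContinuousLinearMap.comp_apply] at h1
  simp_rw [ofReal_inner_eq hL]
  rw [h1]
  congr 1; funext k
  have hl : 0 ≤ l k := by
    rw [← re_inner_eigenvector (e.orthonormal.1 k) (h k)]
    exact re_inner_nonneg hL _
  rw [sqrt_apply_of_eigenvector hL (h k), map_smul, enorm_smul, mul_pow, ENNReal.ofReal_mul hl,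
    ofReal_inner_eq hT, ← ofReal_norm (√(l k) : ℂ), Complex.norm_real,
    Real.norm_of_nonneg (Real.sqrt_nonneg _), ← ENNReal.ofReal_pow (Real.sqrt_nonneg _),
    Real.sq_sqrt hl]

/-- Fatou's lemma for series: the bound passes to the limit on each finite partial sum. -/
theorem tsum_ofReal_le_of_tendsto {ι α : Type*} {l : Filter α} [l.NeBot] {f : α → ι → ℝ}
    {g : ι → ℝ} {C : ℝ≥0∞} (h : ∀ᶠ a in l, ∑' i, ENNReal.ofReal (f a i) ≤ C)
    (hlim : ∀ i, Tendsto (fun a => f a i) l (𝓝 (g i))) : ∑' i, ENNReal.ofReal (g i) ≤ C := by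
  rw [ENNReal.tsum_eq_iSup_sum]
  refine iSup_le fun F => ?_
  refine le_of_tendsto (tendsto_finsetSum F fun i _ => ENNReal.tendsto_ofReal (hlim i)) ?_
  exact h.mono fun a ha => (ENNReal.sum_le_tsum F).trans ha

theorem tendsto_re_inner {α : Type*} {l : Filter α} {T : α → H →L[ℂ] H} {S : H →L[ℂ] H}
    (h : Tendsto T l (𝓝 S)) (x : H) :
    Tendsto (fun a => (⟪x, T a x⟫_ℂ).re) l (𝓝 (⟪x, S x⟫_ℂ).re) := by
  have hc : Continuous fun T : H →L[ℂ] H => (⟪x, T x⟫_ℂ).re := by fun_prop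
  exact (hc.tendsto S).comp h

/-- Trace may be lost in an operator-norm limit, so only the bound by one is stable, not a fixed
value of the trace. -/
theorem isSubstate_of_tendsto {α : Type*} {l : Filter α} [l.NeBot] {T : α → H →L[ℂ] H}
    {S : H →L[ℂ] H} (hT : ∀ᶠ a in l, IsSubstate (T a)) (h : Tendsto T l (𝓝 S)) : IsSubstate S :=
  ⟨ge_of_tendsto h (hT.mono fun _ ha => ha.1),
    tsum_ofReal_le_of_tendsto (hT.mono fun _ ha => ha.2) fun _ => tendsto_re_inner h _⟩

/-- A continuous truncation of `- log x` on the unit interval. -/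
def truncLog (r x : ℝ) : ℝ := max (-log (max x r)) 0

theorem continuous_truncLog {r : ℝ} (hr : 0 < r) : Continuous (truncLog r) := by
  refine Continuous.max (Continuous.neg ?_) continuous_const
  exact Continuous.log (by fun_prop) fun x => (lt_max_of_lt_right hr).ne'

theorem truncLog_nonneg (r x : ℝ) : 0 ≤ truncLog r x := le_max_right _ _

theorem truncLog_le {r x : ℝ} (hx : 0 < x) (hx1 : x ≤ 1) : truncLog r x ≤ -log x := by
  refine max_le (neg_le_neg (log_le_log hx (le_max_left _ _))) ?_
  linarith [log_nonpos hx.le hx1]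

/-- If `T'` almost maximizes the entropy `Tr η` on a convex set, then `- Tr T log Z` is bounded for
a convex combination `Z` of `T` and `T'` in which `T` has a small weight. -/
theorem tsum_inner_mul_neg_log_le {T T' Z : H →L[ℂ] H} (hT : IsSubstate T) (hT' : IsSubstate T')
    (hZ : IsSubstate Z) {ε C : ℝ} (hε : 0 < ε) (hε1 : ε < 1)
    (hZT : Z = (1 - ε) • T' + ε • T) (hC0 : 0 ≤ C)
    (hC : etaTrace Z ≤ ENNReal.ofReal C) (hC' : ENNReal.ofReal C ≤ etaTrace T' + ENNReal.ofReal ε)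
    {κ : Type*} {e : HilbertBasis κ ℂ H} {z : κ → ℝ} (hz : ∀ k, Z (e k) = (z k : ℂ) • e k) :
    ∑' k, ENNReal.ofReal (-log (z k) * (⟪e k, T (e k)⟫_ℂ).re) ≤ ENNReal.ofReal (C + 2) := by
  have he := e.orthonormal.1
  have hz01 := fun k => hZ.eigenvalue_mem (he k) (hz k)
  have ht := fun k => re_inner_nonneg hT.1 (e k)
  have ht' := fun k => re_inner_nonneg hT'.1 (e k)
  have hl : ∀ k, 0 ≤ -log (z k) := fun k => by linarith [log_nonpos (hz01 k).1 (hz01 k).2]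
  have hzt : ∀ k, z k = (1 - ε) * (⟪e k, T' (e k)⟫_ℂ).re + ε * (⟪e k, T (e k)⟫_ℂ).re := by
    intro k
    rw [← re_inner_eigenvector (he k) (hz k), hZT]
    simp only [add_apply, smul_apply, inner_add_right, inner_smul_right_eq_smul, Complex.add_re,
      Complex.smul_re, smul_eq_mul]
  -- Here `a = -Tr T' log Z` and `b = -Tr T log Z`, so that `(1 - ε) a + ε b = Tr η(Z) ≤ C`. A lower
  -- bound on `a` then yields an upper bound on `b`.
  set a := ∑' k, ENNReal.ofReal (-log (z k) * (⟪e k, T' (e k)⟫_ℂ).re) with ha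
  set b := ∑' k, ENNReal.ofReal (-log (z k) * (⟪e k, T (e k)⟫_ℂ).re) with hb
  have h1ε : 0 < 1 - ε := by linarith
  have hab : ENNReal.ofReal (1 - ε) * a + ENNReal.ofReal ε * b ≤ ENNReal.ofReal C := by
    refine le_trans (le_of_eq ?_) hC
    rw [etaTrace_eq_tsum hZ.isSelfAdjoint hz, ha, hb, ← ENNReal.tsum_mul_left,
      ← ENNReal.tsum_mul_left, ← ENNReal.tsum_add]
    congr 1; funext k
    have := hl k; have := ht k; have := ht' k
    rw [← ENNReal.ofReal_mul h1ε.le, ← ENNReal.ofReal_mul hε.le,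
      ← ENNReal.ofReal_add (by positivity) (by positivity)]
    congr 1
    rw [negMulLog]
    -- Only the linear factor of `-z * log z` is expanded, not the arguments of the logarithms.
    nth_rw 3 [hzt k]
    ring
  have hZp : posTrace Z ≤ posTrace T' + ENNReal.ofReal ε := by
    rw [hZT, posTrace_add (smul_nonneg_clm h1ε.le hT'.1) (smul_nonneg_clm hε.le hT.1),
      posTrace_smul h1ε.le, posTrace_smul hε.le]
    gcongr
    · exact mul_le_of_le_one_left zero_le (ENNReal.ofReal_le_one.mpr (by linarith))
    · exact mul_le_of_le_one_right zero_le hT.2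
  -- Klein's inequality for `T'` against `Z` costs `Tr Z - Tr T' ≤ ε`. An eigenvector in the kernel
  -- of `Z` is harmless, since the diagonal entry of `T'` vanishes there.
  have hT'a : etaTrace T' ≤ a + ENNReal.ofReal ε := by
    have h : etaTrace T' + posTrace T' ≤ a + posTrace Z := by
      rw [etaTrace, posTrace_eq_tsum (cfc_etaPos_nonneg T') e, posTrace_eq_tsum hT'.1 e,
        posTrace_eq_tsum hZ.1 e, ha, ← ENNReal.tsum_add, ← ENNReal.tsum_add]
      refine ENNReal.tsum_le_tsum fun k => ?_
      have := hl k; have := ht' k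
      rw [re_inner_eigenvector (he k) (hz k),
        ← ENNReal.ofReal_add (re_inner_nonneg (cfc_etaPos_nonneg T') _) (ht' k),
        ← ENNReal.ofReal_add (by positivity) (hz01 k).1]
      refine ENNReal.ofReal_le_ofReal ?_
      rw [mul_comm]
      refine hT'.re_inner_etaPos_add_le (he k) (hz01 k).1 (hz01 k).2 fun h0 => ?_
      have h1 := hzt k
      rw [h0] at h1
      have h2 : 0 ≤ ε * (⟪e k, T (e k)⟫_ℂ).re := mul_nonneg hε.le (ht k)
      nlinarith [ht' k]
    have h2 : etaTrace T' + posTrace T' ≤ (a + ENNReal.ofReal ε) + posTrace T' := by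
      refine h.trans ?_
      rw [add_assoc, add_comm (ENNReal.ofReal ε)]
      gcongr
    exact (ENNReal.add_le_add_iff_right hT'.posTrace_ne_top).mp h2
  have hfin := hab.trans_lt ENNReal.ofReal_lt_top
  obtain ⟨hfa, hfb⟩ := ENNReal.add_lt_top.mp hfin
  have hane : a ≠ ⊤ := fun h => by
    rw [h, ENNReal.mul_top (by simpa using h1ε)] at hfa
    exact hfa.ne rfl
  have hbne : b ≠ ⊤ := fun h => by
    rw [h, ENNReal.mul_top (by simpa using hε)] at hfb
    exact hfb.ne rfl
  have hCa : ENNReal.ofReal C ≤ a + ENNReal.ofReal ε + ENNReal.ofReal ε :=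
    hC'.trans (by gcongr)
  rw [← ENNReal.ofReal_toReal hane, ← ENNReal.ofReal_add (by positivity) (by positivity),
    ← ENNReal.ofReal_add (by positivity) (by positivity),
    ENNReal.ofReal_le_ofReal_iff (by positivity)] at hCa
  rw [← ENNReal.ofReal_toReal hane, ← ENNReal.ofReal_toReal hbne,
    ← ENNReal.ofReal_mul h1ε.le, ← ENNReal.ofReal_mul hε.le,
    ← ENNReal.ofReal_add (by positivity) (by positivity),
    ENNReal.ofReal_le_ofReal_iff hC0] at hab
  rw [← ENNReal.ofReal_toReal hbne]
  refine ENNReal.ofReal_le_ofReal ?_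
  -- Near-maximality gives `a ≥ C - 2 ε`, whence `ε b ≤ C - (1 - ε) (C - 2 ε) ≤ ε (C + 2)`.
  have h3 : (1 - ε) * (C - 2 * ε) ≤ (1 - ε) * a.toReal := by gcongr; linarith
  refine le_of_mul_le_mul_left ?_ hε
  nlinarith [sq_nonneg ε]

end NearMaximizers

/-! ### The limit of near-maximizers and the weights it defines. -/

section Weights

set_option linter.unusedSectionVars false

open Real

variable {H : Type u} [NormedAddCommGroup H] [InnerProductSpace ℂ H] [CompleteSpace H]

theorem isSubstate_convexCombination {S T : H →L[ℂ] H} (hS : IsSubstate S) (hT : IsSubstate T)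
    {ε : ℝ} (hε : 0 ≤ ε) (hε1 : ε ≤ 1) : IsSubstate ((1 - ε) • S + ε • T) := by
  have h1 : 0 ≤ 1 - ε := by linarith
  refine ⟨add_nonneg (smul_nonneg_clm h1 hS.1) (smul_nonneg_clm hε hT.1), ?_⟩
  rw [posTrace_add (smul_nonneg_clm h1 hS.1) (smul_nonneg_clm hε hT.1), posTrace_smul h1,
    posTrace_smul hε]
  calc _ ≤ ENNReal.ofReal (1 - ε) * 1 + ENNReal.ofReal ε * 1 := by
        gcongr
        · exact hS.2
        · exact hT.2
    _ = 1 := by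
        rw [mul_one, mul_one, ← ENNReal.ofReal_add h1 hε]
        simp

theorem two_div_add_le {N n m : ℕ} (hn : N ≤ n) (hm : N ≤ m) :
    4 * (1 / ((n : ℝ) + 2)) + 4 * (1 / ((m : ℝ) + 2)) ≤ 8 * (1 / ((N : ℝ) + 2)) := by
  have h : ∀ k : ℕ, N ≤ k → 1 / ((k : ℝ) + 2) ≤ 1 / ((N : ℝ) + 2) := fun k hk => by gcongr
  linarith [h n hn, h m hm]

/-- On a convex set of operators with bounded entropy, sequences that maximize the entropy
converge. -/
theorem exists_tendsto_of_near_maximal {𝒞 : Set (H →L[ℂ] H)} (hsub : ∀ T ∈ 𝒞, IsSubstate T)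
    (hconv : Convex ℝ 𝒞) {C : ℝ} (hC : ∀ T ∈ 𝒞, etaTrace T ≤ ENNReal.ofReal C) {T : ℕ → H →L[ℂ] H}
    (hT : ∀ n, T n ∈ 𝒞)
    (hmax : ∀ n : ℕ, ENNReal.ofReal C ≤ etaTrace (T n) + ENNReal.ofReal (1 / ((n : ℝ) + 2))) :
    ∃ S, Tendsto T atTop (𝓝 S) := by
  refine cauchySeq_tendsto_of_complete (cauchySeq_of_le_tendsto_0
    (fun N : ℕ => √(8 * (1 / ((N : ℝ) + 2)))) (fun n m N hn hm => ?_) ?_)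
  -- The midpoint stays in the convex set, so its `Tr η` is at most `C`; strong concavity leaves `‖T
  -- n - T m‖² ≤ 4 / (n + 2) + 4 / (m + 2)`.
  · have hM : (1 / 2 : ℝ) • T n + (1 / 2 : ℝ) • T m ∈ 𝒞 :=
      hconv (hT n) (hT m) (by norm_num) (by norm_num) (by norm_num)
    have h1 := (hsub _ (hT n)).etaTrace_midpoint (hsub _ (hT m)) (hsub _ hM)
      (by rw [smul_add, smul_smul, smul_smul]; norm_num)
    have h2 : 8 * etaTrace ((1 / 2 : ℝ) • T n + (1 / 2 : ℝ) • T m) ≤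
        4 * etaTrace (T n) + 4 * etaTrace (T m) + ENNReal.ofReal (8 * (1 / ((N : ℝ) + 2))) := by
      calc _ ≤ 8 * ENNReal.ofReal C := by gcongr; exact hC _ hM
        _ = 4 * ENNReal.ofReal C + 4 * ENNReal.ofReal C := by ring
        _ ≤ 4 * (etaTrace (T n) + ENNReal.ofReal (1 / ((n : ℝ) + 2))) +
            4 * (etaTrace (T m) + ENNReal.ofReal (1 / ((m : ℝ) + 2))) := by
          gcongr
          · exact hmax n
          · exact hmax m
        _ = 4 * etaTrace (T n) + 4 * etaTrace (T m) +
            ENNReal.ofReal (4 * (1 / ((n : ℝ) + 2)) + 4 * (1 / ((m : ℝ) + 2))) := by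
          rw [ENNReal.ofReal_add (by positivity) (by positivity), ENNReal.ofReal_mul (by norm_num),
            ENNReal.ofReal_mul (by norm_num)]
          simp only [ENNReal.ofReal_ofNat]
          ring
        _ ≤ _ := by gcongr; exact two_div_add_le hn hm
    have hfin : ∀ k, etaTrace (T k) ≠ ⊤ := fun k =>
      ((hC _ (hT k)).trans_lt ENNReal.ofReal_lt_top).ne
    have h3 := (ENNReal.add_le_add_iff_left (ENNReal.add_ne_top.mpr
      ⟨ENNReal.mul_ne_top (by simp) (hfin n), ENNReal.mul_ne_top (by simp) (hfin m)⟩)).mp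
      (h1.trans h2)
    rw [← ofReal_norm, ← ENNReal.ofReal_pow (norm_nonneg _),
      ENNReal.ofReal_le_ofReal_iff (by positivity)] at h3
    rw [dist_eq_norm]
    exact Real.le_sqrt_of_sq_le h3
  · have h : Tendsto (fun N : ℕ => 1 / ((N : ℝ) + 2)) atTop (𝓝 0) := by
      have := (tendsto_add_atTop_iff_nat 1).mpr (tendsto_one_div_add_atTop_nhds_zero_nat (𝕜 := ℝ))
      refine this.congr fun n => ?_
      push_cast
      ring_nf
    simpa using (h.const_mul 8).sqrt

/-- For a convex set `𝒞` of positive operators with bounded entropy there is an operator `S` of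
trace at most one such that `- Tr T log S` is bounded for `T` in `𝒞`. -/
theorem exists_truncLog_bound {𝒞 : Set (H →L[ℂ] H)} (hne : 𝒞.Nonempty)
    (hsub : ∀ T ∈ 𝒞, IsSubstate T) (hconv : Convex ℝ 𝒞) {C₀ : ℝ≥0∞} (hC₀ : C₀ ≠ ⊤)
    (hC : ∀ T ∈ 𝒞, etaTrace T ≤ C₀) :
    ∃ S : H →L[ℂ] H, IsSubstate S ∧ ∃ C : ℝ≥0∞, C ≠ ⊤ ∧ ∀ T ∈ 𝒞, ∀ r : ℝ, 0 < r →
      ∑' i, ENNReal.ofReal (⟪CFC.sqrt T (stdBasis H i),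
        cfc (truncLog r) S (CFC.sqrt T (stdBasis H i))⟫_ℂ).re ≤ C := by
  set s : ℝ≥0∞ := ⨆ T ∈ 𝒞, etaTrace T with hs
  have hsfin : s ≠ ⊤ := ((iSup₂_le hC).trans_lt hC₀.lt_top).ne
  set C := s.toReal with hCdef
  have hsC : s = ENNReal.ofReal C := (ENNReal.ofReal_toReal hsfin).symm
  have hle : ∀ T ∈ 𝒞, etaTrace T ≤ ENNReal.ofReal C := fun T hT =>
    hsC ▸ le_iSup₂ (f := fun T (_ : T ∈ 𝒞) => etaTrace T) T hT
  have hnear : ∀ n : ℕ, ∃ T ∈ 𝒞,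
      ENNReal.ofReal C ≤ etaTrace T + ENNReal.ofReal (1 / ((n : ℝ) + 2)) := by
    intro n
    by_contra! hcon
    obtain ⟨T₀, hT₀⟩ := hne
    have hδ : ENNReal.ofReal (1 / ((n : ℝ) + 2)) ≠ 0 := by
      rw [ne_eq, ENNReal.ofReal_eq_zero, not_le]; positivity
    have h1 : s ≤ s - ENNReal.ofReal (1 / ((n : ℝ) + 2)) := by
      conv_lhs => rw [hs]
      refine iSup₂_le fun T hT => ENNReal.le_sub_of_add_le_right ENNReal.ofReal_ne_top ?_
      rw [hsC]
      exact (hcon T hT).le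
    have hs0 : s ≠ 0 := fun h0 => by
      have := hcon T₀ hT₀
      rw [← hsC, h0] at this
      exact not_lt_zero this
    exact absurd h1 (not_le.mpr (ENNReal.sub_lt_self hsfin hs0 hδ))
  choose T' hT'mem hT'max using hnear
  obtain ⟨S, hS⟩ := exists_tendsto_of_near_maximal hsub hconv hle hT'mem hT'max
  have hSsub : IsSubstate S :=
    isSubstate_of_tendsto (Eventually.of_forall fun n => hsub _ (hT'mem n)) hS
  refine ⟨S, hSsub, ENNReal.ofReal (C + 2), ENNReal.ofReal_ne_top, fun T hT r hr => ?_⟩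
  have hTsub := hsub T hT
  -- The mixing weight equals the defect of near-maximality of `T' n`, and is below one already at
  -- `n = 0`. As it tends to zero, the mixtures `Z n` converge to `S` for every `T`.
  set ε : ℕ → ℝ := fun n => 1 / ((n : ℝ) + 2) with hεdef
  have hε : ∀ n, 0 < ε n := fun n => by positivity
  have hε1 : ∀ n, ε n < 1 := fun n => by
    rw [hεdef, div_lt_one (by positivity)]; linarith [(n.cast_nonneg : (0 : ℝ) ≤ n)]
  have hεlim : Tendsto ε atTop (𝓝 0) := by
    have := (tendsto_add_atTop_iff_nat 1).mpr (tendsto_one_div_add_atTop_nhds_zero_nat (𝕜 := ℝ))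
    refine this.congr fun n => ?_
    rw [hεdef]
    push_cast
    ring_nf
  set Z : ℕ → H →L[ℂ] H := fun n => (1 - ε n) • T' n + ε n • T with hZdef
  have hZsub : ∀ n, IsSubstate (Z n) := fun n =>
    isSubstate_convexCombination (hsub _ (hT'mem n)) hTsub (hε n).le (hε1 n).le
  have hZmem : ∀ n, Z n ∈ 𝒞 := fun n =>
    hconv (hT'mem n) hT (by linarith [hε1 n]) (hε n).le (by ring)
  have hZlim : Tendsto Z atTop (𝓝 S) := by
    have := (((tendsto_const_nhds (x := (1 : ℝ))).sub hεlim).smul hS).add (hεlim.smul_const T)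
    simpa using this
  -- The logarithm is not continuous at zero; its truncation is, so the functional calculus passes
  -- to the limit, with a bound that does not depend on `r`.
  have hcfc : Tendsto (fun n => cfc (truncLog r) (Z n)) atTop (𝓝 (cfc (truncLog r) S)) :=
    hZlim.cfc isCompact_Icc (truncLog r) (Eventually.of_forall fun n => (hZsub n).spectrum_subset)
      (Eventually.of_forall fun n => (hZsub n).isSelfAdjoint) hSsub.spectrum_subset
      hSsub.isSelfAdjoint (continuous_truncLog hr).continuousOn
  refine tsum_ofReal_le_of_tendsto (Eventually.of_forall fun n => ?_)
    fun i => tendsto_re_inner hcfc _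
  obtain ⟨κ, e, z, hz⟩ := exists_eigenbasis (hZsub n).1 (hZsub n).posTrace_ne_top
  rw [tsum_inner_sqrt_eq hTsub.1 (cfc_nonneg fun x _ => truncLog_nonneg r x) (stdBasis H)
    fun k => cfc_apply_of_eigenvector (hZsub n).isSelfAdjoint (continuous_truncLog hr) (hz k)]
  refine le_trans (ENNReal.tsum_le_tsum fun k => ENNReal.ofReal_le_ofReal ?_)
    (tsum_inner_mul_neg_log_le hTsub (hsub _ (hT'mem n)) (hZsub n) (hε n) (hε1 n) rfl
      ENNReal.toReal_nonneg (hle _ (hZmem n)) (hT'max n) hz)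
  obtain ⟨hz0, hz1⟩ := (hZsub n).eigenvalue_mem (e.orthonormal.1 k) (hz k)
  have ht := re_inner_nonneg hTsub.1 (e k)
  -- At a zero eigenvalue of `Z n` the truncation may exceed the conventional value `-log 0 = 0`,
  -- but there the diagonal entry of `T` vanishes.
  rcases hz0.eq_or_lt with h0 | h0
  · have h1 := re_inner_eigenvector (e.orthonormal.1 k) (hz k)
    simp only [hZdef, add_apply, smul_apply, inner_add_right, inner_smul_right_eq_smul,
      Complex.add_re, Complex.smul_re, smul_eq_mul] at h1
    have h2 := mul_nonneg (sub_nonneg.mpr (hε1 n).le)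
      (re_inner_nonneg (hsub _ (hT'mem n)).1 (e k))
    have h3 : ε n * (⟪e k, T (e k)⟫_ℂ).re ≤ 0 := by linarith
    have h4 : (⟪e k, T (e k)⟫_ℂ).re = 0 := le_antisymm (by nlinarith [hε n]) ht
    rw [h4]
    simp
  · exact mul_le_mul_of_nonneg_right (truncLog_le h0 hz1) ht

/-- For a convex set of positive operators with bounded entropy there is an orthonormal basis with
weights `h i ≥ 0` such that `∑ exp (-h i) < ∞` and the sums `∑ h i ⟨i|T|i⟩` are bounded. -/
theorem exists_weights [TopologicalSpace.SeparableSpace H] {𝒞 : Set (H →L[ℂ] H)}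
    (hsub : ∀ T ∈ 𝒞, IsSubstate T) (hconv : Convex ℝ 𝒞) {C₀ : ℝ≥0∞} (hC₀ : C₀ ≠ ⊤)
    (hC : ∀ T ∈ 𝒞, etaTrace T ≤ C₀) :
    ∃ (ι : Type) (b : HilbertBasis ι ℂ H) (h : ι → ℝ), (∀ i, 0 ≤ h i) ∧
      (Summable fun i => exp (-h i)) ∧ ∃ C : ℝ≥0∞, C ≠ ⊤ ∧ ∀ T ∈ 𝒞,
        ∑' i, ENNReal.ofReal (h i * (⟪b i, T (b i)⟫_ℂ).re) ≤ C := by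
  obtain ⟨S, hS, C, hCfin, hSC⟩ : ∃ S : H →L[ℂ] H, IsSubstate S ∧ ∃ C : ℝ≥0∞, C ≠ ⊤ ∧
      ∀ T ∈ 𝒞, ∀ r : ℝ, 0 < r → ∑' i, ENNReal.ofReal (⟪CFC.sqrt T (stdBasis H i),
        cfc (truncLog r) S (CFC.sqrt T (stdBasis H i))⟫_ℂ).re ≤ C := by
    rcases 𝒞.eq_empty_or_nonempty with rfl | hne
    · exact ⟨0, ⟨le_rfl, by simp [posTrace]⟩, 0, by simp⟩
    · exact exists_truncLog_bound hne hsub hconv hC₀ hC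
  obtain ⟨κ, e', s', hs'⟩ := exists_eigenbasis hS.1 hS.posTrace_ne_top
  have := countable_of_hilbertBasis e'
  obtain ⟨ι, ⟨φ⟩⟩ := exists_equiv_type_zero κ
  obtain ⟨e, he⟩ := exists_reindex e' φ
  set s : ι → ℝ := fun i => s' (φ i) with hsdef
  have hs : ∀ i, S (e i) = (s i : ℂ) • e i := fun i => by rw [he]; exact hs' (φ i)
  have hcount := countable_of_hilbertBasis e
  have := Encodable.ofCountable ι
  -- `S` may have zero eigenvalues, where `-log (s i)` would be infinite. Replacing `s i` by `max (s
  -- i) (w i)`, with `w` positive and summable, keeps the weights finite and `∑ exp (-h i) ≤ ∑ s i +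
  -- ∑ w i`.
  obtain ⟨w, hw, c, hwc, hc1⟩ := posSumOfEncodable one_pos ι
  have hw1 : ∀ i, w i ≤ 1 := fun i => (le_hasSum hwc i fun j _ => (hw j).le).trans hc1
  have hs01 := fun i => hS.eigenvalue_mem (e.orthonormal.1 i) (hs i)
  have hmax : ∀ i, 0 < max (s i) (w i) := fun i => lt_max_of_lt_right (hw i)
  have hmax1 : ∀ i, max (s i) (w i) ≤ 1 := fun i => max_le (hs01 i).2 (hw1 i)
  have hh : ∀ i, 0 ≤ -log (max (s i) (w i)) := fun i => by
    linarith [log_nonpos (hmax i).le (hmax1 i)]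
  refine ⟨ι, e, fun i => -log (max (s i) (w i)), hh, ?_, C, hCfin, fun T hT => ?_⟩
  · have hsum : Summable s := by
      have h1 := hS.posTrace_ne_top
      rw [posTrace_eq_tsum hS.1 e] at h1
      refine (ENNReal.summable_toReal h1).congr fun i => ?_
      rw [re_inner_eigenvector (e.orthonormal.1 i) (hs i), ENNReal.toReal_ofReal (hs01 i).1]
    refine Summable.of_nonneg_of_le (fun i => (exp_pos _).le) (fun i => ?_) (hsum.add hwc.summable)
    rw [neg_neg, exp_log (hmax i)]
    exact max_le (by linarith [(hw i).le]) (by linarith [(hs01 i).1])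
  · rw [ENNReal.tsum_eq_iSup_sum]
    refine iSup_le fun F => ?_
    -- For a finite set of indices a truncation level below all the `w i` gives `h i ≤ truncLog r (s
    -- i)`.
    obtain ⟨r, hr, hrF⟩ : ∃ r > 0, ∀ i ∈ F, r ≤ w i := by
      rcases F.eq_empty_or_nonempty with rfl | hF
      · exact ⟨1, one_pos, by simp⟩
      · obtain ⟨j, -, hj⟩ := F.exists_min_image w hF
        exact ⟨w j, hw j, hj⟩
    refine le_trans ?_ (hSC T hT r hr)
    rw [tsum_inner_sqrt_eq (hsub T hT).1 (cfc_nonneg fun x _ => truncLog_nonneg r x) (stdBasis H)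
      fun k => cfc_apply_of_eigenvector hS.isSelfAdjoint (continuous_truncLog hr) (hs k)]
    refine le_trans (Finset.sum_le_sum fun i hi => ENNReal.ofReal_le_ofReal ?_)
      (ENNReal.sum_le_tsum F)
    refine mul_le_mul_of_nonneg_right ?_ (re_inner_nonneg (hsub T hT).1 _)
    refine le_max_of_le_left (neg_le_neg (log_le_log (lt_max_of_lt_right hr) ?_))
    exact max_le_max le_rfl (hrF i hi)

end Weights

/-! ### Completeness of the trace norm, infinite mixtures and monotone series of operators. -/

section Duality

set_option linter.unusedSectionVars false

variable {H : Type u} [NormedAddCommGroup H] [InnerProductSpace ℂ H] [CompleteSpace H]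
variable {K : Type v} [NormedAddCommGroup K] [InnerProductSpace ℂ K] [CompleteSpace K]

namespace TraceClass

theorem pairing_add_right (A : TraceClass H) (B B' : H →L[ℂ] H) :
    pairing (B + B') A = pairing B A + pairing B' A := by
  rw [pairing_apply, pairing_apply, pairing_apply, trace, trace, trace,
    ← (hasSum_trace_mul A B).1.tsum_add (hasSum_trace_mul A B').1]
  congr 1; funext i
  rw [mul_add, add_apply, inner_add_right]

theorem pairing_smul_right (A : TraceClass H) (c : ℝ) (B : H →L[ℂ] H) :
    pairing (c • B) A = (c : ℂ) * pairing B A := by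
  rw [pairing_apply, pairing_apply, trace, trace, ← tsum_mul_left]
  congr 1; funext i
  rw [mul_smul_comm, smul_apply, inner_smul_right_eq_smul, Complex.real_smul]

theorem toCLM_smul_real (c : ℝ) (A : TraceClass H) : (c • A).toCLM = c • A.toCLM :=
  LinearMap.map_smul_of_tower toCLM c A

/-- The trace-class operators are complete for the trace norm. -/
instance : CompleteSpace (TraceClass H) := by
  refine Metric.complete_of_cauchySeq_tendsto fun a ha => ?_
  have hC : CauchySeq fun n => (a n).toCLM := by
    refine Metric.cauchySeq_iff'.mpr fun ε hε => ?_
    obtain ⟨N, hN⟩ := Metric.cauchySeq_iff'.mp ha ε hε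
    refine ⟨N, fun n hn => (hN n hn).trans_le' ?_⟩
    rw [dist_eq_norm, dist_eq_norm, ← map_sub]
    exact norm_toCLM_le _
  obtain ⟨S, hS⟩ := cauchySeq_tendsto_of_complete hC
  -- The trace norm is lower semicontinuous for operator-norm limits: by `traceNorm_le_of_forall` it
  -- is controlled by finite sums that depend continuously on the operator.
  have key : ∀ ε > 0, ∃ N, ∀ n ≥ N, traceNorm (S - (a n).toCLM) ≤ ENNReal.ofReal ε := by
    intro ε hε
    obtain ⟨N, hN⟩ := Metric.cauchySeq_iff.mp ha ε hε
    refine ⟨N, fun n hn => traceNorm_le_of_forall _ _ fun W F hW => ?_⟩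
    have hlim : Tendsto (fun m => ∑ i ∈ F, ‖⟪W (stdBasis H i),
        ((a m).toCLM - (a n).toCLM) (stdBasis H i)⟫_ℂ‖ₑ) atTop
        (𝓝 (∑ i ∈ F, ‖⟪W (stdBasis H i), (S - (a n).toCLM) (stdBasis H i)⟫_ℂ‖ₑ)) := by
      refine tendsto_finsetSum F fun i _ => ?_
      have hc : Continuous fun T : H →L[ℂ] H =>
          ‖⟪W (stdBasis H i), (T - (a n).toCLM) (stdBasis H i)⟫_ℂ‖ₑ := by fun_prop
      exact (hc.tendsto S).comp hS
    refine le_of_tendsto hlim (eventually_atTop.mpr ⟨N, fun m hm => ?_⟩)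
    have h1 := sum_enorm_inner_le ((a m).toCLM - (a n).toCLM) (stdBasis H) W
      (ContinuousLinearMap.id ℂ H) F
    refine h1.trans ?_
    calc ‖W‖ₑ * ‖ContinuousLinearMap.id ℂ H‖ₑ * traceNorm ((a m).toCLM - (a n).toCLM)
        ≤ 1 * 1 * traceNorm ((a m).toCLM - (a n).toCLM) := by
          gcongr
          · exact enorm_le_one hW
          · exact enorm_le_one ContinuousLinearMap.norm_id_le
      _ = ENNReal.ofReal ‖a m - a n‖ := by
          rw [one_mul, one_mul, ← map_sub, norm_def,
            ENNReal.ofReal_toReal (traceNorm_lt_top _).ne]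
      _ ≤ ENNReal.ofReal ε := by
          rw [← dist_eq_norm]
          exact ENNReal.ofReal_le_ofReal (hN m hm n hn).le
  obtain ⟨N, hN⟩ := key 1 one_pos
  have hSfin : traceNorm S < ⊤ := by
    have h1 := traceNorm_add_le (S - (a N).toCLM) (a N).toCLM
    rw [sub_add_cancel] at h1
    exact h1.trans_lt (ENNReal.add_lt_top.mpr
      ⟨(hN N le_rfl).trans_lt ENNReal.ofReal_lt_top, (a N).traceNorm_lt_top⟩)
  refine ⟨mk S hSfin, Metric.tendsto_atTop.mpr fun ε hε => ?_⟩
  obtain ⟨M, hM⟩ := key (ε / 2) (half_pos hε)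
  refine ⟨M, fun n hn => ?_⟩
  rw [dist_comm, dist_eq_norm, norm_def, map_sub, toCLM_mk]
  exact (ENNReal.toReal_le_of_le_ofReal (half_pos hε).le (hM n hn)).trans_lt (half_lt_self hε)

end TraceClass

open TraceClass

theorem isClosed_posCone : IsClosed (posCone H) :=
  isClosed_Ici.preimage continuous_toCLM

/-- A sequence in a bounded, closed and convex set of positive trace-class operators is dominated,
up to geometric weights, by an element of this set. -/
theorem exists_mem_ge_smul {𝒜 : Set (TraceClass H)} (hpos : 𝒜 ⊆ posCone H) (hconv : Convex ℝ 𝒜)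
    (hclosed : IsClosed 𝒜) {R : ℝ} (hR : ∀ A ∈ 𝒜, ‖A‖ ≤ R) {a : ℕ → TraceClass H}
    (ha : ∀ n, a n ∈ 𝒜) :
    ∃ A ∈ 𝒜, ∀ n, A - ((1 / 2 : ℝ) ^ (n + 1)) • a n ∈ posCone H := by
  have hpa : ∀ n, ((1 / 2 : ℝ) ^ (n + 1)) • a n ∈ posCone H := fun n => by
    change 0 ≤ toCLM _
    rw [toCLM_smul_real]
    exact smul_nonneg_clm (by positivity) (hpos (ha n))
  have hsum : Summable fun n => ((1 / 2 : ℝ) ^ (n + 1)) • a n := by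
    have hg : Summable fun n : ℕ => (1 / 2 : ℝ) ^ (n + 1) * R :=
      ((summable_nat_add_iff 1).mpr summable_geometric_two).mul_right R
    refine Summable.of_norm_bounded hg fun n => ?_
    rw [norm_smul, Real.norm_of_nonneg (by positivity)]
    gcongr
    exact hR _ (ha n)
  obtain ⟨A, hA⟩ := hsum
  -- The weights `2 ^ -(n + 1)` for `n < N` add up to `1 - 2 ^ -N`; giving the missing mass to any
  -- `B` in `𝒜` makes a convex combination.
  have hmem : ∀ N : ℕ, ∀ B ∈ 𝒜,
      ∑ n ∈ Finset.range N, ((1 / 2 : ℝ) ^ (n + 1)) • a n + ((1 / 2 : ℝ) ^ N) • B ∈ 𝒜 := by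
    intro N
    induction N with
    | zero => intro B hB; simpa using hB
    | succ N ih =>
      intro B hB
      have h := ih _ (hconv (ha N) hB (by norm_num : (0 : ℝ) ≤ 1 / 2) (by norm_num : (0 : ℝ) ≤ 1 / 2)
        (by norm_num))
      convert h using 1
      rw [Finset.sum_range_succ, add_assoc, smul_add, smul_smul, smul_smul, ← pow_succ]
  refine ⟨A, ?_, fun n => ?_⟩
  · have h1 := hA.tendsto_sum_nat
    have h2 : Tendsto (fun N : ℕ => ((1 / 2 : ℝ) ^ N) • a 0) atTop (𝓝 ((0 : ℝ) • a 0)) :=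
      (tendsto_pow_atTop_nhds_zero_of_lt_one (by norm_num) (by norm_num)).smul_const _
    have h3 := h1.add h2
    rw [zero_smul, add_zero] at h3
    exact hclosed.mem_of_tendsto h3 (Eventually.of_forall fun N => hmem N _ (ha 0))
  · refine isClosed_posCone.mem_of_tendsto (hA.sub_const _) ?_
    refine (eventually_ge_atTop {n}).mono fun F hF => ?_
    classical
    rw [← Finset.sum_erase_eq_sub (Finset.singleton_subset_iff.mp hF)]
    change 0 ≤ toCLM _
    rw [map_sum]
    exact Finset.sum_nonneg fun i _ => hpa i

/-- States are defined by the complex equation `A.tr = 1`, so the trace of a positive operator must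
be known to be real. -/
theorem tr_eq_norm {A : TraceClass H} (hA : 0 ≤ A.toCLM) : A.tr = (‖A‖ : ℂ) := by
  have h := (hasSum_pairing hA 1 (stdBasis H))
  rw [← tr_eq_pairing] at h
  have h2 : HasSum (fun i => ((‖CFC.sqrt A.toCLM (stdBasis H i)‖ ^ 2 : ℝ) : ℂ)) A.tr := by
    refine h.congr_fun fun i => ?_
    rw [one_apply_eq_self, inner_self_eq_norm_sq_to_K]
    norm_cast
  have h3 := Complex.hasSum_ofReal.mpr (Complex.hasSum_re h2)
  simp only [Complex.ofReal_re] at h3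
  rw [norm_eq_tr hA]
  exact h2.unique h3

theorem exists_state_smul {A : TraceClass H} (hA : A ∈ posCone H) (h0 : A ≠ 0) :
    ∃ ρ ∈ states H, A = ‖A‖ • ρ := by
  have hn : 0 < ‖A‖ := norm_pos_iff.mpr h0
  have hpos : 0 ≤ toCLM (‖A‖⁻¹ • A) := by
    rw [toCLM_smul_real]
    exact smul_nonneg_clm (by positivity) hA
  refine ⟨‖A‖⁻¹ • A, ⟨hpos, ?_⟩, ?_⟩
  · rw [tr_eq_norm hpos, norm_smul, norm_inv, norm_norm, inv_mul_cancel₀ hn.ne']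
    simp
  · rw [smul_smul, mul_inv_cancel₀ hn.ne', one_smul]

/-- A series of positive operators with bounded partial sums converges strongly. -/
theorem exists_hasSum_apply {ι : Type*} {D : ι → H →L[ℂ] H} (hD : ∀ i, 0 ≤ D i) {C : ℝ}
    (hC : ∀ F : Finset ι, ‖∑ i ∈ F, D i‖ ≤ C) :
    ∃ S : H →L[ℂ] H, ∀ x, HasSum (fun i => D i x) (S x) := by
  have hC0 : 0 ≤ C := (norm_nonneg _).trans (hC ∅)
  have hpos : ∀ F : Finset ι, 0 ≤ ∑ i ∈ F, D i := fun F => Finset.sum_nonneg fun i _ => hD i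
  have hre : ∀ x, Summable fun i => (⟪x, D i x⟫_ℂ).re := by
    intro x
    refine summable_of_sum_le (c := C * ‖x‖ ^ 2) (fun i => re_inner_nonneg (hD i) x) fun F => ?_
    have h1 : ∑ i ∈ F, (⟪x, D i x⟫_ℂ).re = (⟪x, (∑ i ∈ F, D i) x⟫_ℂ).re := by
      rw [sum_apply, inner_sum, Complex.re_sum]
    rw [h1]
    calc _ ≤ ‖⟪x, (∑ i ∈ F, D i) x⟫_ℂ‖ := Complex.re_le_norm _
      _ ≤ ‖x‖ * (‖∑ i ∈ F, D i‖ * ‖x‖) := (norm_inner_le_norm _ _).trans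
          (by gcongr; exact ContinuousLinearMap.le_opNorm _ _)
      _ ≤ ‖x‖ * (C * ‖x‖) := by gcongr; exact hC F
      _ = _ := by ring
  -- For `P ≥ 0`, `‖P x‖² ≤ ‖P‖ ⟨x, P x⟩`. This turns the Cauchy criterion for the numerical series
  -- into the one for vectors.
  have hsq : ∀ (F : Finset ι) x, ‖(∑ i ∈ F, D i) x‖ ^ 2 ≤ C * ∑ i ∈ F, (⟪x, D i x⟫_ℂ).re := by
    intro F x
    set P := ∑ i ∈ F, D i with hP
    set Q := CFC.sqrt P with hQ
    have hQQ : Q * Q = P := CFC.sqrt_mul_sqrt_self P (hpos F)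
    have h1 : ∑ i ∈ F, (⟪x, D i x⟫_ℂ).re = ‖Q x‖ ^ 2 := by
      have : ∑ i ∈ F, (⟪x, D i x⟫_ℂ).re = (⟪x, P x⟫_ℂ).re := by
        rw [hP, sum_apply, inner_sum, Complex.re_sum]
      rw [this, inner_eq_sqrt (hpos F), inner_self_eq_norm_sq_to_K]
      norm_cast
    have hQs : star Q = Q := IsSelfAdjoint.of_nonneg (CFC.sqrt_nonneg P)
    have h2 : ‖Q‖ ^ 2 ≤ C := by
      rw [sq, ← CStarRing.norm_star_mul_self, hQs, hQQ]
      exact hC F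
    rw [h1, ← hQQ, mul_apply_eq_comp]
    calc _ ≤ (‖Q‖ * ‖Q x‖) ^ 2 := by gcongr; exact ContinuousLinearMap.le_opNorm _ _
      _ = ‖Q‖ ^ 2 * ‖Q x‖ ^ 2 := by ring
      _ ≤ _ := by gcongr
  have hsum : ∀ x, Summable fun i => D i x := by
    intro x
    rw [summable_iff_vanishing_norm]
    intro ε hε
    obtain ⟨s, hs⟩ := summable_iff_vanishing_norm.mp (hre x) (ε ^ 2 / (C + 1)) (by positivity)
    refine ⟨s, fun t ht => ?_⟩
    have h1 := hs t ht
    have h2 := hsq t x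
    rw [sum_apply] at h2
    have h3 : C * ∑ i ∈ t, (⟪x, D i x⟫_ℂ).re < ε ^ 2 := by
      have h4 := (Real.le_norm_self _).trans_lt h1
      rw [lt_div_iff₀ (by positivity)] at h4
      have h5 : 0 ≤ ∑ i ∈ t, (⟪x, D i x⟫_ℂ).re :=
        Finset.sum_nonneg fun i _ => re_inner_nonneg (hD i) x
      nlinarith
    exact lt_of_pow_lt_pow_left₀ 2 hε.le (h2.trans_lt h3)
  let S : H →ₗ[ℂ] H :=
    { toFun := fun x => ∑' i, D i x
      map_add' := fun x y => by
        rw [← (hsum x).tsum_add (hsum y)]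
        simp only [map_add]
      map_smul' := fun c x => by
        rw [RingHom.id_apply, ← (hsum x).tsum_const_smul c]
        simp only [map_smul] }
  refine ⟨S.mkContinuous C fun x => ?_, fun x => (hsum x).hasSum⟩
  refine le_of_tendsto (hsum x).hasSum.norm (Eventually.of_forall fun F => ?_)
  rw [← sum_apply]
  exact (ContinuousLinearMap.le_opNorm _ _).trans (by gcongr; exact hC F)

theorem norm_le_of_re_inner_le {B : H →L[ℂ] H} (hB : 0 ≤ B) {C : ℝ} (hC : 0 ≤ C)
    (h : ∀ x, ‖x‖ = 1 → (⟪x, B x⟫_ℂ).re ≤ C) : ‖B‖ ≤ C := by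
  have hQQ : CFC.sqrt B * CFC.sqrt B = B := CFC.sqrt_mul_sqrt_self B hB
  have h1 : ‖CFC.sqrt B‖ ≤ √C := by
    refine ContinuousLinearMap.opNorm_le_of_unit_norm (Real.sqrt_nonneg _) fun x hx => ?_
    refine Real.le_sqrt_of_sq_le ?_
    have h2 := h x hx
    rw [inner_eq_sqrt hB, inner_self_eq_norm_sq_to_K] at h2
    exact_mod_cast h2
  rw [← hQQ]
  calc _ ≤ ‖CFC.sqrt B‖ * ‖CFC.sqrt B‖ := norm_mul_le _ _
    _ ≤ √C * √C := by gcongr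
    _ = C := Real.mul_self_sqrt hC

end Duality

/-! ### The dual map and the weights obtained from finite output entropy. -/

section OutputEntropy

set_option linter.unusedSectionVars false

open TraceClass Real

variable {H : Type u} [NormedAddCommGroup H] [InnerProductSpace ℂ H] [CompleteSpace H]
variable {K : Type v} [NormedAddCommGroup K] [InnerProductSpace ℂ K] [CompleteSpace K]

theorem isSubstate_of_norm_le_one {A : TraceClass H} (hA : A ∈ posCone H) (h : ‖A‖ ≤ 1) :
    IsSubstate A.toCLM := by
  refine ⟨hA, ?_⟩
  rw [← traceNorm_of_nonneg hA, ← ENNReal.ofReal_toReal A.traceNorm_lt_top.ne]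
  exact ENNReal.ofReal_le_one.mpr h

theorem norm_of_mem_states {ρ : TraceClass H} (hρ : ρ ∈ states H) : ‖ρ‖ = 1 := by
  rw [norm_eq_tr hρ.1, hρ.2, Complex.one_re]

namespace PosTraceNonincMap

variable (Φ : PosTraceNonincMap H K)

theorem norm_map_le {A : TraceClass H} (hA : A ∈ posCone H) : ‖Φ A‖ ≤ ‖A‖ := by
  rw [norm_eq_tr hA, norm_eq_tr (Φ.map_mem_posCone A hA)]
  exact Φ.tr_map_le A hA

theorem map_smul_real (c : ℝ) (A : TraceClass H) : Φ (c • A) = c • Φ A :=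
  LinearMap.map_smul_of_tower Φ.toLinearMap c A

theorem isSubstate_map {ρ : TraceClass H} (hρ : ρ ∈ states H) : IsSubstate (Φ ρ).toCLM :=
  isSubstate_of_norm_le_one (Φ.map_mem_posCone ρ hρ.1)
    ((Φ.norm_map_le hρ.1).trans_eq (norm_of_mem_states hρ))

/-- The defining relation of `dual` is given on states only; scaling extends it to the cone. -/
theorem pairing_dual (B : K →L[ℂ] K) {A : TraceClass H} (hA : A ∈ posCone H) :
    pairing (Φ.dual B) A = pairing B (Φ A) := by
  rcases eq_or_ne A 0 with rfl | h0
  · simp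
  obtain ⟨ρ, hρ, hAρ⟩ := exists_state_smul hA h0
  rw [hAρ, map_smul_real, LinearMap.map_smul_of_tower, LinearMap.map_smul_of_tower]
  congr 1
  exact (Φ.dual_spec B ρ hρ).symm

/-- `dual` is chosen for each operator separately, so its linearity has to come from uniqueness. -/
theorem dual_add (B B' : K →L[ℂ] K) : Φ.dual (B + B') = Φ.dual B + Φ.dual B' := by
  refine (Φ.dual_unique _ fun ρ hρ => ?_).symm
  rw [← pairing_apply, ← pairing_apply, pairing_add_right, pairing_add_right,
    Φ.pairing_dual B hρ.1, Φ.pairing_dual B' hρ.1]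

theorem dual_smul (c : ℝ) (B : K →L[ℂ] K) : Φ.dual (c • B) = c • Φ.dual B := by
  refine (Φ.dual_unique _ fun ρ hρ => ?_).symm
  rw [← pairing_apply, ← pairing_apply, pairing_smul_right, pairing_smul_right,
    Φ.pairing_dual B hρ.1]

theorem dual_sum {ι : Type*} (F : Finset ι) (B : ι → K →L[ℂ] K) :
    Φ.dual (∑ i ∈ F, B i) = ∑ i ∈ F, Φ.dual (B i) :=
  map_sum (AddMonoidHom.mk' Φ.dual Φ.dual_add) B F

theorem inner_dual_rankOne (y : K) (x : H) :
    ⟪x, Φ.dual (InnerProductSpace.rankOne ℂ y y) x⟫_ℂ = ⟪y, (Φ (rankOne x x)).toCLM y⟫_ℂ := by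
  rw [← pairing_rankOne, Φ.pairing_dual _ (toCLM_rankOne_self_nonneg x), pairing_apply,
    trace_mul_rankOne]

theorem pairing_dual_rankOne (y : K) {A : TraceClass H} (hA : A ∈ posCone H) :
    pairing (Φ.dual (InnerProductSpace.rankOne ℂ y y)) A = ⟪y, (Φ A).toCLM y⟫_ℂ := by
  rw [Φ.pairing_dual _ hA, pairing_apply, trace_mul_rankOne]

theorem dual_rankOne_nonneg (y : K) : 0 ≤ Φ.dual (InnerProductSpace.rankOne ℂ y y) := by
  rw [ContinuousLinearMap.nonneg_iff_isPositive, ContinuousLinearMap.isPositive_iff_complex]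
  intro x
  have h1 := (ContinuousLinearMap.nonneg_iff_isPositive _).mp
    (Φ.map_mem_posCone _ (toCLM_rankOne_self_nonneg x))
  have h2 := (ContinuousLinearMap.isPositive_iff_complex _).mp h1 y
  have h3 : ⟪Φ.dual (InnerProductSpace.rankOne ℂ y y) x, x⟫_ℂ =
      ⟪(Φ (rankOne x x)).toCLM y, y⟫_ℂ := by
    rw [← inner_conj_symm, Φ.inner_dual_rankOne, inner_conj_symm]
  rw [h3]
  exact h2

/-- Finiteness of the output entropy on a bounded, closed and convex set implies boundedness. -/
theorem exists_etaTrace_bound {𝒜 : Set (TraceClass H)} (hpos : 𝒜 ⊆ posCone H)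
    (hconv : Convex ℝ 𝒜) (hclosed : IsClosed 𝒜) {c R : ℝ} (hc : 0 < c) (hcR : c * R ≤ 1)
    (hR : ∀ A ∈ 𝒜, ‖A‖ ≤ R) (hfin : ∀ A ∈ 𝒜, etaTrace (Φ A).toCLM ≠ ⊤) :
    ∃ C : ℝ≥0∞, C ≠ ⊤ ∧ ∀ A ∈ 𝒜, etaTrace (c • (Φ A).toCLM) ≤ C := by
  by_contra! hcon
  have hsub : ∀ A ∈ posCone H, ‖A‖ ≤ R → IsSubstate (c • (Φ A).toCLM) := by
    intro A hA hAR
    rw [← toCLM_smul_real]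
    refine isSubstate_of_norm_le_one ?_ ?_
    · change 0 ≤ toCLM _
      rw [toCLM_smul_real]
      exact smul_nonneg_clm hc.le (Φ.map_mem_posCone A hA)
    · rw [norm_smul, Real.norm_of_nonneg hc.le]
      calc c * ‖Φ A‖ ≤ c * R := by gcongr; exact (Φ.norm_map_le hA).trans hAR
        _ ≤ 1 := hcR
  -- The growth `4 ^ n` must beat the factor `2 ^ (n + 1)` lost when `a n` enters the mixture with
  -- weight `2 ^ -(n + 1)`.
  choose a ha hbig using fun n : ℕ => hcon ((4 : ℝ≥0∞) ^ n) (by simp)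
  obtain ⟨A, hA, hge⟩ := exists_mem_ge_smul hpos hconv hclosed hR ha
  have hZ := hsub A (hpos hA) (hR A hA)
  set M := etaTrace (c • (Φ A).toCLM) + 1 with hM
  have hMfin : M ≠ ⊤ := by
    refine ENNReal.add_ne_top.mpr ⟨ne_top_of_le_ne_top ?_ (etaTrace_smul_le
      (Φ.map_mem_posCone A (hpos hA)) hc.le), ENNReal.one_ne_top⟩
    exact ENNReal.add_ne_top.mpr ⟨ENNReal.mul_ne_top ENNReal.ofReal_ne_top (hfin A hA),
      ENNReal.mul_ne_top ENNReal.ofReal_ne_top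
        (posTrace_toCLM_ne_top (Φ.map_mem_posCone A (hpos hA)))⟩
  have hbound : ∀ n : ℕ, (4 : ℝ≥0∞) ^ n ≤ 2 ^ (n + 1) * M := by
    intro n
    set X := ((1 / 2 : ℝ) ^ (n + 1)) • (c • (Φ (a n)).toCLM) with hX
    have hXpos : 0 ≤ X := smul_nonneg_clm (by positivity) (hsub _ (hpos (ha n)) (hR _ (ha n))).1
    have hXZ : X ≤ c • (Φ A).toCLM := by
      have h1 := Φ.map_mem_posCone _ (hge n)
      have h2 : (Φ (A - ((1 / 2 : ℝ) ^ (n + 1)) • a n)).toCLM =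
          (Φ A).toCLM - ((1 / 2 : ℝ) ^ (n + 1)) • (Φ (a n)).toCLM := by
        rw [map_sub, map_smul_real, map_sub, toCLM_smul_real]
      change 0 ≤ toCLM _ at h1
      rw [h2] at h1
      have h3 := smul_nonneg_clm hc.le h1
      rw [smul_sub, sub_nonneg] at h3
      rwa [hX, smul_comm]
    have hXsub : IsSubstate X := ⟨hXpos, (posTrace_mono hXZ).trans hZ.2⟩
    have h1 : etaTrace X ≤ M := (hXsub.etaTrace_mono hZ hXZ).trans (by rw [hM]; gcongr; exact hZ.2)
    have h2 : c • (Φ (a n)).toCLM = ((2 : ℝ) ^ (n + 1)) • X := by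
      rw [hX, smul_smul, ← mul_pow]
      norm_num
    -- `η` is non-positive above one, so scaling back up by `2 ^ (n + 1)` produces no trace term.
    have h3 : etaPos ((2 : ℝ) ^ (n + 1)) = 0 := by
      refine max_eq_right ?_
      have : 0 ≤ log ((2 : ℝ) ^ (n + 1)) := log_nonneg (one_le_pow₀ (by norm_num))
      rw [negMulLog, neg_mul]
      exact neg_nonpos.mpr (by positivity)
    have h4 := etaTrace_smul_le hXpos (μ := (2 : ℝ) ^ (n + 1)) (by positivity)
    rw [← h2, h3, ENNReal.ofReal_zero, zero_mul, add_zero, ENNReal.ofReal_pow (by norm_num),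
      ENNReal.ofReal_ofNat] at h4
    exact (hbig n).le.trans (h4.trans (by gcongr))
  have h2 : ∀ n : ℕ, (2 : ℝ) ^ n ≤ 2 * M.toReal := by
    intro n
    have h3 := ENNReal.toReal_mono (ENNReal.mul_ne_top (by simp) hMfin) (hbound n)
    rw [ENNReal.toReal_mul, ENNReal.toReal_pow, ENNReal.toReal_pow] at h3
    simp only [ENNReal.toReal_ofNat] at h3
    rw [show (4 : ℝ) = 2 * 2 by norm_num, mul_pow, pow_succ, mul_assoc] at h3
    exact le_of_mul_le_mul_left h3 (by positivity)
  obtain ⟨n, hn⟩ := pow_unbounded_of_one_lt (2 * M.toReal) (by norm_num : (1 : ℝ) < 2)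
  exact absurd (h2 n) (not_le.mpr hn)

/-- The central implication. The outputs are rescaled by `R⁻¹` to have trace at most one; the
weights found for them are then transported by duality, and `hdet` turns a bound on expectations
into a bound on norms. -/
theorem hasSummableDualWeights_of_finiteOn [TopologicalSpace.SeparableSpace K]
    {𝒜 : Set (TraceClass H)} (hpos : 𝒜 ⊆ posCone H) (hconv : Convex ℝ 𝒜) (hclosed : IsClosed 𝒜)
    (hbdd : Bornology.IsBounded 𝒜) (hdet : Φ.DetectsBoundedness 𝒜)
    (hfin : FiniteOn Φ.outputEntropy 𝒜) : Φ.HasSummableDualWeights := by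
  obtain ⟨R, hR0, hR⟩ : ∃ R : ℝ, 0 < R ∧ ∀ A ∈ 𝒜, ‖A‖ ≤ R := by
    obtain ⟨R, hR⟩ := hbdd.exists_norm_le
    exact ⟨max R 1, by positivity, fun A hA => (hR A hA).trans (le_max_left _ _)⟩
  have hc : 0 < R⁻¹ := inv_pos.mpr hR0
  have hcR : R⁻¹ * R ≤ 1 := (inv_mul_cancel₀ hR0.ne').le
  obtain ⟨C₀, hC₀, hbound⟩ := Φ.exists_etaTrace_bound hpos hconv hclosed hc hcR hR
    fun A hA => (entropy_finite_iff (Φ.map_mem_posCone A (hpos hA))).mp (hfin A hA)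
  set 𝒞 : Set (K →L[ℂ] K) := (fun A => R⁻¹ • (Φ A).toCLM) '' 𝒜 with h𝒞
  have hsub : ∀ T ∈ 𝒞, IsSubstate T := by
    rintro _ ⟨A, hA, rfl⟩
    change IsSubstate (R⁻¹ • (Φ A).toCLM)
    rw [← toCLM_smul_real]
    refine isSubstate_of_norm_le_one ?_ ?_
    · change 0 ≤ toCLM _
      rw [toCLM_smul_real]
      exact smul_nonneg_clm hc.le (Φ.map_mem_posCone A (hpos hA))
    · rw [norm_smul, Real.norm_of_nonneg hc.le]
      calc R⁻¹ * ‖Φ A‖ ≤ R⁻¹ * R := by gcongr; exact (Φ.norm_map_le (hpos hA)).trans (hR A hA)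
        _ ≤ 1 := hcR
  have hconv' : Convex ℝ 𝒞 := by
    rintro _ ⟨A, hA, rfl⟩ _ ⟨B, hB, rfl⟩ s t hs ht hst
    refine ⟨s • A + t • B, hconv hA hB hs ht hst, ?_⟩
    simp only
    rw [map_add, map_smul_real, map_smul_real, map_add, toCLM_smul_real, toCLM_smul_real, smul_add,
      smul_comm s, smul_comm t]
  obtain ⟨ι, b, h, hh, hexp, C, hCfin, hC⟩ := exists_weights hsub hconv' hC₀
    (by rintro _ ⟨A, hA, rfl⟩; exact hbound A hA)
  have := countable_of_hilbertBasis b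
  have := Encodable.ofCountable ι
  set D : ι → H →L[ℂ] H := fun i => Φ.dual (InnerProductSpace.rankOne ℂ (b i) (b i)) with hD
  have hDnn : ∀ i, 0 ≤ h i • D i := fun i => smul_nonneg_clm (hh i) (Φ.dual_rankOne_nonneg _)
  -- `DetectsBoundedness` speaks of sequences, so the net of finite index sets is replaced by an
  -- increasing exhausting sequence. It becomes constant if `ι` is finite.
  set F : ℕ → Finset ι := fun n =>
    (Finset.range n).preimage Encodable.encode Encodable.encode_injective.injOn with hF
  have hFmono : Monotone F := fun m n hmn => Finset.monotone_preimage Encodable.encode_injective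
    (Finset.range_mono hmn)
  have hFmem : ∀ i : ι, ∃ n, i ∈ F n := fun i => ⟨Encodable.encode i + 1, by simp [hF]⟩
  have hFtop : Tendsto F atTop atTop := tendsto_atTop_finset_of_monotone hFmono hFmem
  have hpair : ∀ A ∈ 𝒜, ∀ G : Finset ι, (pairing (∑ i ∈ G, h i • D i) A).re =
      ∑ i ∈ G, h i * (⟪b i, (Φ A).toCLM (b i)⟫_ℂ).re := by
    intro A hA G
    have h1 : pairing (∑ i ∈ G, h i • D i) A = ∑ i ∈ G, pairing (h i • D i) A :=
      map_sum (AddMonoidHom.mk' (fun B : H →L[ℂ] H => pairing B A) (pairing_add_right A)) _ G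
    rw [h1, Complex.re_sum]
    refine Finset.sum_congr rfl fun i _ => ?_
    rw [pairing_smul_right, Φ.pairing_dual_rankOne _ (hpos hA), Complex.re_ofReal_mul]
  obtain ⟨C', hC'⟩ := hdet (fun n => ∑ i ∈ F n, h i • D i)
    (fun n => Finset.sum_nonneg fun i _ => hDnn i)
    (fun m n hmn => Finset.sum_le_sum_of_subset_of_nonneg (hFmono hmn) fun i _ _ => hDnn i)
    (fun n => ⟨∑ i ∈ F n, h i • InnerProductSpace.rankOne ℂ (b i) (b i), by
      rw [Φ.dual_sum]; simp only [Φ.dual_smul]; rfl⟩)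
    ⟨R * C.toReal, fun A hA => by
      have hnn : ∀ i, 0 ≤ h i * (⟪b i, (Φ A).toCLM (b i)⟫_ℂ).re := fun i =>
        mul_nonneg (hh i) (re_inner_nonneg (Φ.map_mem_posCone A (hpos hA)) _)
      have hle : ∀ G : Finset ι, ∑ i ∈ G, h i * (⟪b i, (Φ A).toCLM (b i)⟫_ℂ).re ≤
          R * C.toReal := by
        intro G
        have h1 := (ENNReal.sum_le_tsum G).trans (hC _ ⟨A, hA, rfl⟩)
        have h2 : ∀ i, h i * (⟪b i, (R⁻¹ • (Φ A).toCLM) (b i)⟫_ℂ).re =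
            R⁻¹ * (h i * (⟪b i, (Φ A).toCLM (b i)⟫_ℂ).re) := by
          intro i
          rw [smul_apply, inner_smul_right_eq_smul, Complex.smul_re, smul_eq_mul]
          ring
        simp only [h2] at h1
        rw [← ENNReal.ofReal_sum_of_nonneg fun i _ => mul_nonneg hc.le (hnn i),
          ← Finset.mul_sum, ENNReal.ofReal_le_iff_le_toReal hCfin] at h1
        rwa [inv_mul_le_iff₀ hR0] at h1
      have hsum := (summable_of_sum_le hnn hle).hasSum
      refine ⟨_, hsum.tsum_eq ▸ hasSum_le_of_sum_le hsum hle, ?_⟩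
      refine (hsum.comp hFtop).congr fun n => ?_
      exact (hpair A hA (F n)).symm⟩
  -- Every finite set lies in some `F n`, and the norm is monotone on positive operators.
  have hCF : ∀ G : Finset ι, ‖∑ i ∈ G, h i • D i‖ ≤ C' := by
    intro G
    obtain ⟨n, hn⟩ := (hFtop.eventually_ge_atTop G).exists
    refine le_trans ?_ (hC' n)
    exact CStarAlgebra.norm_le_norm_of_nonneg_of_le (Finset.sum_nonneg fun i _ => hDnn i)
      (Finset.sum_le_sum_of_subset_of_nonneg hn fun i _ _ => hDnn i)
  obtain ⟨S, hS⟩ := exists_hasSum_apply hDnn hCF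
  exact ⟨ι, b, h, hh, ⟨S, hS⟩, hexp⟩

/-- Pure states suffice: on them `Tr A B n` is `⟨x, B n x⟩`, which increases to its limit, and these
numbers control the norm of a positive operator. -/
theorem detectsBoundedness_states : Φ.DetectsBoundedness (states H) := by
  intro B hB hmono _ ⟨C, hC⟩
  refine ⟨max C 0, fun n => norm_le_of_re_inner_le (hB n) (le_max_right _ _) fun x hx => ?_⟩
  have hρ : rankOne x x ∈ states H := by
    refine ⟨toCLM_rankOne_self_nonneg x, ?_⟩
    rw [tr_eq_norm (toCLM_rankOne_self_nonneg x), norm_eq_tr (toCLM_rankOne_self_nonneg x),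
      tr_rankOne_self, hx]
    simp
  obtain ⟨l, hl, hlim⟩ := hC _ hρ
  have h1 : ∀ m, (trace ((rankOne x x).toCLM * B m)).re = (⟪x, B m x⟫_ℂ).re := fun m => by
    rw [← pairing_apply, pairing_rankOne]
  replace hlim := hlim.congr h1
  have hm : Monotone fun m => (⟪x, B m x⟫_ℂ).re := fun m k hmk => re_inner_mono (hmono hmk) x
  exact (hm.ge_of_tendsto hlim n).trans (hl.trans (le_max_left _ _))

end PosTraceNonincMap

theorem convex_states : Convex ℝ (states H) := by
  intro ρ hρ σ hσ s t hs ht hst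
  have hpos : 0 ≤ toCLM (s • ρ + t • σ) := by
    rw [map_add, toCLM_smul_real, toCLM_smul_real]
    exact add_nonneg (smul_nonneg_clm hs hρ.1) (smul_nonneg_clm ht hσ.1)
  refine ⟨hpos, ?_⟩
  rw [tr_eq_pairing, map_add, LinearMap.map_smul_of_tower, LinearMap.map_smul_of_tower,
    ← tr_eq_pairing, ← tr_eq_pairing, hρ.2, hσ.2, ← add_smul, hst, one_smul]

theorem isClosed_states : IsClosed (states H) := by
  have htr : Continuous fun A : TraceClass H => A.tr :=
    (continuous_pairing 1).congr fun A => (tr_eq_pairing A).symm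
  exact isClosed_posCone.inter (isClosed_eq htr continuous_const)

theorem isBounded_states : Bornology.IsBounded (states H) :=
  (Metric.isBounded_closedBall (x := (0 : TraceClass H)) (r := 1)).subset fun ρ hρ => by
    rw [mem_closedBall_zero_iff, norm_of_mem_states hρ]

end OutputEntropy

/-! ### Entropy of finite-dimensional compressions. -/

section Compression

set_option linter.unusedSectionVars false

open Real

/-- `η` is not monotone, but Klein's inequality with `q = t` repairs this at the cost of `t`; it
serves as a domination bound. -/
theorem negMulLog_le_add_of_le {y t : ℝ} (hy : 0 ≤ y) (hyt : y ≤ t) (ht : t ≤ 1) :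
    negMulLog y ≤ negMulLog t + t := by
  rcases (hy.trans hyt).eq_or_lt with rfl | h0
  · rw [le_antisymm hyt hy]; simp
  have h1 := negMulLog_add_sq_le hy (hyt.trans ht) h0 ht
  have h2 : y * -log t ≤ t * -log t :=
    mul_le_mul_of_nonneg_right hyt (by linarith [log_nonpos h0.le ht])
  have h3 : negMulLog t = t * -log t := by rw [negMulLog]; ring
  nlinarith [sq_nonneg (y - t)]

/-- Jensen's inequality by the tangent line of `η` at `y`. Total weight below one is allowed because
that line is non-negative at zero. -/
theorem sum_mul_negMulLog_le {ι : Type*} {F : Finset ι} {d s : ι → ℝ} {y : ℝ}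
    (hd : ∀ i ∈ F, 0 ≤ d i) (hd1 : ∑ i ∈ F, d i ≤ 1) (hs : ∀ i ∈ F, 0 ≤ s i) (hs1 : ∀ i ∈ F, s i ≤ 1)
    (hy1 : y ≤ 1) (hy : ∑ i ∈ F, d i * s i = y) : ∑ i ∈ F, d i * negMulLog (s i) ≤ negMulLog y := by
  have hy0 : 0 ≤ y := hy ▸ Finset.sum_nonneg fun i hi => mul_nonneg (hd i hi) (hs i hi)
  rcases hy0.eq_or_lt with rfl | hy0
  · rw [Finset.sum_eq_zero_iff_of_nonneg fun i hi => mul_nonneg (hd i hi) (hs i hi)] at hy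
    rw [Finset.sum_eq_zero fun i hi => ?_, negMulLog_zero]
    rcases mul_eq_zero.mp (hy i hi) with h | h
    · rw [h, zero_mul]
    · rw [h, negMulLog_zero, mul_zero]
  · have h1 : ∀ i ∈ F, d i * negMulLog (s i) ≤ (-log y - 1) * (d i * s i) + y * d i := by
      intro i hi
      have h2 := negMulLog_add_sq_le (hs i hi) (hs1 i hi) hy0 hy1
      nlinarith [mul_le_mul_of_nonneg_left h2 (hd i hi),
        mul_nonneg (hd i hi) (sq_nonneg (s i - y))]
    refine (Finset.sum_le_sum h1).trans ?_
    rw [Finset.sum_add_distrib, ← Finset.mul_sum, ← Finset.mul_sum, hy, negMulLog]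
    nlinarith

variable {H : Type u} [NormedAddCommGroup H] [InnerProductSpace ℂ H] [CompleteSpace H]

theorem hasSum_norm_inner_sq {ι : Type*} (b : HilbertBasis ι ℂ H) (x : H) :
    HasSum (fun i => ‖⟪b i, x⟫_ℂ‖ ^ 2) (‖x‖ ^ 2) := by
  have h := tsum_enorm_inner_sq b x
  have hfin : ∑' i, ‖⟪b i, x⟫_ℂ‖ₑ ^ 2 ≠ ⊤ := by
    rw [h]; exact ENNReal.pow_ne_top enorm_ne_top
  have h2 := ENNReal.hasSum_toReal hfin
  rw [← ENNReal.tsum_toReal_eq (ENNReal.ne_top_of_tsum_ne_top hfin), h] at h2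
  simpa only [ENNReal.toReal_pow, toReal_enorm] using h2

theorem eq_zero_of_inner_hilbertBasis {ι : Type*} (b : HilbertBasis ι ℂ H) {x : H}
    (h : ∀ i, ⟪b i, x⟫_ℂ = 0) : x = 0 := by
  have h1 := hasSum_norm_inner_sq b x
  simp only [h, norm_zero, ne_eq, OfNat.ofNat_ne_zero, not_false_eq_true, zero_pow] at h1
  have := h1.unique hasSum_zero
  exact norm_eq_zero.mp (pow_eq_zero_iff two_ne_zero |>.mp this)

/-- Finitely many vectors of a Hilbert basis can be rotated so that the matrix of a given positive
operator with respect to the new vectors is diagonal. -/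
theorem exists_hilbertBasis_diagonal {T : H →L[ℂ] H} (hT : 0 ≤ T) {ι : Type*}
    (b : HilbertBasis ι ℂ H) (F : Finset ι) :
    ∃ c : HilbertBasis ι ℂ H, (∀ i ∉ F, c i = b i) ∧
      ∀ i ∈ F, ∀ j ∈ F, i ≠ j → ⟪c i, T (c j)⟫_ℂ = 0 := by
  classical
  have hbF : Orthonormal ℂ fun i : F => b i := b.orthonormal.comp _ Subtype.val_injective
  set V : Submodule ℂ H := Submodule.span ℂ (Set.range fun i : F => b i) with hV
  have : FiniteDimensional ℂ V := FiniteDimensional.span_of_finite ℂ (Set.finite_range _)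
  have hn : Module.finrank ℂ V = F.card := by
    rw [hV, finrank_span_eq_card hbF.linearIndependent, Fintype.card_coe]
  -- The new vectors are the eigenvectors of the compression of `T` to the span of the old ones.
  set S : V →ₗ[ℂ] V := (V.orthogonalProjectionOnto ∘L T ∘L V.subtypeL).toLinearMap with hS
  have hSin : ∀ v w : V, ⟪v, S w⟫_ℂ = ⟪(v : H), T w⟫_ℂ := fun v w =>
    Submodule.inner_orthogonalProjectionOnto_eq_of_mem_left v (T w)
  have hTsym := ((ContinuousLinearMap.nonneg_iff_isPositive T).mp hT).isSymmetric
  have hSsym : S.IsSymmetric := by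
    intro v w
    rw [hSin, ← inner_conj_symm, hSin, inner_conj_symm]
    exact hTsym v w
  set u := hSsym.eigenvectorBasis hn with hu
  have huS : ∀ i j, i ≠ j → ⟪(u i : H), T (u j)⟫_ℂ = 0 := by
    intro i j hij
    rw [← hSin, hu, hSsym.apply_eigenvectorBasis, inner_smul_right, ← hu, u.orthonormal.2 hij,
      mul_zero]
  have hVb : ∀ v : V, ∀ j ∉ F, ⟪(v : H), b j⟫_ℂ = 0 := by
    intro v j hj
    have hle : V ≤ (Submodule.span ℂ {b j})ᗮ := by
      rw [hV, Submodule.span_le]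
      rintro _ ⟨i, rfl⟩
      rw [SetLike.mem_coe, Submodule.mem_orthogonal_singleton_iff_inner_left]
      exact b.orthonormal.2 fun h => hj (h ▸ i.2)
    exact Submodule.mem_orthogonal_singleton_iff_inner_left.mp (hle v.2)
  set c : ι → H := fun i => if h : i ∈ F then (u (F.equivFin ⟨i, h⟩) : H) else b i with hc
  have hcF : ∀ i (h : i ∈ F), c i = u (F.equivFin ⟨i, h⟩) := fun i h => by simp [hc, h]
  have hcn : ∀ i ∉ F, c i = b i := fun i h => by simp [hc, h]
  have hne : ∀ i j (hi : i ∈ F) (hj : j ∈ F), i ≠ j → F.equivFin ⟨i, hi⟩ ≠ F.equivFin ⟨j, hj⟩ :=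
    fun i j hi hj hij h => hij (congrArg Subtype.val (F.equivFin.injective h))
  have hon : Orthonormal ℂ c := by
    constructor
    · intro i
      by_cases hi : i ∈ F
      · rw [hcF i hi]; exact u.orthonormal.1 _
      · rw [hcn i hi]; exact b.orthonormal.1 i
    · intro i j hij
      by_cases hi : i ∈ F <;> by_cases hj : j ∈ F
      · rw [hcF i hi, hcF j hj]
        exact u.orthonormal.2 (hne i j hi hj hij)
      · rw [hcF i hi, hcn j hj]
        exact hVb _ j hj
      · rw [hcn i hi, hcF j hj, ← inner_conj_symm, hVb _ i hi, map_zero]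
      · rw [hcn i hi, hcn j hj]
        exact b.orthonormal.2 hij
  have hsp : (Submodule.span ℂ (Set.range c))ᗮ = ⊥ := by
    rw [eq_bot_iff]
    intro x hx
    have hx' : ∀ i, ⟪c i, x⟫_ℂ = 0 := fun i =>
      (Submodule.mem_orthogonal _ _).mp hx _ (Submodule.subset_span ⟨i, rfl⟩)
    have hux : ∀ j, ⟪(u j : H), x⟫_ℂ = 0 := by
      intro j
      have h1 := hx' (F.equivFin.symm j)
      rwa [hcF _ (F.equivFin.symm j).2, Subtype.coe_eta, Equiv.apply_symm_apply] at h1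
    have hVx : ∀ v : V, ⟪(v : H), x⟫_ℂ = 0 := by
      intro v
      rw [← u.sum_repr' v, Submodule.coe_sum, sum_inner]
      refine Finset.sum_eq_zero fun j _ => ?_
      rw [Submodule.coe_smul, inner_smul_left, hux, mul_zero]
    refine eq_zero_of_inner_hilbertBasis b fun i => ?_
    by_cases hi : i ∈ F
    · exact hVx ⟨b i, Submodule.subset_span ⟨⟨i, hi⟩, rfl⟩⟩
    · rw [← hcn i hi]; exact hx' i
  refine ⟨HilbertBasis.mkOfOrthogonalEqBot hon hsp, fun i hi => ?_, fun i hi j hj hij => ?_⟩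
  · rw [HilbertBasis.coe_mkOfOrthogonalEqBot, hcn i hi]
  · rw [HilbertBasis.coe_mkOfOrthogonalEqBot, hcF i hi, hcF j hj]
    exact huS _ _ (hne i j hi hj hij)

/-- The entropy of the compression of `T` to the span of finitely many basis vectors is controlled
by the eigenvalues of `T` and the lengths of the projections of its eigenvectors. -/
theorem IsSubstate.exists_hilbertBasis_sum_le {T : H →L[ℂ] H} (hT : IsSubstate T) {ι κ : Type*}
    (b : HilbertBasis ι ℂ H) {e : HilbertBasis κ ℂ H} {t : κ → ℝ}
    (he : ∀ k, T (e k) = (t k : ℂ) • e k) (F : Finset ι) :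
    ∃ c : HilbertBasis ι ℂ H, (∀ i ∉ F, c i = b i) ∧
      ∑ i ∈ F, ENNReal.ofReal (negMulLog (⟪c i, T (c i)⟫_ℂ).re) ≤
        ∑' k, ENNReal.ofReal (negMulLog (t k * ∑ i ∈ F, ‖⟪b i, e k⟫_ℂ‖ ^ 2)) := by
  classical
  obtain ⟨c, hcb, hdiag⟩ := exists_hilbertBasis_diagonal hT.1 b F
  refine ⟨c, hcb, ?_⟩
  have hten := fun k => hT.eigenvalue_mem (e.orthonormal.1 k) (he k)
  -- The bases agree outside `F`, so by Parseval the projections onto the two spans have the same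
  -- length.
  have hparseval : ∀ x, ∑ i ∈ F, ‖⟪b i, x⟫_ℂ‖ ^ 2 = ∑ i ∈ F, ‖⟪c i, x⟫_ℂ‖ ^ 2 := by
    intro x
    have h1 := hasSum_norm_inner_sq b x
    have h2 := hasSum_norm_inner_sq c x
    have h3 := h1.summable.sum_add_tsum_subtype_compl F
    have h4 := h2.summable.sum_add_tsum_subtype_compl F
    rw [h1.tsum_eq] at h3
    rw [h2.tsum_eq] at h4
    have h5 : ∑' i : {i // i ∉ F}, ‖⟪b i, x⟫_ℂ‖ ^ 2 = ∑' i : {i // i ∉ F}, ‖⟪c i, x⟫_ℂ‖ ^ 2 :=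
      tsum_congr fun i => by rw [hcb i i.2]
    linarith
  set Q := CFC.sqrt T with hQ
  have hQs : Q.adjoint = Q := IsSelfAdjoint.of_nonneg (CFC.sqrt_nonneg T)
  set s : ι → ℝ := fun i => (⟪c i, T (c i)⟫_ℂ).re with hs
  have hs0 : ∀ i, 0 ≤ s i := fun i => re_inner_nonneg hT.1 _
  have hs1 : ∀ i, s i ≤ 1 := fun i => hT.re_inner_le_one (c.orthonormal.1 i)
  have hQn : ∀ i, ‖Q (c i)‖ ^ 2 = s i := by
    intro i
    rw [hs]
    simp only
    rw [inner_eq_sqrt hT.1, inner_self_eq_norm_sq_to_K]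
    norm_cast
  have hQe : ∀ i k, ‖⟪Q (c i), e k⟫_ℂ‖ ^ 2 = t k * ‖⟪c i, e k⟫_ℂ‖ ^ 2 := by
    intro i k
    rw [← hQs, ContinuousLinearMap.adjoint_inner_left, sqrt_apply_of_eigenvector hT.1 (he k),
      inner_smul_right, norm_mul, mul_pow, Complex.norm_real, Real.norm_of_nonneg (Real.sqrt_nonneg _),
      Real.sq_sqrt (hten k).1]
  -- With `P` the projection onto the span, `P T P` and `√T P √T` have the same non-zero eigenvalues
  -- `s i`, and the latter has eigenvectors `√T c i / √(s i)`. `d k i` is the squared overlap of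
  -- such a vector with `e k`: it sums to one over `k`, to at most one over `i` by Bessel, and
  -- Jensen compares the `s i` with the diagonal `t k ‖P e k‖²`. For `s i = 0` the quotient is zero.
  set d : κ → ι → ℝ := fun k i => t k * ‖⟪c i, e k⟫_ℂ‖ ^ 2 / s i with hd
  have hd0 : ∀ k i, 0 ≤ d k i := fun k i =>
    div_nonneg (mul_nonneg (hten k).1 (by positivity)) (hs0 i)
  have hds : ∀ k i, d k i * s i = t k * ‖⟪c i, e k⟫_ℂ‖ ^ 2 := by
    intro k i
    rcases (hs0 i).eq_or_lt with h0 | h0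
    · have h1 : Q (c i) = 0 := by
        rw [← norm_eq_zero]
        exact pow_eq_zero_iff two_ne_zero |>.mp ((hQn i).trans h0.symm)
      rw [← h0, mul_zero, ← hQe, h1, inner_zero_left, norm_zero]
      norm_num
    · rw [hd]
      exact div_mul_cancel₀ _ h0.ne'
  have hdsum : ∀ k, ∑ i ∈ F, d k i ≤ 1 := by
    intro k
    set w : {i // i ∈ F ∧ s i ≠ 0} → H := fun i => ((√(s i))⁻¹ : ℂ) • Q (c i) with hw
    have hwon : Orthonormal ℂ w := by
      constructor
      · intro i
        have h0 : 0 < s i := (hs0 i).lt_of_ne i.2.2.symm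
        have h1 : ‖Q (c i)‖ = √(s i) := by
          rw [← hQn, Real.sqrt_sq (norm_nonneg _)]
        rw [hw]
        simp only
        rw [norm_smul, norm_inv, Complex.norm_real, Real.norm_of_nonneg (Real.sqrt_nonneg _), h1,
          inv_mul_cancel₀ (Real.sqrt_pos.mpr h0).ne']
      · intro i j hij
        rw [hw]
        simp only
        rw [inner_smul_left, inner_smul_right, hQ, ← inner_eq_sqrt hT.1,
          hdiag i i.2.1 j j.2.1 fun h => hij (Subtype.ext h), mul_zero, mul_zero]
    have hbessel := hwon.sum_inner_products_le (e k)
      (s := Finset.subtype (fun i => i ∈ F ∧ s i ≠ 0) F)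
    rw [e.orthonormal.1 k, one_pow] at hbessel
    refine le_trans (le_of_eq ?_) hbessel
    have h1 : ∀ i : {i // i ∈ F ∧ s i ≠ 0}, ‖⟪w i, e k⟫_ℂ‖ ^ 2 = d k i := by
      intro i
      rw [hw]
      simp only
      rw [inner_smul_left, norm_mul, mul_pow, hQe, RCLike.norm_conj, norm_inv, Complex.norm_real,
        Real.norm_of_nonneg (Real.sqrt_nonneg _), inv_pow, Real.sq_sqrt (hs0 i), hd]
      exact inv_mul_eq_div _ _
    simp_rw [h1]
    rw [Finset.sum_subtype_eq_sum_filter (s := F) (p := fun i => i ∈ F ∧ s i ≠ 0) (fun i => d k i)]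
    refine (Finset.sum_filter_of_ne fun i hi hne => ⟨hi, fun h0 => hne ?_⟩).symm
    rw [hd]
    simp only
    rw [h0, div_zero]
  have hcol : ∀ i, s i ≠ 0 → ∑' k, ENNReal.ofReal (d k i) = 1 := by
    intro i hi
    have h1 := hasSum_norm_inner_sq e (Q (c i))
    have h2 : ∀ k, ‖⟪e k, Q (c i)⟫_ℂ‖ ^ 2 = t k * ‖⟪c i, e k⟫_ℂ‖ ^ 2 := fun k => by
      rw [norm_inner_symm, hQe]
    simp only [h2, hQn] at h1
    have h3 := h1.div_const (s i)
    rw [div_self hi] at h3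
    rw [← ENNReal.ofReal_tsum_of_nonneg (fun k => hd0 k i) h3.summable, h3.tsum_eq,
      ENNReal.ofReal_one]
  have hη0 : ∀ i, 0 ≤ negMulLog (s i) := fun i => negMulLog_nonneg (hs0 i) (hs1 i)
  have hexpand : ∀ i, ENNReal.ofReal (negMulLog (s i)) =
      ∑' k, ENNReal.ofReal (d k i * negMulLog (s i)) := by
    intro i
    by_cases hi : s i = 0
    · simp [hi]
    · simp_rw [ENNReal.ofReal_mul' (hη0 i)]
      rw [ENNReal.tsum_mul_right, hcol i hi, one_mul]
  calc ∑ i ∈ F, ENNReal.ofReal (negMulLog (s i))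
      = ∑' k, ∑ i ∈ F, ENNReal.ofReal (d k i * negMulLog (s i)) := by
        rw [Summable.tsum_finsetSum fun i _ => ENNReal.summable]
        exact Finset.sum_congr rfl fun i _ => hexpand i
    _ ≤ _ := by
        refine ENNReal.tsum_le_tsum fun k => ?_
        rw [← ENNReal.ofReal_sum_of_nonneg fun i _ => mul_nonneg (hd0 k i) (hη0 i)]
        refine ENNReal.ofReal_le_ofReal ?_
        rw [hparseval]
        refine sum_mul_negMulLog_le (fun i _ => hd0 k i) (hdsum k) (fun i _ => hs0 i)
          (fun i _ => hs1 i) ?_ ?_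
        · have h1 := c.orthonormal.sum_inner_products_le (s := F) (e k)
          rw [e.orthonormal.1 k, one_pow] at h1
          exact mul_le_one₀ (hten k).2 (Finset.sum_nonneg fun i _ => by positivity) h1
        · rw [Finset.mul_sum]
          exact Finset.sum_congr rfl fun i _ => hds k i

/-- In a given basis, a suitable rotation of finitely many vectors yields a basis in which the
entropy of these diagonal entries of `T` exceeds the entropy of `T` by an arbitrarily small
amount. -/
theorem IsSubstate.eventually_exists_hilbertBasis {T : H →L[ℂ] H} (hT : IsSubstate T) {ι : Type*}
    (b : HilbertBasis ι ℂ H) (hfin : etaTrace T ≠ ⊤) {δ : ℝ} (hδ : 0 < δ) :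
    ∀ᶠ F : Finset ι in atTop, ∃ c : HilbertBasis ι ℂ H, (∀ i ∉ F, c i = b i) ∧
      ∑ i ∈ F, negMulLog (⟪c i, T (c i)⟫_ℂ).re ≤ (etaTrace T).toReal + δ := by
  obtain ⟨κ, e, t, he⟩ := exists_eigenbasis hT.1 hT.posTrace_ne_top
  have ht := fun k => hT.eigenvalue_mem (e.orthonormal.1 k) (he k)
  have hη : ∀ k, 0 ≤ negMulLog (t k) := fun k => negMulLog_nonneg (ht k).1 (ht k).2
  rw [etaTrace_eq_tsum hT.isSelfAdjoint he] at hfin ⊢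
  have hsη : Summable fun k => negMulLog (t k) :=
    (ENNReal.summable_toReal hfin).congr fun k => ENNReal.toReal_ofReal (hη k)
  have hst : Summable t := by
    have h1 := hT.posTrace_ne_top
    rw [posTrace_eq_tsum hT.1 e] at h1
    refine (ENNReal.summable_toReal h1).congr fun k => ?_
    rw [re_inner_eigenvector (e.orthonormal.1 k) (he k), ENNReal.toReal_ofReal (ht k).1]
  have hE : (∑' k, ENNReal.ofReal (negMulLog (t k))).toReal = ∑' k, negMulLog (t k) := by
    rw [← ENNReal.ofReal_tsum_of_nonneg hη hsη, ENNReal.toReal_ofReal (tsum_nonneg hη)]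
  rw [hE]
  set y : Finset ι → κ → ℝ := fun F k => t k * ∑ i ∈ F, ‖⟪b i, e k⟫_ℂ‖ ^ 2 with hy
  have hP0 : ∀ F k, 0 ≤ ∑ i ∈ F, ‖⟪b i, e k⟫_ℂ‖ ^ 2 := fun F k =>
    Finset.sum_nonneg fun i _ => by positivity
  have hP1 : ∀ F k, ∑ i ∈ F, ‖⟪b i, e k⟫_ℂ‖ ^ 2 ≤ 1 := fun F k => by
    have h1 := b.orthonormal.sum_inner_products_le (s := F) (e k)
    rwa [e.orthonormal.1 k, one_pow] at h1
  have hy0 : ∀ F k, 0 ≤ y F k := fun F k => mul_nonneg (ht k).1 (hP0 F k)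
  have hyt : ∀ F k, y F k ≤ t k := fun F k => mul_le_of_le_one_right (ht k).1 (hP1 F k)
  have hηy : ∀ F k, 0 ≤ negMulLog (y F k) := fun F k =>
    negMulLog_nonneg (hy0 F k) ((hyt F k).trans (ht k).2)
  have hbd : ∀ F k, negMulLog (y F k) ≤ negMulLog (t k) + t k := fun F k =>
    negMulLog_le_add_of_le (hy0 F k) (hyt F k) (ht k).2
  -- The projected lengths tend to one as `F` grows, and `η(t k) + t k` is a summable majorant.
  have hlim : Tendsto (fun F => ∑' k, negMulLog (y F k)) atTop (𝓝 (∑' k, negMulLog (t k))) := by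
    refine tendsto_tsum_of_dominated_convergence (hsη.add hst) (fun k => ?_)
      (Eventually.of_forall fun F k => ?_)
    · have h1 : Tendsto (fun F => y F k) atTop (𝓝 (t k * ‖e k‖ ^ 2)) :=
        (hasSum_norm_inner_sq b (e k)).const_mul (t k) |>.congr fun F => by
          rw [hy]
      rw [e.orthonormal.1 k, one_pow, mul_one] at h1
      exact (continuous_negMulLog.tendsto _).comp h1
    · rw [Real.norm_of_nonneg (hηy F k)]
      exact hbd F k
  filter_upwards [hlim.eventually_lt_const (lt_add_of_pos_right _ hδ)] with F hF
  obtain ⟨c, hcb, hc⟩ := hT.exists_hilbertBasis_sum_le b he F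
  refine ⟨c, hcb, le_trans ?_ hF.le⟩
  rw [← ENNReal.ofReal_tsum_of_nonneg (hηy F)
    (Summable.of_nonneg_of_le (hηy F) (hbd F) (hsη.add hst)),
    ← ENNReal.ofReal_sum_of_nonneg fun i _ => negMulLog_nonneg (re_inner_nonneg hT.1 _)
      (hT.re_inner_le_one (c.orthonormal.1 i)),
    ENNReal.ofReal_le_ofReal_iff (tsum_nonneg (hηy F))] at hc
  exact hc

end Compression

/-! ### A Dini-type criterion for continuity of series. -/

section Continuity

set_option linter.unusedSectionVars false

/-- A series of non-negative continuous functions is continuous if it is dominated by a series of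
continuous functions with a continuous sum. -/
theorem continuousOn_tsum_of_le {X ι : Type*} [TopologicalSpace X] {s : Set X} {f g : ι → X → ℝ}
    {G : X → ℝ} (hf0 : ∀ i, ∀ x ∈ s, 0 ≤ f i x) (hfg : ∀ i, ∀ x ∈ s, f i x ≤ g i x)
    (hf : ∀ i, ContinuousOn (f i) s) (hg : ∀ i, ContinuousOn (g i) s)
    (hgG : ∀ x ∈ s, HasSum (fun i => g i x) (G x)) (hG : ContinuousOn G s) :
    ContinuousOn (fun x => ∑' i, f i x) s := by
  have hsum : ∀ x ∈ s, Summable fun i => f i x := fun x hx =>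
    Summable.of_nonneg_of_le (fun i => hf0 i x hx) (fun i => hfg i x hx) (hgG x hx).summable
  have htail : ∀ x ∈ s, ∀ F : Finset ι, ∑' i, f i x - ∑ i ∈ F, f i x ≤ G x - ∑ i ∈ F, g i x := by
    intro x hx F
    have h1 := ((hgG x hx).sub (hsum x hx).hasSum)
    have h2 := sum_le_hasSum F (fun i _ => sub_nonneg.mpr (hfg i x hx)) h1
    rw [Finset.sum_sub_distrib] at h2
    linarith
  -- The tail of `f` is below the tail `G - ∑ g` over the same finite set. The latter is continuous
  -- and small at `x`, hence small near `x`, and enlarging the set only shrinks the tail of `f`.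
  have hloc : TendstoLocallyUniformlyOn (fun (F : Finset ι) x => ∑ i ∈ F, f i x)
      (fun x => ∑' i, f i x) atTop s := by
    rw [Metric.tendstoLocallyUniformlyOn_iff]
    intro ε hε x hx
    have h1 : ∀ᶠ F : Finset ι in atTop, G x - ε < ∑ i ∈ F, g i x :=
      (hgG x hx).eventually_const_lt (by linarith)
    obtain ⟨F, hF⟩ := h1.exists
    have hc : ContinuousOn (fun x => G x - ∑ i ∈ F, g i x) s :=
      hG.sub (continuousOn_finsetSum F fun i _ => hg i)
    refine ⟨{y | G y - ∑ i ∈ F, g i y < ε} ∩ s,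
      inter_mem ((hc x hx).eventually_lt_const (by linarith)) self_mem_nhdsWithin, ?_⟩
    refine (eventually_ge_atTop F).mono fun F' hF' y hy => ?_
    have h2 := sum_le_hasSum F' (fun i _ => hf0 i y hy.2) (hsum y hy.2).hasSum
    have h3 := htail y hy.2 F
    have h4 : ∑ i ∈ F, f i y ≤ ∑ i ∈ F', f i y :=
      Finset.sum_le_sum_of_subset_of_nonneg hF' fun i _ _ => hf0 i y hy.2
    rw [Real.dist_eq, abs_of_nonneg (by linarith)]
    have h5 : G y - ∑ i ∈ F, g i y < ε := hy.1
    linarith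
  exact hloc.continuousOn (Frequently.of_forall fun F => continuousOn_finsetSum F fun i _ => hf i)

end Continuity

/-! ### Continuity of the output entropies and the equivalences. -/

section MainTheorem

set_option linter.unusedSectionVars false

open TraceClass Real

variable {H : Type u} [NormedAddCommGroup H] [InnerProductSpace ℂ H] [CompleteSpace H]
variable {K : Type v} [NormedAddCommGroup K] [InnerProductSpace ℂ K] [CompleteSpace K]

/-- Polarization with unit vectors: the four squared norms sum to `8`, which divided by `4` gives
the factor `2`. -/
theorem norm_le_of_norm_inner_self_le {T : H →L[ℂ] H} {δ : ℝ} (hδ : 0 ≤ δ)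
    (h : ∀ x, ‖⟪T x, x⟫_ℂ‖ ≤ δ * ‖x‖ ^ 2) : ‖T‖ ≤ 2 * δ := by
  refine ContinuousLinearMap.opNorm_le_of_unit_norm (by positivity) fun y hy => ?_
  rcases eq_or_ne (T y) 0 with h0 | h0
  · rw [h0, norm_zero]; positivity
  have hn : 0 < ‖T y‖ := norm_pos_iff.mpr h0
  set x : H := ((‖T y‖ : ℂ)⁻¹) • T y with hx
  have hx1 : ‖x‖ = 1 := by
    rw [hx, norm_smul, norm_inv, Complex.norm_real, norm_norm, inv_mul_cancel₀ hn.ne']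
  have h1 : ‖⟪T y, x⟫_ℂ‖ = ‖T y‖ := by
    rw [hx, inner_smul_right, inner_self_eq_norm_sq_to_K, norm_mul, norm_inv, norm_pow,
      Complex.norm_real, RCLike.norm_ofReal, norm_norm, abs_norm]
    field_simp
  have h2 := inner_map_polarization (T : H →ₗ[ℂ] H) x y
  simp only [ContinuousLinearMap.coe_coe] at h2
  have p1 := parallelogram_law_with_norm ℂ x y
  have p2 := parallelogram_law_with_norm ℂ x (Complex.I • y)
  rw [norm_smul Complex.I y, Complex.norm_I, one_mul] at p2
  rw [hx1, hy] at p1 p2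
  rw [← h1, h2, norm_div]
  have h4 : ‖(4 : ℂ)‖ = 4 := by simp
  rw [h4, div_le_iff₀ (by norm_num)]
  refine (norm_sub_le _ _).trans ?_
  refine (add_le_add ((norm_add_le _ _).trans (add_le_add (norm_sub_le _ _) le_rfl)) le_rfl).trans ?_
  rw [norm_mul, norm_mul, Complex.norm_I, one_mul, one_mul]
  refine (add_le_add (add_le_add (add_le_add (h _) (h _)) (h _)) (h _)).trans ?_
  linear_combination δ * p1 + δ * p2

theorem continuousBoundedOn_of_eq {X : Type*} [TopologicalSpace X] {f : X → EReal} {g : X → ℝ}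
    {s : Set X} {C : ℝ} (hg : ContinuousOn g s) (hC : ∀ x ∈ s, |g x| ≤ C)
    (hfg : ∀ x ∈ s, f x = (g x : EReal)) : ContinuousBoundedOn f s := by
  refine ⟨(continuous_coe_real_ereal.comp_continuousOn hg).congr hfg, C, fun x hx => ?_⟩
  obtain ⟨h1, h2⟩ := abs_le.mp (hC x hx)
  rw [hfg x hx]
  exact ⟨by rw [← EReal.coe_neg]; exact EReal.coe_le_coe_iff.mpr h1, EReal.coe_le_coe_iff.mpr h2⟩

theorem ContinuousBoundedOn.finiteOn {X : Type*} [TopologicalSpace X] {f : X → EReal} {s : Set X}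
    (h : ContinuousBoundedOn f s) : FiniteOn f s := by
  obtain ⟨-, C, hC⟩ := h
  intro x hx
  obtain ⟨h1, h2⟩ := hC x hx
  refine ⟨fun h0 => ?_, fun h0 => ?_⟩
  · rw [h0, ← EReal.coe_neg, le_bot_iff] at h1
    exact EReal.coe_ne_bot _ h1
  · rw [h0, top_le_iff] at h2
    exact EReal.coe_ne_top _ h2

theorem hasSum_diagonal {A : TraceClass H} (hA : A ∈ posCone H) {ι : Type*}
    (b : HilbertBasis ι ℂ H) : HasSum (fun i => (⟪b i, A.toCLM (b i)⟫_ℂ).re) A.tr.re := by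
  have h1 := posTrace_toCLM_ne_top hA
  rw [posTrace_eq_tsum hA b] at h1
  have h2 := ENNReal.hasSum_toReal h1
  rw [← ENNReal.tsum_toReal_eq (ENNReal.ne_top_of_tsum_ne_top h1), ← posTrace_eq_tsum hA b,
    ← traceNorm_of_nonneg hA, ← norm_def, norm_eq_tr hA] at h2
  exact h2.congr_fun fun i => (ENNReal.toReal_ofReal (re_inner_nonneg hA _)).symm

namespace PosTraceNonincMap

variable (Φ : PosTraceNonincMap H K)

theorem tr_map_mem {ρ : TraceClass H} (hρ : ρ ∈ states H) :
    0 ≤ (Φ ρ).tr.re ∧ (Φ ρ).tr.re ≤ 1 := by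
  rw [← norm_eq_tr (Φ.map_mem_posCone ρ hρ.1)]
  exact ⟨norm_nonneg _, (Φ.norm_map_le hρ.1).trans_eq (norm_of_mem_states hρ)⟩

theorem negMulLog_tr_map_mem {ρ : TraceClass H} (hρ : ρ ∈ states H) :
    0 ≤ negMulLog (Φ ρ).tr.re ∧ negMulLog (Φ ρ).tr.re ≤ 1 := by
  obtain ⟨h0, h1⟩ := Φ.tr_map_mem hρ
  exact ⟨negMulLog_nonneg h0 h1, (negMulLog_le_one_sub_self h0).trans (by linarith)⟩

theorem continuousOn_inner_map (y : K) :
    ContinuousOn (fun ρ => (⟪y, (Φ ρ).toCLM y⟫_ℂ).re) (states H) :=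
  (Complex.continuous_re.comp (continuous_pairing (Φ.dual (InnerProductSpace.rankOne ℂ y y))))
    |>.continuousOn.congr fun ρ hρ => by
      rw [Function.comp_apply, Φ.pairing_dual_rankOne y hρ.1]

theorem continuousOn_tr_map : ContinuousOn (fun ρ => (Φ ρ).tr.re) (states H) :=
  (Complex.continuous_re.comp (continuous_pairing (Φ.dual 1))).continuousOn.congr fun ρ hρ => by
    rw [Function.comp_apply, Φ.pairing_dual 1 hρ.1, tr_eq_pairing]

theorem norm_dual_rankOne_le (y : K) :
    ‖Φ.dual (InnerProductSpace.rankOne ℂ y y)‖ ≤ ‖y‖ ^ 2 := by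
  refine norm_le_of_re_inner_le (Φ.dual_rankOne_nonneg y) (by positivity) fun x hx => ?_
  rw [Φ.inner_dual_rankOne]
  refine (Complex.re_le_norm _).trans ((norm_inner_le _ _ _).trans ?_)
  have h1 : ‖Φ (rankOne x x)‖ ≤ 1 := by
    refine (Φ.norm_map_le (toCLM_rankOne_self_nonneg x)).trans_eq ?_
    rw [norm_eq_tr (toCLM_rankOne_self_nonneg x), tr_rankOne_self, hx, one_pow]
  calc ‖y‖ * ‖y‖ * ‖Φ (rankOne x x)‖ ≤ ‖y‖ * ‖y‖ * 1 := by gcongr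
    _ = ‖y‖ ^ 2 := by ring

/-- The quadratic form of `Φ ρ - Φ σ` at `y` is the pairing of `ρ - σ` with `Φ*(|y⟩⟨y|)`, of norm at
most `‖y‖²`. Operator-norm continuity is enough for the functional calculus. -/
theorem continuousOn_toCLM_map : ContinuousOn (fun ρ => (Φ ρ).toCLM) (states H) := by
  have h : LipschitzOnWith 2 (fun ρ => (Φ ρ).toCLM) (states H) := by
    refine LipschitzOnWith.of_dist_le_mul fun ρ hρ σ hσ => ?_
    rw [dist_eq_norm, dist_eq_norm]
    refine norm_le_of_norm_inner_self_le (norm_nonneg _) fun y => ?_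
    have h1 : ⟪y, ((Φ ρ).toCLM - (Φ σ).toCLM) y⟫_ℂ =
        pairing (Φ.dual (InnerProductSpace.rankOne ℂ y y)) (ρ - σ) := by
      rw [sub_apply, inner_sub_right, map_sub, Φ.pairing_dual_rankOne y hρ.1,
        Φ.pairing_dual_rankOne y hσ.1]
    rw [norm_inner_symm, h1, mul_comm]
    refine (norm_pairing_le _ _).trans ?_
    gcongr
    exact Φ.norm_dual_rankOne_le y
  exact h.continuousOn

/-- Strong convergence gives the sum on vectors only. Writing `ρ` through the vectors `√ρ e j`
yields a double series of non-negative terms, whose order of summation can be exchanged. -/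
theorem hasSum_weights {ι : Type*} {b : HilbertBasis ι ℂ K} {h : ι → ℝ} (hh : ∀ i, 0 ≤ h i)
    {S : H →L[ℂ] H} (hS : ∀ x : H,
      HasSum (fun i => h i • Φ.dual (InnerProductSpace.rankOne ℂ (b i) (b i)) x) (S x))
    {ρ : TraceClass H} (hρ : ρ ∈ posCone H) :
    HasSum (fun i => h i * (⟪b i, (Φ ρ).toCLM (b i)⟫_ℂ).re) (pairing S ρ).re := by
  set D : ι → H →L[ℂ] H := fun i => Φ.dual (InnerProductSpace.rankOne ℂ (b i) (b i)) with hD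
  have hDnn : ∀ i, 0 ≤ D i := fun i => Φ.dual_rankOne_nonneg _
  have hSx : ∀ x, HasSum (fun i => h i * (⟪x, D i x⟫_ℂ).re) (⟪x, S x⟫_ℂ).re := by
    intro x
    have h1 := Complex.hasSum_re ((hS x).mapL (innerSL ℂ x))
    refine h1.congr_fun fun i => ?_
    rw [innerSL_apply_apply, inner_smul_right_eq_smul, Complex.smul_re, smul_eq_mul]
  have hSnn : ∀ x, 0 ≤ (⟪x, S x⟫_ℂ).re := fun x =>
    (hSx x).nonneg fun i => mul_nonneg (hh i) (re_inner_nonneg (hDnn i) x)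
  have hofReal : ∀ B : H →L[ℂ] H, (∀ x, 0 ≤ (⟪x, B x⟫_ℂ).re) →
      0 ≤ (pairing B ρ).re ∧ ENNReal.ofReal (pairing B ρ).re = ∑' j, ENNReal.ofReal
        (⟪CFC.sqrt ρ.toCLM (stdBasis H j), B (CFC.sqrt ρ.toCLM (stdBasis H j))⟫_ℂ).re := by
    intro B hB
    have h1 := Complex.hasSum_re (hasSum_pairing hρ B (stdBasis H))
    refine ⟨h1.nonneg fun j => hB _, ?_⟩
    rw [← ENNReal.ofReal_tsum_of_nonneg (fun j => hB _) h1.summable, h1.tsum_eq]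
  have hp : ∀ i, (pairing (D i) ρ).re = (⟪b i, (Φ ρ).toCLM (b i)⟫_ℂ).re := fun i => by
    rw [hD, Φ.pairing_dual_rankOne _ hρ]
  have hnn : ∀ i, 0 ≤ h i * (⟪b i, (Φ ρ).toCLM (b i)⟫_ℂ).re := fun i =>
    mul_nonneg (hh i) (re_inner_nonneg (Φ.map_mem_posCone ρ hρ) _)
  have key : ∑' i, ENNReal.ofReal (h i * (⟪b i, (Φ ρ).toCLM (b i)⟫_ℂ).re) =
      ENNReal.ofReal (pairing S ρ).re := by
    rw [(hofReal S hSnn).2]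
    have h1 : ∀ i, ENNReal.ofReal (h i * (⟪b i, (Φ ρ).toCLM (b i)⟫_ℂ).re) =
        ∑' j, ENNReal.ofReal (h i * (⟪CFC.sqrt ρ.toCLM (stdBasis H j),
          D i (CFC.sqrt ρ.toCLM (stdBasis H j))⟫_ℂ).re) := by
      intro i
      rw [← hp, ENNReal.ofReal_mul (hh i), (hofReal (D i) (re_inner_nonneg (hDnn i))).2,
        ← ENNReal.tsum_mul_left]
      simp_rw [ENNReal.ofReal_mul (hh i)]
    simp_rw [h1]
    rw [ENNReal.tsum_comm]
    refine tsum_congr fun j => ?_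
    rw [← ENNReal.ofReal_tsum_of_nonneg
      (fun i => mul_nonneg (hh i) (re_inner_nonneg (hDnn i) _)) (hSx _).summable, (hSx _).tsum_eq]
  have hne : ∑' i, ENNReal.ofReal (h i * (⟪b i, (Φ ρ).toCLM (b i)⟫_ℂ).re) ≠ ⊤ := by
    rw [key]; exact ENNReal.ofReal_ne_top
  have h2 := ENNReal.hasSum_toReal hne
  rw [← ENNReal.tsum_toReal_eq (ENNReal.ne_top_of_tsum_ne_top hne), key,
    ENNReal.toReal_ofReal (hofReal S hSnn).1] at h2
  exact h2.congr_fun fun i => (ENNReal.toReal_ofReal (hnn i)).symm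

/-- Under the weight condition the diagonal of the output has a uniformly bounded entropy, which is
a continuous function of the state. -/
theorem exists_diagonal_entropy_bound {ι : Type*} {b : HilbertBasis ι ℂ K} {h : ι → ℝ}
    (hh : ∀ i, 0 ≤ h i) {S : H →L[ℂ] H} (hS : ∀ x : H,
      HasSum (fun i => h i • Φ.dual (InnerProductSpace.rankOne ℂ (b i) (b i)) x) (S x))
    (hexp : Summable fun i => exp (-h i)) :
    (∃ C : ℝ, ∀ ρ ∈ states H,
      (Summable fun i => negMulLog (⟪b i, (Φ ρ).toCLM (b i)⟫_ℂ).re) ∧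
      ∑' i, negMulLog (⟪b i, (Φ ρ).toCLM (b i)⟫_ℂ).re ≤ C) ∧
    ContinuousOn (fun ρ => ∑' i, negMulLog (⟪b i, (Φ ρ).toCLM (b i)⟫_ℂ).re) (states H) := by
  have hp0 : ∀ i, ∀ ρ ∈ states H, 0 ≤ (⟪b i, (Φ ρ).toCLM (b i)⟫_ℂ).re := fun i ρ hρ =>
    re_inner_nonneg (Φ.isSubstate_map hρ).1 _
  have hp1 : ∀ i, ∀ ρ ∈ states H, (⟪b i, (Φ ρ).toCLM (b i)⟫_ℂ).re ≤ 1 := fun i ρ hρ =>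
    (Φ.isSubstate_map hρ).re_inner_le_one (b.orthonormal.1 i)
  have hη0 : ∀ i, ∀ ρ ∈ states H, 0 ≤ negMulLog (⟪b i, (Φ ρ).toCLM (b i)⟫_ℂ).re :=
    fun i ρ hρ => negMulLog_nonneg (hp0 i ρ hρ) (hp1 i ρ hρ)
  have hle : ∀ i, ∀ ρ ∈ states H, negMulLog (⟪b i, (Φ ρ).toCLM (b i)⟫_ℂ).re ≤
      h i * (⟪b i, (Φ ρ).toCLM (b i)⟫_ℂ).re + exp (-h i) := by
    intro i ρ hρ
    -- `q = exp (-h i)` is at most one because `h i ≥ 0`, and makes `-log q` the weight.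
    have h1 := negMulLog_add_sq_le (hp0 i ρ hρ) (hp1 i ρ hρ) (exp_pos (-h i))
      (exp_le_one_iff.mpr (by linarith [hh i]))
    rw [log_exp, neg_neg] at h1
    nlinarith [sq_nonneg ((⟪b i, (Φ ρ).toCLM (b i)⟫_ℂ).re - exp (-h i)), hp0 i ρ hρ]
  have hG : ∀ ρ ∈ states H, HasSum (fun i => h i * (⟪b i, (Φ ρ).toCLM (b i)⟫_ℂ).re + exp (-h i))
      ((pairing S ρ).re + ∑' i, exp (-h i)) := fun ρ hρ =>
    (Φ.hasSum_weights hh hS hρ.1).add hexp.hasSum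
  refine ⟨⟨‖S‖ + ∑' i, exp (-h i), fun ρ hρ => ?_⟩, ?_⟩
  · have hsum : Summable fun i => negMulLog (⟪b i, (Φ ρ).toCLM (b i)⟫_ℂ).re :=
      Summable.of_nonneg_of_le (fun i => hη0 i ρ hρ) (fun i => hle i ρ hρ) (hG ρ hρ).summable
    refine ⟨hsum, (hsum.tsum_le_tsum (fun i => hle i ρ hρ) (hG ρ hρ).summable).trans ?_⟩
    rw [(hG ρ hρ).tsum_eq]
    gcongr
    refine (Complex.re_le_norm _).trans ((norm_pairing_le _ _).trans_eq ?_)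
    rw [norm_of_mem_states hρ, mul_one]
  · refine continuousOn_tsum_of_le hη0 hle
      (fun i => continuous_negMulLog.comp_continuousOn (Φ.continuousOn_inner_map _))
      (fun i => ((Φ.continuousOn_inner_map _).const_smul (h i)).add continuousOn_const) hG
      ((Complex.continuous_re.comp (continuous_pairing S)).continuousOn.add continuousOn_const)

variable {Φ}

theorem HasSummableDualWeights.hasContinuousDiagonalEntropy (hΦ : Φ.HasSummableDualWeights) :
    Φ.HasContinuousDiagonalEntropy := by
  obtain ⟨ι, b, h, hh, ⟨S, hS⟩, hexp⟩ := hΦ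
  obtain ⟨⟨C, hC⟩, hcont⟩ := Φ.exists_diagonal_entropy_bound hh hS hexp
  have hp0 : ∀ i, ∀ ρ ∈ states H, 0 ≤ (⟪b i, (Φ ρ).toCLM (b i)⟫_ℂ).re := fun i ρ hρ =>
    re_inner_nonneg (Φ.isSubstate_map hρ).1 _
  have hp1 : ∀ i, ∀ ρ ∈ states H, (⟪b i, (Φ ρ).toCLM (b i)⟫_ℂ).re ≤ 1 := fun i ρ hρ =>
    (Φ.isSubstate_map hρ).re_inner_le_one (b.orthonormal.1 i)
  have hη0 : ∀ i, ∀ ρ ∈ states H, 0 ≤ negMulLog (⟪b i, (Φ ρ).toCLM (b i)⟫_ℂ).re :=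
    fun i ρ hρ => negMulLog_nonneg (hp0 i ρ hρ) (hp1 i ρ hρ)
  refine ⟨ι, b, continuousBoundedOn_of_eq (C := |C| + 1)
    (g := fun ρ => ∑' i, negMulLog (⟪b i, (Φ ρ).toCLM (b i)⟫_ℂ).re - negMulLog (Φ ρ).tr.re)
    (hcont.sub (continuous_negMulLog.comp_continuousOn Φ.continuousOn_tr_map)) (fun ρ hρ => ?_)
    fun ρ hρ => ?_⟩
  · obtain ⟨h0, h1⟩ := Φ.negMulLog_tr_map_mem hρ
    have h2 := (hC ρ hρ).2
    have h3 : 0 ≤ ∑' i, negMulLog (⟪b i, (Φ ρ).toCLM (b i)⟫_ℂ).re := tsum_nonneg fun i => hη0 i ρ hρ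
    rw [abs_le]
    constructor <;> linarith [le_abs_self C, abs_nonneg C]
  · rw [classicalEntropy_eq (fun i => hp0 i ρ hρ) (fun i => hp1 i ρ hρ),
      (hasSum_diagonal (Φ.map_mem_posCone ρ hρ.1) b).tsum_eq,
      ← ENNReal.ofReal_tsum_of_nonneg (fun i => hη0 i ρ hρ) (hC ρ hρ).1, EReal.coe_ennreal_ofReal,
      max_eq_left (tsum_nonneg fun i => hη0 i ρ hρ), EReal.coe_sub]

/-- An output of infinite entropy would have infinite diagonal entropy in every basis. -/
theorem HasContinuousDiagonalEntropy.finiteOn (hΦ : Φ.HasContinuousDiagonalEntropy) :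
    FiniteOn Φ.outputEntropy (states H) := by
  obtain ⟨ι, b, hb⟩ := hΦ
  intro ρ hρ
  have hsub := Φ.isSubstate_map hρ
  refine (entropy_finite_iff hsub.1).mpr fun h0 => ?_
  have h1 := (hb.finiteOn ρ hρ).2
  have h2 := hsub.etaTrace_le_tsum b
  rw [h0, top_le_iff] at h2
  rw [classicalEntropy_eq (fun i => re_inner_nonneg hsub.1 _)
    (fun i => hsub.re_inner_le_one (b.orthonormal.1 i)),
    h2] at h1
  refine h1 ?_
  rw [EReal.coe_ennreal_top, EReal.top_sub_coe]

theorem HasSummableDualWeights.continuousBoundedOn (hΦ : Φ.HasSummableDualWeights) :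
    ContinuousBoundedOn Φ.outputEntropy (states H) := by
  obtain ⟨ι, b, h, hh, ⟨S, hS⟩, hexp⟩ := hΦ
  obtain ⟨⟨C, hC⟩, hcont⟩ := Φ.exists_diagonal_entropy_bound hh hS hexp
  have hη0 : ∀ c : HilbertBasis ι ℂ K, ∀ i, ∀ ρ ∈ states H,
      0 ≤ negMulLog (⟪c i, (Φ ρ).toCLM (c i)⟫_ℂ).re := fun c i ρ hρ =>
    negMulLog_nonneg (re_inner_nonneg (Φ.isSubstate_map hρ).1 _)
      ((Φ.isSubstate_map hρ).re_inner_le_one (c.orthonormal.1 i))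
  have hηcont : ∀ c : HilbertBasis ι ℂ K, ∀ i,
      ContinuousOn (fun ρ => negMulLog (⟪c i, (Φ ρ).toCLM (c i)⟫_ℂ).re) (states H) := fun c i =>
    continuous_negMulLog.comp_continuousOn (Φ.continuousOn_inner_map _)
  have hle : ∀ ρ ∈ states H, etaTrace (Φ ρ).toCLM ≤ ENNReal.ofReal C := by
    intro ρ hρ
    refine ((Φ.isSubstate_map hρ).etaTrace_le_tsum b).trans ?_
    rw [← ENNReal.ofReal_tsum_of_nonneg (fun i => hη0 b i ρ hρ) (hC ρ hρ).1]
    exact ENNReal.ofReal_le_ofReal (hC ρ hρ).2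
  have hfin : ∀ ρ ∈ states H, etaTrace (Φ ρ).toCLM ≠ ⊤ := fun ρ hρ =>
    ((hle ρ hρ).trans_lt ENNReal.ofReal_lt_top).ne
  have hlower : LowerSemicontinuousOn (fun ρ => etaTrace (Φ ρ).toCLM) (states H) := by
    -- Each diagonal entry of `η(Φ(ρ))` is continuous in `ρ` and non-negative.
    refine lowerSemicontinuousOn_tsum fun i => ContinuousOn.lowerSemicontinuousOn fun ρ hρ => ?_
    have h1 : Tendsto (fun σ => cfc etaPos (Φ σ).toCLM) (𝓝[states H] ρ)
        (𝓝 (cfc etaPos (Φ ρ).toCLM)) :=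
      Filter.Tendsto.cfc (a := fun σ => (Φ σ).toCLM) isCompact_Icc etaPos (Φ.continuousOn_toCLM_map ρ hρ)
        ((eventually_mem_nhdsWithin (a := ρ) (s := states H)).mono fun σ hσ => (Φ.isSubstate_map hσ).spectrum_subset)
        ((eventually_mem_nhdsWithin (a := ρ) (s := states H)).mono fun σ hσ => (Φ.isSubstate_map hσ).isSelfAdjoint)
        (Φ.isSubstate_map hρ).spectrum_subset (Φ.isSubstate_map hρ).isSelfAdjoint
        continuous_etaPos.continuousOn
    exact ENNReal.tendsto_ofReal (tendsto_re_inner h1 _)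
  have hupper : UpperSemicontinuousOn (fun ρ => etaTrace (Φ ρ).toCLM) (states H) := by
    intro ρ hρ y hy
    obtain ⟨δ, hδ, hδy⟩ : ∃ δ : ℝ, 0 < δ ∧
        ENNReal.ofReal ((etaTrace (Φ ρ).toCLM).toReal + 2 * δ) ≤ y := by
      obtain ⟨r, hr1, hr2⟩ := ENNReal.lt_iff_exists_real_btwn.mp hy |>.imp fun r hr => hr.2
      have h1 : (etaTrace (Φ ρ).toCLM).toReal < r := by
        refine (ENNReal.lt_ofReal_iff_toReal_lt (hfin ρ hρ)).mp hr1
      refine ⟨(r - (etaTrace (Φ ρ).toCLM).toReal) / 2, by linarith, ?_⟩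
      rw [mul_div_cancel₀ _ two_ne_zero, add_sub_cancel]
      exact hr2.le
    have htail : ∀ᶠ F : Finset ι in atTop,
        ∑' i, negMulLog (⟪b i, (Φ ρ).toCLM (b i)⟫_ℂ).re - δ <
          ∑ i ∈ F, negMulLog (⟪b i, (Φ ρ).toCLM (b i)⟫_ℂ).re :=
      (hC ρ hρ).1.hasSum.eventually_const_lt (by linarith)
    obtain ⟨F, hF, c, hcb, hcF⟩ := (htail.and
      ((Φ.isSubstate_map hρ).eventually_exists_hilbertBasis b (hfin ρ hρ) hδ)).exists
    -- `U` is the diagonal entropy in the basis `c`, written with the tail in `b` so that its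
    -- continuity is visible. At `ρ` the block over `F` costs `δ` above `Tr η(Φ(ρ))` and the tail
    -- less than `δ`.
    set U : TraceClass H → ℝ := fun σ => ∑ i ∈ F, negMulLog (⟪c i, (Φ σ).toCLM (c i)⟫_ℂ).re +
      (∑' i, negMulLog (⟪b i, (Φ σ).toCLM (b i)⟫_ℂ).re -
        ∑ i ∈ F, negMulLog (⟪b i, (Φ σ).toCLM (b i)⟫_ℂ).re) with hU
    have hUcont : ContinuousOn U (states H) :=
      (continuousOn_finsetSum F fun i _ => hηcont c i).add
        (hcont.sub (continuousOn_finsetSum F fun i _ => hηcont b i))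
    have hUle : ∀ σ ∈ states H, etaTrace (Φ σ).toCLM ≤ ENNReal.ofReal (U σ) := by
      intro σ hσ
      have h1 := (hC σ hσ).1
      have htl : ∀ i : {i // i ∉ F}, negMulLog (⟪c i, (Φ σ).toCLM (c i)⟫_ℂ).re =
          negMulLog (⟪b i, (Φ σ).toCLM (b i)⟫_ℂ).re := fun i => by rw [hcb i i.2]
      have h2 : Summable fun i => negMulLog (⟪c i, (Φ σ).toCLM (c i)⟫_ℂ).re :=
        F.summable_compl_iff.mp ((F.summable_compl_iff.mpr h1).congr fun i => (htl i).symm)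
      have h3 : U σ = ∑' i, negMulLog (⟪c i, (Φ σ).toCLM (c i)⟫_ℂ).re := by
        rw [hU]
        simp only
        rw [← h1.sum_add_tsum_subtype_compl F, ← h2.sum_add_tsum_subtype_compl F, tsum_congr htl]
        ring
      refine ((Φ.isSubstate_map hσ).etaTrace_le_tsum c).trans ?_
      rw [h3, ENNReal.ofReal_tsum_of_nonneg (fun i => hη0 c i σ hσ) h2]
    have hUρ : U ρ < (etaTrace (Φ ρ).toCLM).toReal + 2 * δ := by
      rw [hU]
      simp only
      linarith
    filter_upwards [(hUcont ρ hρ).eventually_lt_const hUρ, self_mem_nhdsWithin] with σ h1 hσ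
    refine (hUle σ hσ).trans_lt (lt_of_lt_of_le ?_ hδy)
    exact (ENNReal.ofReal_lt_ofReal_iff (by positivity)).mpr h1
  have hcontη : ContinuousOn (fun ρ => etaTrace (Φ ρ).toCLM) (states H) :=
    continuousOn_iff_lower_upperSemicontinuousOn.mpr ⟨hlower, hupper⟩
  have hreal : ContinuousOn (fun ρ => (etaTrace (Φ ρ).toCLM).toReal) (states H) := fun ρ hρ =>
    (ENNReal.tendsto_toReal (hfin ρ hρ)).comp (hcontη ρ hρ)
  refine continuousBoundedOn_of_eq (C := |C| + 1)
    (g := fun ρ => (etaTrace (Φ ρ).toCLM).toReal - negMulLog (Φ ρ).tr.re)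
    (hreal.sub (continuous_negMulLog.comp_continuousOn Φ.continuousOn_tr_map)) (fun ρ hρ => ?_)
    fun ρ hρ => ?_
  · obtain ⟨h0, h1⟩ := Φ.negMulLog_tr_map_mem hρ
    have h2 : (etaTrace (Φ ρ).toCLM).toReal ≤ |C| :=
      ENNReal.toReal_le_of_le_ofReal (abs_nonneg C)
        ((hle ρ hρ).trans (ENNReal.ofReal_le_ofReal (le_abs_self C)))
    have h3 : 0 ≤ (etaTrace (Φ ρ).toCLM).toReal := ENNReal.toReal_nonneg
    rw [abs_le]
    constructor <;> linarith [abs_nonneg C]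
  · rw [outputEntropy, entropy_eq_of_isSubstate (Φ.isSubstate_map hρ), EReal.coe_sub,
      ← EReal.toReal_coe_ennreal,
      EReal.coe_toReal (EReal.coe_ennreal_eq_top_iff.not.mpr (hfin ρ hρ)) (EReal.coe_ennreal_ne_bot _)]

/-- If the output entropy is finite on states, it is finite on all positive operators. -/
theorem finiteOn_of_finiteOn_states (hΦ : FiniteOn Φ.outputEntropy (states H))
    {𝒜 : Set (TraceClass H)} (hpos : 𝒜 ⊆ posCone H) : FiniteOn Φ.outputEntropy 𝒜 := by
  intro A hA
  refine (entropy_finite_iff (Φ.map_mem_posCone A (hpos hA))).mpr ?_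
  rcases eq_or_ne A 0 with rfl | h0
  · rw [map_zero, map_zero]
    have h1 := etaTrace_smul_le (T := (0 : K →L[ℂ] K)) le_rfl (μ := 0) le_rfl
    rw [smul_zero, ENNReal.ofReal_zero, zero_mul, zero_add] at h1
    refine ne_top_of_le_ne_top ?_ h1
    simp [posTrace]
  obtain ⟨ρ, hρ, hAρ⟩ := exists_state_smul (hpos hA) h0
  have h1 : (Φ A).toCLM = ‖A‖ • (Φ ρ).toCLM := by
    conv_lhs => rw [hAρ]
    rw [map_smul_real, toCLM_smul_real]
  have hρ' := (entropy_finite_iff (Φ.map_mem_posCone ρ hρ.1)).mp (hΦ ρ hρ)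
  rw [h1]
  refine ne_top_of_le_ne_top ?_ (etaTrace_smul_le (Φ.isSubstate_map hρ).1 (norm_nonneg A))
  exact ENNReal.add_ne_top.mpr ⟨ENNReal.mul_ne_top ENNReal.ofReal_ne_top hρ',
    ENNReal.mul_ne_top ENNReal.ofReal_ne_top (Φ.isSubstate_map hρ).posTrace_ne_top⟩

variable (Φ)

/-- The characterization of finiteness of the output entropy on a set that detects boundedness. -/
theorem tfae_outputEntropy [TopologicalSpace.SeparableSpace K] {𝒜 : Set (TraceClass H)}
    (hpos : 𝒜 ⊆ posCone H) (hconv : Convex ℝ 𝒜) (hclosed : IsClosed 𝒜)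
    (hbdd : Bornology.IsBounded 𝒜) (hdet : Φ.DetectsBoundedness 𝒜) :
    List.TFAE [FiniteOn Φ.outputEntropy 𝒜, ContinuousBoundedOn Φ.outputEntropy (states H),
      Φ.HasContinuousDiagonalEntropy, Φ.HasSummableDualWeights] := by
  tfae_have 1 → 4 := Φ.hasSummableDualWeights_of_finiteOn hpos hconv hclosed hbdd hdet
  tfae_have 4 → 3 := fun h => h.hasContinuousDiagonalEntropy
  tfae_have 4 → 2 := fun h => h.continuousBoundedOn
  tfae_have 3 → 1 := fun h => finiteOn_of_finiteOn_states h.finiteOn hpos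
  tfae_have 2 → 1 := fun h => finiteOn_of_finiteOn_states h.finiteOn hpos
  tfae_finish

end PosTraceNonincMap

end MainTheorem

end QuantumEntropy

end

theorem theorem1
    {H : Type*} [NormedAddCommGroup H] [InnerProductSpace ℂ H] [CompleteSpace H]
    [TopologicalSpace.SeparableSpace H]
    {K : Type*} [NormedAddCommGroup K] [InnerProductSpace ℂ K] [CompleteSpace K]
    [TopologicalSpace.SeparableSpace K]
    (Φ : QuantumEntropy.PosTraceNonincMap H K) :
    List.TFAE
      [QuantumEntropy.FiniteOn Φ.outputEntropy (QuantumEntropy.states H),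
        QuantumEntropy.ContinuousBoundedOn Φ.outputEntropy (QuantumEntropy.states H),
        Φ.HasContinuousDiagonalEntropy,
        Φ.HasSummableDualWeights] ∧
    ∀ 𝒜 : Set (QuantumEntropy.TraceClass H), 𝒜 ⊆ QuantumEntropy.posCone H →
      Convex ℝ 𝒜 → IsClosed 𝒜 → Bornology.IsBounded 𝒜 → Φ.DetectsBoundedness 𝒜 →
      List.TFAE
        [QuantumEntropy.FiniteOn Φ.outputEntropy 𝒜,
          QuantumEntropy.ContinuousBoundedOn Φ.outputEntropy (QuantumEntropy.states H),
          Φ.HasContinuousDiagonalEntropy,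
          Φ.HasSummableDualWeights] := by
  -- The first equivalence is the second for the set of states, which itself detects boundedness.
  exact ⟨Φ.tfae_outputEntropy (fun _ h => h.1) QuantumEntropy.convex_states
      QuantumEntropy.isClosed_states QuantumEntropy.isBounded_states Φ.detectsBoundedness_states,
    fun 𝒜 hpos hconv hclosed hbdd hdet => Φ.tfae_outputEntropy hpos hconv hclosed hbdd hdet⟩
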